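/- Let $n\ge 2$, $0<\alpha<1$, $0<s<1$, $T>0$, let $\Omega\subset\mathbb{R}^n$ be a bounded domain with smooth boundary and $\Omega_e:=\mathbb{R}^n\setminus\overline\Omega$. Let $$a(x,t,z)=\sum_{k=1}^m a_k(x,t)\,|z|^{b_k}z,\qquad 0=b_1<b_2<\dots<b_m,$$ where $m\ge 1$, the $b_k$ are real and the $a_k\ge 0$ are smooth on $\overline\Omega\times[0,T]$. Let $f\in L^\infty(\Omega\times(0,T))$ and $g\in C_c^\infty(\Omega_e\times(0,T))$ (extended by zero), and let $u\in C([0,T];L^2(\mathbb{R}^n))$ be a solution of $$\begin{cases}\partial_t^\alpha u+(-\Delta)^s u+a(x,t,u)=f & \text{in }\Omega\times(0,T),\\ u=g & \text{in }\Omega_e\times(0,T),\\ u=0 & \text{in }\Omega\times\{0\}.\end{cases}$$ Here $\partial_t^\alpha u=\partial_t\big(\phi_{1-\alpha}*(u-u(0))\big)$ is the Caputo derivative, with $\phi_\beta(t)=t^{\beta-1}/\Gamma(\beta)$ and $(\phi*w)(t)=\int_0^t\phi(t-\tau)w(\tau)\,d\tau$, and "solution" means: $u-g\in L^2(0,T;\tilde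 H^s(\Omega))$, where $\tilde H^s(\Omega)$ is the closure of $C_c^\infty(\Omega)$ in $H^s(\mathbb{R}^n)$, that is, the space of functions in $H^s(\mathbb{R}^n)$ that vanish outside $\Omega$; $u(0)=0$ a.e. in $\Omega$; $a(x,t,u)\in L^1(\Omega\times(0,T))$; and for all $v\in\tilde H^s(\Omega)\cap L^\infty(\mathbb{R}^n)$ and $\psi\in C_c^\infty(0,T)$ $$-\int_0^T\psi'(t)\int_{\mathbb{R}^n}\big(\phi_{1-\alpha}*(u-u(0))\big)(t)\,v\,dx\,dt+\int_0^T\psi(t)\,\langle(-\Delta)^su(t),v\rangle\,dt+\int_0^T\psi(t)\int_\Omega a(x,t,u)\,v\,dx\,dt=\int_0^T\psi(t)\int_\Omega f\,v\,dx\,dt,$$ with $$\langle(-\Delta)^su,v\rangle=\frac{c_{n,s}}2\int_{\mathbb{R}^n}\int_{\mathbb{R}^n}\frac{(u(x)-u(y))(v(x)-v(y))}{|x-y|^{n+2s}}\,dx\,dy,\qquad c_{n,s}=\frac{4^s\,s\,\Gamma(\frac n2+s)}{\pi^{n/2}\,\Gamma(1-s)}.$$ Then, for every $t\in[0,T]$,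 $$\|u(t)\|_{L^\infty(\mathbb{R}^n)}\le\frac{T^\alpha}{\Gamma(\alpha+1)}\,\|f\|_{L^\infty(\Omega\times(0,T))}+\|g\|_{L^\infty(\Omega_e\times(0,T))},$$ and in particular $\|u\|_{L^\infty(\mathbb{R}^n\times(0,T))}$ satisfies the same bound. -/

import Mathlib

open MeasureTheory Set
open scoped ENNReal ContDiff

noncomputable section

namespace SpaceTimeFrac

/-- Euclidean space `ℝⁿ`. -/
abbrev Space (n : ℕ) : Type := EuclideanSpace ℝ (Fin n)

/-- The Hilbert space `L²(ℝⁿ)` of real-valued functions. -/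
abbrev L2 (n : ℕ) : Type := Lp ℝ 2 (volume : Measure (Space n))

/-- `Ω` has smooth boundary: near each boundary point, `Ω` is the set where a smooth function
without critical points is negative. -/
def HasSmoothBoundary {n : ℕ} (Ω : Set (Space n)) : Prop :=
  ∀ p ∈ frontier Ω, ∃ (U : Set (Space n)) (ρ : Space n → ℝ), IsOpen U ∧ p ∈ U ∧
    ContDiffOn ℝ ∞ ρ U ∧ (∀ y ∈ U, fderiv ℝ ρ y ≠ 0) ∧ Ω ∩ U = {y ∈ U | ρ y < 0}

/-- A bounded domain (nonempty connected open set) with smooth boundary. -/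
structure IsSmoothBoundedDomain {n : ℕ} (Ω : Set (Space n)) : Prop where
  isOpen : IsOpen Ω
  isConnected : IsConnected Ω
  isBounded : Bornology.IsBounded Ω
  smoothBoundary : HasSmoothBoundary Ω

/-! ### Fractional calculus in time -/

/-- The kernel `φ_β(t) = t^(β-1) / Γ(β)`. -/
def phi (β t : ℝ) : ℝ := t ^ (β - 1) / Real.Gamma β

/-- The left Riemann-Liouville integral `I^β_{0,t} w = φ_β * w` of a Banach space-valued function
(a Bochner integral). -/
def rlIntegral {X : Type*} [NormedAddCommGroup X] [NormedSpace ℝ X]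
    (β : ℝ) (w : ℝ → X) (t : ℝ) : X :=
  ∫ τ in (0 : ℝ)..t, phi β (t - τ) • w τ

/-! ### Fractional Sobolev spaces and the fractional Laplacian -/

/-- The squared Gagliardo seminorm `∬ |v(x) - v(y)|² / |x - y|^(n+2s) dx dy`. -/
def gagliardoSq {n : ℕ} (s : ℝ) (v : Space n → ℝ) : ℝ≥0∞ :=
  ∫⁻ p : Space n × Space n,
    ENNReal.ofReal ((v p.1 - v p.2) ^ 2 / ‖p.1 - p.2‖ ^ ((n : ℝ) + 2 * s))

/-- `v ∈ H^s(ℝⁿ) = W^{s,2}(ℝⁿ)`, for `0 < s < 1`. -/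
def MemHs {n : ℕ} (s : ℝ) (v : Space n → ℝ) : Prop :=
  MemLp v 2 volume ∧ gagliardoSq s v < ⊤

/-- The space `H̃^s(Ω)`: functions in `H^s(ℝⁿ)` which vanish (a.e.) outside `Ω`.
For a bounded `Ω` with smooth boundary this is the closure of `C_c^∞(Ω)` in `H^s(ℝⁿ)`, and also
the space of `v ∈ H^s(ℝⁿ)` with support in the closure of `Ω` (the boundary is a null set). -/
def MemHsTilde {n : ℕ} (s : ℝ) (Ω : Set (Space n)) (v : Space n → ℝ) : Prop :=
  MemHs s v ∧ ∀ᵐ x, x ∉ Ω → v x = 0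

/-- The constant `c_{n,s} = 4^s s Γ(n/2 + s) / (π^{n/2} Γ(1 - s))` in the pointwise formula
`(-Δ)^s u(x) = c_{n,s} PV ∫ (u(x) - u(y)) / |x - y|^(n+2s) dy`. -/
def fracConst (n : ℕ) (s : ℝ) : ℝ :=
  4 ^ s * s * Real.Gamma ((n : ℝ) / 2 + s) / (Real.pi ^ ((n : ℝ) / 2) * Real.Gamma (1 - s))

/-- The pairing `⟨(-Δ)^s u, v⟩` of `(-Δ)^s : H^s(ℝⁿ) → H^{-s}(ℝⁿ)`, for `u, v ∈ H^s(ℝⁿ)`: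
`(c_{n,s} / 2) ∬ (u(x) - u(y)) (v(x) - v(y)) / |x - y|^(n+2s) dx dy`. -/
def fracLaplacianForm {n : ℕ} (s : ℝ) (u v : Space n → ℝ) : ℝ :=
  fracConst n s / 2 * ∫ p : Space n × Space n,
    (u p.1 - u p.2) * (v p.1 - v p.2) / ‖p.1 - p.2‖ ^ ((n : ℝ) + 2 * s)

/-! ### The semilinear problem -/

/-- The nonlinearity `a(x,t,z) = ∑ₖ aₖ(x,t) |z|^{bₖ} z`. -/
def powerNonlinearity {n m : ℕ} (a : Fin (m + 1) → Space n × ℝ → ℝ) (b : Fin (m + 1) → ℝ)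
    (x : Space n) (t z : ℝ) : ℝ :=
  ∑ k, a k (x, t) * (|z| ^ b k * z)

/-- `u ∈ C([0,T]; L²(ℝⁿ))` is a (weak, finite energy) solution of
`∂ₜ^α u + (-Δ)^s u + N(x,t,u) = f` in `Ω × (0,T)`, `u = g` in `(ℝⁿ \ Ω) × (0,T)`, `u = 0` on
`Ω × {0}`.  Functions on space-time are written as functions of `(x, t)`. -/
structure IsSolution {n : ℕ} (α s T : ℝ) (Ω : Set (Space n))
    (N : Space n → ℝ → ℝ → ℝ) (f g : Space n × ℝ → ℝ) (u : ℝ → L2 n) : Prop where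
  /-- `u ∈ C([0,T]; L²(ℝⁿ))` -/
  continuousOn : ContinuousOn u (Icc 0 T)
  /-- `u - g` takes values in `H̃^s(Ω)`; in particular `u = g` outside `Ω`. -/
  exterior : ∀ᵐ t ∂(volume.restrict (Ioo 0 T)), MemHsTilde s Ω (fun x => u t x - g (x, t))
  /-- `u - g ∈ L²(0,T; H̃^s(Ω))`; the `L²(0,T; L²)` part follows from continuity. -/
  energy : ∫⁻ t in Ioo 0 T, gagliardoSq s (fun x => u t x - g (x, t)) < ⊤
  /-- `u = 0` on `Ω × {0}` -/
  initial : ∀ᵐ x ∂(volume.restrict Ω), u 0 x = 0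
  /-- `N(x,t,u) ∈ L¹(Ω × (0,T))`, so that it acts on bounded test functions. -/
  nonlinearity : ∫⁻ t in Ioo 0 T, ∫⁻ x in Ω, ‖N x t (u t x)‖ₑ < ⊤
  /-- The equation, tested with `ψ(t) v(x)`, where `ψ ∈ C_c^∞(0,T)` and `v ∈ H̃^s(Ω)` is bounded.
  The Caputo derivative is `∂ₜ^α u = ∂ₜ I^{1-α}_{0,t} (u - u(0))`, the outer time derivative being
  taken in the sense of distributions on `(0,T)`. -/
  equation : ∀ v : Space n → ℝ, MemHsTilde s Ω v → MemLp v ⊤ volume →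
    ∀ ψ : ℝ → ℝ, ContDiff ℝ ∞ ψ → HasCompactSupport ψ → tsupport ψ ⊆ Ioo 0 T →
      -(∫ t in Ioo 0 T, deriv ψ t *
            ∫ x, rlIntegral (1 - α) (fun τ => u τ - u 0) t x * v x)
        + (∫ t in Ioo 0 T, ψ t * fracLaplacianForm s (u t) v)
        + (∫ t in Ioo 0 T, ψ t * ∫ x in Ω, N x t (u t x) * v x)
      = ∫ t in Ioo 0 T, ψ t * ∫ x in Ω, f (x, t) * v x

end SpaceTimeFrac

end

noncomputable section

namespace SpaceTimeFrac

section

theorem lintegral_rpow_mul_rpow {a b t : ℝ} (ha : 0 < a) (hb : 0 < b) (ht : 0 < t) :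
    ∫⁻ x in Ioo 0 t, ENNReal.ofReal (x ^ (a - 1) * (t - x) ^ (b - 1)) =
      ENNReal.ofReal (t ^ (a + b - 1) * ProbabilityTheory.beta a b) := by
  have hB := ProbabilityTheory.beta_pos ha hb
  have h1 : ∫⁻ x in Ioo (0 : ℝ) 1, ENNReal.ofReal (x ^ (a - 1) * (1 - x) ^ (b - 1)) =
      ENNReal.ofReal (ProbabilityTheory.beta a b) := by
    have h := ProbabilityTheory.lintegral_betaPDF_eq_one ha hb
    rw [ProbabilityTheory.lintegral_betaPDF] at h
    have h2 : ∀ x : ℝ, ENNReal.ofReal (x ^ (a - 1) * (1 - x) ^ (b - 1)) =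
        ENNReal.ofReal (ProbabilityTheory.beta a b) *
          ENNReal.ofReal (1 / ProbabilityTheory.beta a b * x ^ (a - 1) * (1 - x) ^ (b - 1)) := by
      intro x
      rw [← ENNReal.ofReal_mul hB.le]
      congr 1
      field_simp
    simp_rw [h2]
    rw [lintegral_const_mul' _ _ ENNReal.ofReal_ne_top, h, mul_one]
  have himg : (fun x : ℝ => t * x) '' Ioo 0 1 = Ioo 0 t := by
    rw [image_mul_left_Ioo ht]; simp
  rw [← himg, lintegral_image_eq_lintegral_deriv_mul_of_monotoneOn (f' := fun _ => t)
    measurableSet_Ioo (fun x _ => by simpa using ((hasDerivAt_id x).const_mul t).hasDerivWithinAt)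
    (fun x _ y _ hxy => mul_le_mul_of_nonneg_left hxy ht.le),
    ENNReal.ofReal_mul (Real.rpow_nonneg ht.le _), ← h1,
    ← lintegral_const_mul' _ _ ENNReal.ofReal_ne_top]
  refine setLIntegral_congr_fun measurableSet_Ioo fun x hx => ?_
  rw [← ENNReal.ofReal_mul ht.le, ← ENNReal.ofReal_mul (Real.rpow_nonneg ht.le _)]
  congr 1
  have e : t - t * x = t * (1 - x) := by ring
  rw [e, Real.mul_rpow ht.le hx.1.le, Real.mul_rpow ht.le (by linarith [hx.2]),
    show a + b - 1 = 1 + (a - 1) + (b - 1) by ring, Real.rpow_add ht, Real.rpow_add ht,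
    Real.rpow_one]
  ring

theorem integrableOn_and_integral_of_lintegral_ofReal {S : Set ℝ} (hS : MeasurableSet S)
    {F : ℝ → ℝ} {c : ℝ} (hF : Measurable F) (h0 : ∀ x ∈ S, 0 ≤ F x) (hc : 0 ≤ c)
    (h : ∫⁻ x in S, ENNReal.ofReal (F x) = ENNReal.ofReal c) :
    IntegrableOn F S ∧ ∫ x in S, F x = c := by
  have h0' : 0 ≤ᵐ[volume.restrict S] F := ae_restrict_of_forall_mem hS h0
  constructor
  · refine ⟨hF.aestronglyMeasurable, ?_⟩
    rw [hasFiniteIntegral_iff_ofReal h0', h]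
    exact ENNReal.ofReal_lt_top
  · rw [integral_eq_lintegral_of_nonneg_ae h0' hF.aestronglyMeasurable, h,
      ENNReal.toReal_ofReal hc]

/-- The resolvent-type kernel whose convolution with `phi (1 - α)` is its translate. -/
def shiftKernel (α ε τ : ℝ) : ℝ :=
  if 0 < τ then ε ^ (1 - α) * τ ^ (α - 1) / (ε + τ) / (Real.Gamma α * Real.Gamma (1 - α)) else 0

@[fun_prop]
theorem measurable_phi (β : ℝ) : Measurable (phi β) := by
  unfold phi; fun_prop

@[fun_prop]
theorem measurable_shiftKernel (α ε : ℝ) : Measurable (shiftKernel α ε) := by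
  unfold shiftKernel
  exact Measurable.ite measurableSet_Ioi (by fun_prop) measurable_const

theorem phi_nonneg {β t : ℝ} (hβ : 0 < β) (ht : 0 ≤ t) : 0 ≤ phi β t :=
  div_nonneg (Real.rpow_nonneg ht _) (Real.Gamma_pos_of_pos hβ).le

theorem phi_pos {β t : ℝ} (hβ : 0 < β) (ht : 0 < t) : 0 < phi β t :=
  div_pos (Real.rpow_pos_of_pos ht _) (Real.Gamma_pos_of_pos hβ)

theorem phi_antitone {β t r : ℝ} (hβ : 0 < β) (hβ1 : β ≤ 1) (ht : 0 < t) (htr : t ≤ r) :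
    phi β r ≤ phi β t :=
  div_le_div_of_nonneg_right (Real.rpow_le_rpow_of_nonpos ht htr (by linarith))
    (Real.Gamma_pos_of_pos hβ).le

theorem shiftKernel_nonneg {α ε : ℝ} (hα : α ∈ Ioo (0 : ℝ) 1) (hε : 0 < ε) (τ : ℝ) :
    0 ≤ shiftKernel α ε τ := by
  unfold shiftKernel
  split_ifs with h
  · have := Real.Gamma_pos_of_pos hα.1
    have := Real.Gamma_pos_of_pos (show 0 < 1 - α by linarith [hα.2])
    positivity
  · exact le_rfl

theorem shiftKernel_conv {α ε t : ℝ} (hα : α ∈ Ioo (0 : ℝ) 1) (hε : 0 < ε) (ht : 0 < t) :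
    IntegrableOn (fun τ => shiftKernel α ε τ * phi (1 - α) (t - τ)) (Ioo 0 t) ∧
      ∫ τ in Ioo 0 t, shiftKernel α ε τ * phi (1 - α) (t - τ) = phi (1 - α) (t + ε) := by
  have hα' : 0 < 1 - α := by linarith [hα.2]
  have hΓ := Real.Gamma_pos_of_pos hα.1
  have hΓ' := Real.Gamma_pos_of_pos hα'
  refine integrableOn_and_integral_of_lintegral_ofReal measurableSet_Ioo (by fun_prop)
    (fun τ hτ => mul_nonneg (shiftKernel_nonneg hα hε _) (phi_nonneg hα' (by linarith [hτ.2])))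
    (phi_nonneg hα' (by linarith)) ?_
  have hte : 0 < t + ε := by linarith
  set f : ℝ → ℝ := fun τ => τ * (t + ε) / (ε + τ) with hf
  have hmono : MonotoneOn f (Ioo 0 t) := by
    intro x hx y hy hxy
    have h1 : 0 < ε + x := by linarith [hx.1]
    have h2 : 0 < ε + y := by linarith [hy.1]
    simp only [hf]
    rw [div_le_div_iff₀ h1 h2]
    have : 0 ≤ (y - x) * ε * (t + ε) :=
      mul_nonneg (mul_nonneg (by linarith) hε.le) hte.le
    nlinarith
  have himg : f '' Ioo 0 t = Ioo 0 t := by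
    ext y
    constructor
    · rintro ⟨x, hx, rfl⟩
      have h1 : 0 < ε + x := by linarith [hx.1]
      refine ⟨div_pos (mul_pos hx.1 hte) h1, ?_⟩
      simp only [hf]
      rw [div_lt_iff₀ h1]
      nlinarith [mul_pos hε (sub_pos.2 hx.2)]
    · intro hy
      have h1 : 0 < t + ε - y := by linarith [hy.2]
      refine ⟨ε * y / (t + ε - y), ⟨div_pos (mul_pos hε hy.1) h1, ?_⟩, ?_⟩
      · rw [div_lt_iff₀ h1]
        nlinarith [mul_pos hte (sub_pos.2 hy.2)]
      · rw [hf]; simp only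
        have : ε + ε * y / (t + ε - y) = ε * (t + ε) / (t + ε - y) := by
          field_simp; ring
        rw [this]
        field_simp
  have hderiv : ∀ x ∈ Ioo 0 t,
      HasDerivWithinAt f ((t + ε) * ε / (ε + x) ^ 2) (Ioo 0 t) x := by
    intro x hx
    have h1 : ε + x ≠ 0 := by linarith [hx.1]
    have := ((hasDerivAt_id x).mul_const (t + ε)).div ((hasDerivAt_id x).const_add ε) h1
    refine HasDerivAt.hasDerivWithinAt ?_
    rw [show (t + ε) * ε / (ε + x) ^ 2 =
      (1 * (t + ε) * (ε + id x) - id x * (t + ε) * 1) / (ε + id x) ^ 2 by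
        simp only [id]; congr 1; ring]
    exact this
  have hmain := lintegral_rpow_mul_rpow hα.1 hα' ht
  rw [← himg, lintegral_image_eq_lintegral_deriv_mul_of_monotoneOn measurableSet_Ioo hderiv
    hmono] at hmain
  have hbeta : ProbabilityTheory.beta α (1 - α) = Real.Gamma α * Real.Gamma (1 - α) := by
    rw [ProbabilityTheory.beta]; simp
  have e1 : t ^ (α + (1 - α) - 1) * ProbabilityTheory.beta α (1 - α) =
      Real.Gamma α * Real.Gamma (1 - α) := by
    rw [hbeta]; simp
  rw [e1] at hmain
  set c : ℝ := (t + ε) ^ (-α) / (Real.Gamma α * Real.Gamma (1 - α)) / Real.Gamma (1 - α) with hc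
  have hc0 : 0 ≤ c := by positivity
  have e2 : ENNReal.ofReal (phi (1 - α) (t + ε)) =
      ENNReal.ofReal c * ENNReal.ofReal (Real.Gamma α * Real.Gamma (1 - α)) := by
    rw [← ENNReal.ofReal_mul hc0]
    congr 1
    rw [hc, phi, show 1 - α - 1 = -α by ring]
    field_simp
  rw [e2, ← hmain, ← lintegral_const_mul' _ _ ENNReal.ofReal_ne_top]
  refine setLIntegral_congr_fun measurableSet_Ioo fun τ hτ => ?_
  have h1 : 0 < ε + τ := by linarith [hτ.1]
  have h2 : 0 < t - τ := by linarith [hτ.2]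
  rw [← ENNReal.ofReal_mul (by positivity), ← ENNReal.ofReal_mul hc0]
  congr 1
  have e3 : t - f τ = ε * (t - τ) / (ε + τ) := by
    rw [hf]; simp only; field_simp; ring
  rw [e3, hf, shiftKernel, if_pos hτ.1, phi, hc]
  simp only
  rw [Real.div_rpow (mul_pos hτ.1 hte).le h1.le, Real.mul_rpow hτ.1.le hte.le,
    Real.div_rpow (mul_pos hε h2).le h1.le, Real.mul_rpow hε.le h2.le,
    show 1 - α - 1 = -α by ring]
  have e4 : (ε + τ) ^ (α - 1) * (ε + τ) ^ (-α) * (ε + τ) = 1 := by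
    rw [← Real.rpow_add h1, ← Real.rpow_add_one h1.ne',
      show α - 1 + -α + 1 = 0 by ring, Real.rpow_zero]
  have e5 : (t + ε) ^ (-α) * (t + ε) ^ (α - 1) * (t + ε) = 1 := by
    rw [← Real.rpow_add hte, ← Real.rpow_add_one hte.ne',
      show -α + (α - 1) + 1 = 0 by ring, Real.rpow_zero]
  have e6 : ε ^ (1 - α) = ε ^ (-α) * ε := by
    rw [← Real.rpow_add_one hε.ne']; congr 1; ring
  rw [e6]
  have p1 : 0 < (ε + τ) ^ (α - 1) := Real.rpow_pos_of_pos h1 _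
  have p2 : 0 < (ε + τ) ^ (-α) := Real.rpow_pos_of_pos h1 _
  field_simp
  linear_combination τ ^ (α - 1) * (e4 - e5)

theorem phi_conv_phi {α t : ℝ} (hα : α ∈ Ioo (0 : ℝ) 1) (ht : 0 < t) :
    IntegrableOn (fun τ => phi (1 - α) (t - τ) * phi (1 + α) τ) (Ioo 0 t) ∧
      ∫ τ in Ioo 0 t, phi (1 - α) (t - τ) * phi (1 + α) τ = t := by
  have hα' : 0 < 1 - α := by linarith [hα.2]
  have hα2 : 0 < 1 + α := by linarith [hα.1]
  have hΓ := Real.Gamma_pos_of_pos hα2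
  have hΓ' := Real.Gamma_pos_of_pos hα'
  refine integrableOn_and_integral_of_lintegral_ofReal measurableSet_Ioo (by fun_prop)
    (fun τ hτ => mul_nonneg (phi_nonneg hα' (by linarith [hτ.2])) (phi_nonneg hα2 hτ.1.le))
    ht.le ?_
  have hmain := lintegral_rpow_mul_rpow hα2 hα' ht
  have e : t ^ (1 + α + (1 - α) - 1) * ProbabilityTheory.beta (1 + α) (1 - α) =
      t * (Real.Gamma (1 + α) * Real.Gamma (1 - α)) := by
    rw [ProbabilityTheory.beta, show 1 + α + (1 - α) = (2 : ℝ) by ring, Real.Gamma_two]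
    norm_num
  rw [e] at hmain
  set c := (Real.Gamma (1 + α) * Real.Gamma (1 - α))⁻¹ with hc
  have hc0 : 0 ≤ c := by positivity
  have e2 : ENNReal.ofReal t = ENNReal.ofReal c *
      ENNReal.ofReal (t * (Real.Gamma (1 + α) * Real.Gamma (1 - α))) := by
    rw [← ENNReal.ofReal_mul hc0]; congr 1; rw [hc]; field_simp
  rw [e2, ← hmain, ← lintegral_const_mul' _ _ ENNReal.ofReal_ne_top]
  refine setLIntegral_congr_fun measurableSet_Ioo fun τ hτ => ?_
  rw [← ENNReal.ofReal_mul hc0]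
  congr 1
  rw [phi, phi, hc]
  field_simp

theorem volterra_assoc {p q R y : ℝ → ℝ} (hp : Measurable p) (hq : Measurable q)
    (hp0 : ∀ τ, 0 < τ → 0 ≤ p τ) (hq0 : ∀ τ, 0 < τ → 0 ≤ q τ)
    (hpq : ∀ t, 0 < t → IntegrableOn (fun σ => p σ * q (t - σ)) (Ioo 0 t) ∧
      ∫ σ in Ioo 0 t, p σ * q (t - σ) = R t)
    {t : ℝ} (hy : AEStronglyMeasurable y (volume.restrict (Ioo 0 t)))
    (hRy : IntegrableOn (fun r => R (t - r) * y r) (Ioo 0 t)) :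
    ∫ τ in Ioo 0 t, p (t - τ) * ∫ r in Ioo 0 τ, q (τ - r) * y r =
      ∫ r in Ioo 0 t, R (t - r) * y r := by
  set μ := volume.restrict (Ioo 0 t) with hμ
  set F : ℝ → ℝ → ℝ := fun τ r => (Iio τ).indicator (fun r => p (t - τ) * (q (τ - r) * y r)) r
    with hF
  have hF' : ∀ τ r, F τ r = (Ioi r).indicator (fun τ => p (t - τ) * q (τ - r)) τ * y r := by
    intro τ r
    by_cases h : r < τ
    · simp [hF, indicator, h, mul_assoc]
    · simp [hF, indicator, h]
  have key : ∀ r ∈ Ioo 0 t,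
      Integrable ((Ioi r).indicator (fun τ => p (t - τ) * q (τ - r))) μ ∧
      ∫ τ, (Ioi r).indicator (fun τ => p (t - τ) * q (τ - r)) τ ∂μ = R (t - r) ∧
      ∀ᵐ τ ∂μ, 0 ≤ (Ioi r).indicator (fun τ => p (t - τ) * q (τ - r)) τ := by
    intro r hr
    have hs : Ioi r ∩ Ioo 0 t = Ioo r t := by
      ext τ; simp only [mem_inter_iff, mem_Ioi, mem_Ioo]
      exact ⟨fun h => ⟨h.1, h.2.2⟩, fun h => ⟨h.1, by linarith [hr.1], h.2⟩⟩
    obtain ⟨hi, hI⟩ := hpq (t - r) (by linarith [hr.2])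
    have mp : MeasurePreserving (fun τ : ℝ => t - τ) volume volume :=
      Measure.measurePreserving_sub_left volume t
    have me : MeasurableEmbedding (fun τ : ℝ => t - τ) :=
      (Homeomorph.subLeft t).measurableEmbedding
    have hpre : (fun τ : ℝ => t - τ) ⁻¹' (Ioo 0 (t - r)) = Ioo r t := by
      ext τ; simp only [mem_preimage, mem_Ioo]
      exact ⟨fun h => ⟨by linarith, by linarith⟩, fun h => ⟨by linarith, by linarith⟩⟩
    have hcomp : ((fun σ => p σ * q (t - r - σ)) ∘ fun τ : ℝ => t - τ) =
        fun τ => p (t - τ) * q (τ - r) := by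
      ext τ; simp only [Function.comp]; congr 2; ring
    refine ⟨?_, ?_, ?_⟩
    · rw [integrable_indicator_iff measurableSet_Ioi, IntegrableOn, hμ,
        Measure.restrict_restrict measurableSet_Ioi, hs, ← hpre, ← hcomp]
      exact (mp.integrableOn_comp_preimage me).2 hi
    · rw [integral_indicator measurableSet_Ioi, hμ,
        Measure.restrict_restrict measurableSet_Ioi, hs, ← hI, ← hpre, ← hcomp]
      exact mp.setIntegral_preimage_emb me (fun σ => p σ * q (t - r - σ)) _
    · refine ae_restrict_of_forall_mem measurableSet_Ioo fun τ hτ => ?_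
      refine indicator_apply_nonneg fun h => ?_
      exact mul_nonneg (hp0 _ (by linarith [hτ.2])) (hq0 _ (sub_pos.2 h))
  have hmeas : AEStronglyMeasurable (Function.uncurry F) (μ.prod μ) := by
    have h1 : Function.uncurry F = fun z : ℝ × ℝ =>
        {z : ℝ × ℝ | z.2 < z.1}.indicator (fun z => p (t - z.1) * q (z.1 - z.2)) z * y z.2 := by
      ext ⟨τ, r⟩
      simp only [Function.uncurry, hF']
      rfl
    rw [h1]
    refine AEStronglyMeasurable.mul ?_ hy.comp_snd
    refine (Measurable.indicator ?_ (measurableSet_lt measurable_snd measurable_fst)).aestronglyMeasurable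
    fun_prop
  have hint : Integrable (Function.uncurry F) (μ.prod μ) := by
    rw [integrable_prod_iff' hmeas]
    constructor
    · refine ae_restrict_of_forall_mem measurableSet_Ioo fun r hr => ?_
      simp only [Function.uncurry, hF']
      exact (key r hr).1.mul_const _
    · refine (hRy.norm).congr (ae_restrict_of_forall_mem measurableSet_Ioo fun r hr => ?_)
      simp only [Function.uncurry, hF', norm_mul]
      rw [integral_mul_const, ← (key r hr).2.1, Real.norm_eq_abs,
        abs_of_nonneg (integral_nonneg_of_ae (key r hr).2.2)]
      congr 1
      refine integral_congr_ae ?_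
      filter_upwards [(key r hr).2.2] with τ hτ
      rw [Real.norm_eq_abs, abs_of_nonneg hτ]
  have := integral_integral_swap hint
  calc ∫ τ, (p (t - τ) * ∫ r in Ioo 0 τ, q (τ - r) * y r) ∂μ
      = ∫ τ, ∫ r, F τ r ∂μ ∂μ := by
        refine setIntegral_congr_fun measurableSet_Ioo fun τ hτ => ?_
        simp only [hF]
        rw [integral_indicator measurableSet_Iio, hμ, Measure.restrict_restrict measurableSet_Iio,
          show Iio τ ∩ Ioo 0 t = Ioo 0 τ by
            ext r; simp only [mem_inter_iff, mem_Iio, mem_Ioo]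
            exact ⟨fun h => ⟨h.2.1, h.1⟩, fun h => ⟨h.2, h.1, h.2.trans hτ.2⟩⟩,
          integral_const_mul]
    _ = ∫ r, ∫ τ, F τ r ∂μ ∂μ := this
    _ = ∫ r, R (t - r) * y r ∂μ := by
        refine setIntegral_congr_fun measurableSet_Ioo fun r hr => ?_
        simp only [hF']
        rw [integral_mul_const, (key r hr).2.1]

end

section

theorem integrableOn_shiftKernel {α ε : ℝ} (hα : α ∈ Ioo (0 : ℝ) 1) (hε : 0 < ε) (t : ℝ) :
    IntegrableOn (shiftKernel α ε) (Ioo 0 t) := by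
  rcases le_or_gt t 0 with ht | ht
  · rw [Ioo_eq_empty (not_lt.2 ht)]; exact integrableOn_empty
  have hα' : 0 < 1 - α := by linarith [hα.2]
  have hk := phi_pos hα' ht
  refine ((shiftKernel_conv hα hε ht).1.const_mul (phi (1 - α) t)⁻¹).mono'
    (measurable_shiftKernel α ε).aestronglyMeasurable
    (ae_restrict_of_forall_mem measurableSet_Ioo fun τ hτ => ?_)
  rw [Real.norm_eq_abs, abs_of_nonneg (shiftKernel_nonneg hα hε τ), ← div_eq_inv_mul,
    le_div_iff₀ hk]
  exact mul_le_mul_of_nonneg_left (phi_antitone hα' (by linarith [hα.1]) (by linarith [hτ.2])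
    (by linarith [hτ.1])) (shiftKernel_nonneg hα hε τ)

/-- The primitive of `shiftKernel`. -/
def shiftPrim (α ε σ : ℝ) : ℝ := ∫ τ in Ioo 0 σ, shiftKernel α ε τ

theorem shiftPrim_of_nonpos {α ε σ : ℝ} (hσ : σ ≤ 0) : shiftPrim α ε σ = 0 := by
  rw [shiftPrim, Ioo_eq_empty (not_lt.2 hσ)]; simp

theorem shiftPrim_mono {α ε : ℝ} (hα : α ∈ Ioo (0 : ℝ) 1) (hε : 0 < ε) :
    Monotone (shiftPrim α ε) := fun _ _ h =>
  setIntegral_mono_set (integrableOn_shiftKernel hα hε _)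
    (Filter.Eventually.of_forall fun τ => shiftKernel_nonneg hα hε τ)
    (Filter.Eventually.of_forall (Ioo_subset_Ioo_right h))

theorem shiftPrim_nonneg {α ε : ℝ} (hα : α ∈ Ioo (0 : ℝ) 1) (hε : 0 < ε) (σ : ℝ) :
    0 ≤ shiftPrim α ε σ :=
  integral_nonneg fun τ => shiftKernel_nonneg hα hε τ

theorem shiftPrim_le_one {α ε : ℝ} (hα : α ∈ Ioo (0 : ℝ) 1) (hε : 0 < ε) (σ : ℝ) :
    shiftPrim α ε σ ≤ 1 := by
  rcases le_or_gt σ 0 with hσ | hσ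
  · rw [shiftPrim_of_nonpos hσ]; exact zero_le_one
  have hα' : 0 < 1 - α := by linarith [hα.2]
  have hk := phi_pos hα' hσ
  obtain ⟨hi, hI⟩ := shiftKernel_conv hα hε hσ
  have h1 : shiftPrim α ε σ * phi (1 - α) σ ≤ phi (1 - α) (σ + ε) := by
    rw [← hI, shiftPrim, ← integral_mul_const]
    refine setIntegral_mono_on ((integrableOn_shiftKernel hα hε σ).mul_const _) hi
      measurableSet_Ioo fun τ hτ => ?_
    exact mul_le_mul_of_nonneg_left (phi_antitone hα' (by linarith [hα.1]) (by linarith [hτ.2])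
      (by linarith [hτ.1])) (shiftKernel_nonneg hα hε τ)
  have h2 : phi (1 - α) (σ + ε) ≤ phi (1 - α) σ :=
    phi_antitone hα' (by linarith [hα.1]) hσ (by linarith)
  by_contra! h
  nlinarith

theorem shiftKernel_le {α ε r τ : ℝ} (hα : α ∈ Ioo (0 : ℝ) 1) (hε : 0 < ε) (hr : 0 < r)
    (hτ : r ≤ τ) : shiftKernel α ε τ ≤
      ε ^ (1 - α) * (r ^ (α - 1) / r / (Real.Gamma α * Real.Gamma (1 - α))) := by
  have hα' : 0 < 1 - α := by linarith [hα.2]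
  have hΓ := Real.Gamma_pos_of_pos hα.1
  have hΓ' := Real.Gamma_pos_of_pos hα'
  rw [shiftKernel, if_pos (hr.trans_le hτ), ← mul_div_assoc, ← mul_div_assoc]
  have h1 : τ ^ (α - 1) ≤ r ^ (α - 1) :=
    Real.rpow_le_rpow_of_nonpos hr hτ (by linarith)
  have h2 : 0 ≤ r ^ (α - 1) := by positivity
  gcongr
  linarith

theorem shiftPrim_add_sub_le {α ε r σ δ : ℝ} (hα : α ∈ Ioo (0 : ℝ) 1) (hε : 0 < ε) (hr : 0 < r)
    (hσ : r ≤ σ) (hδ : 0 ≤ δ) : shiftPrim α ε (σ + δ) - shiftPrim α ε σ ≤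
      δ * (ε ^ (1 - α) * (r ^ (α - 1) / r / (Real.Gamma α * Real.Gamma (1 - α)))) := by
  set c := ε ^ (1 - α) * (r ^ (α - 1) / r / (Real.Gamma α * Real.Gamma (1 - α)))
  have hu : Ioo 0 (σ + δ) =ᵐ[volume] (Ioo 0 σ ∪ Ioo σ (σ + δ) : Set ℝ) := by
    refine Ioo_ae_eq_Ioc.trans ?_
    rw [← Ioc_union_Ioc_eq_Ioc (hr.le.trans hσ) (by linarith : σ ≤ σ + δ)]
    exact Ioo_ae_eq_Ioc.symm.union Ioo_ae_eq_Ioc.symm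
  have hi := integrableOn_shiftKernel hα hε (σ + δ)
  have hi2 : IntegrableOn (shiftKernel α ε) (Ioo σ (σ + δ)) :=
    hi.mono_set (Ioo_subset_Ioo_left (hr.le.trans hσ))
  have : shiftPrim α ε (σ + δ) = shiftPrim α ε σ + ∫ τ in Ioo σ (σ + δ), shiftKernel α ε τ := by
    rw [shiftPrim, setIntegral_congr_set hu, setIntegral_union _ measurableSet_Ioo
      (integrableOn_shiftKernel hα hε σ) hi2, shiftPrim]
    exact disjoint_left.2 fun x h1 h2 => lt_asymm h1.2 h2.1
  rw [this, add_sub_cancel_left]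
  calc ∫ τ in Ioo σ (σ + δ), shiftKernel α ε τ ≤ ∫ τ in Ioo σ (σ + δ), c :=
        setIntegral_mono_on hi2 (by simp) measurableSet_Ioo fun τ hτ =>
          shiftKernel_le hα hε hr (hσ.trans hτ.1.le)
    _ = δ * c := by simp [hδ]

/-- The forward difference quotient of `shiftPrim`. -/
def shiftQuot (α ε δ σ : ℝ) : ℝ := (shiftPrim α ε (σ + δ) - shiftPrim α ε σ) / δ

theorem shiftQuot_nonneg {α ε δ : ℝ} (hα : α ∈ Ioo (0 : ℝ) 1) (hε : 0 < ε) (hδ : 0 < δ) (σ : ℝ) :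
    0 ≤ shiftQuot α ε δ σ :=
  div_nonneg (sub_nonneg.2 (shiftPrim_mono hα hε (by linarith))) hδ.le

theorem shiftQuot_le {α ε δ : ℝ} (hα : α ∈ Ioo (0 : ℝ) 1) (hε : 0 < ε) (hδ : 0 < δ) (σ : ℝ) :
    shiftQuot α ε δ σ ≤ 1 / δ := by
  have h1 := shiftPrim_le_one hα hε (σ + δ)
  have h2 := shiftPrim_nonneg hα hε σ
  exact div_le_div_of_nonneg_right (by linarith) hδ.le

theorem measurable_shiftQuot {α ε δ : ℝ} (hα : α ∈ Ioo (0 : ℝ) 1) (hε : 0 < ε) :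
    Measurable (shiftQuot α ε δ) := by
  have := (shiftPrim_mono hα hε).measurable
  unfold shiftQuot
  fun_prop

theorem integrableOn_shiftQuot {α ε δ : ℝ} (hα : α ∈ Ioo (0 : ℝ) 1) (hε : 0 < ε) (hδ : 0 < δ)
    (a b : ℝ) : IntegrableOn (shiftQuot α ε δ) (Ioo a b) := by
  refine Measure.integrableOn_of_bounded (M := 1 / δ) measure_Ioo_lt_top.ne
    (measurable_shiftQuot hα hε).aestronglyMeasurable (Filter.Eventually.of_forall fun σ => ?_)
  rw [Real.norm_eq_abs, abs_of_nonneg (shiftQuot_nonneg hα hε hδ σ)]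
  exact shiftQuot_le hα hε hδ σ

theorem integral_shiftQuot_le_one {α ε δ T : ℝ} (hα : α ∈ Ioo (0 : ℝ) 1) (hε : 0 < ε)
    (hδ : 0 < δ) (hT : 0 < T) : ∫ σ in Ioo (-δ) T, shiftQuot α ε δ σ ≤ 1 := by
  have hm := shiftPrim_mono hα hε
  have hi : ∀ a b, IntervalIntegrable (shiftPrim α ε) volume a b := fun a b =>
    hm.intervalIntegrable
  have hi' : ∀ a b, IntervalIntegrable (fun σ => shiftPrim α ε (σ + δ)) volume a b := fun a b =>
    (hm.comp (fun _ _ h => by simpa using h : Monotone fun σ : ℝ => σ + δ)).intervalIntegrable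
  rw [← integral_Ioc_eq_integral_Ioo, ← intervalIntegral.integral_of_le (by linarith)]
  unfold shiftQuot
  rw [intervalIntegral.integral_div, intervalIntegral.integral_sub (hi' _ _) (hi _ _),
    intervalIntegral.integral_comp_add_right (shiftPrim α ε), neg_add_cancel,
    ← intervalIntegral.integral_add_adjacent_intervals (hi (-δ) 0) (hi 0 T),
    ← intervalIntegral.integral_add_adjacent_intervals (hi 0 T) (hi T (T + δ)), div_le_one hδ]
  have h0 : ∫ σ in (-δ)..0, shiftPrim α ε σ = 0 := by
    rw [intervalIntegral.integral_congr (g := fun _ => (0 : ℝ))]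
    · simp
    · intro σ hσ
      rw [uIcc_of_le (by linarith)] at hσ
      exact shiftPrim_of_nonpos hσ.2
  have h1 : ∫ σ in T..(T + δ), shiftPrim α ε σ ≤ ∫ _ in T..(T + δ), (1 : ℝ) :=
    intervalIntegral.integral_mono_on (by linarith) (hi _ _) (by simp)
      fun σ _ => shiftPrim_le_one hα hε σ
  rw [h0]
  simp at h1
  linarith

/-- The difference quotients of `shiftPrim` concentrate at the origin. -/
theorem exists_integral_shiftQuot_mul_le {α T : ℝ} (hα : α ∈ Ioo (0 : ℝ) 1) (hT : 0 < T)
    {C : ℝ → ℝ} (hC : Continuous C) {B : ℝ} (hB : ∀ σ, |C σ| ≤ B) (hC0 : C 0 ≤ 0)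
    {η : ℝ} (hη : 0 < η) :
    ∃ ε ∈ Ioc (0 : ℝ) 1, ∃ δ₀ > 0, ∀ δ ∈ Ioo 0 δ₀,
      ∫ σ in Ioo (-δ) T, shiftQuot α ε δ σ * C σ ≤ η := by
  have hα' : 0 < 1 - α := by linarith [hα.2]
  have hB0 : 0 ≤ B := (abs_nonneg _).trans (hB 0)
  obtain ⟨r, hr, hCr⟩ : ∃ r > 0, ∀ σ, |σ| < r → C σ ≤ η / 2 := by
    have := Metric.continuous_iff.1 hC 0 (η / 2) (by linarith)
    obtain ⟨r, hr, h⟩ := this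
    refine ⟨r, hr, fun σ hσ => ?_⟩
    have := h σ (by simpa using hσ)
    rw [Real.dist_eq] at this
    linarith [(abs_lt.1 this).2]
  set c := r ^ (α - 1) / r / (Real.Gamma α * Real.Gamma (1 - α)) with hc
  obtain ⟨ε, hε, hεη⟩ : ∃ ε ∈ Ioc (0 : ℝ) 1, B * (ε ^ (1 - α) * c) * (T + 1) < η / 2 := by
    have h1 : Filter.Tendsto (fun ε : ℝ => B * (ε ^ (1 - α) * c) * (T + 1)) (nhds 0) (nhds 0) := by
      have : ContinuousAt (fun ε : ℝ => B * (ε ^ (1 - α) * c) * (T + 1)) 0 := by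
        have := Real.continuousAt_rpow_const 0 (1 - α) (Or.inr hα'.le)
        fun_prop
      have h2 := this.tendsto
      simpa [Real.zero_rpow hα'.ne'] using h2
    have h2 := (h1.mono_left (nhdsWithin_le_nhds (s := Ioi 0))).eventually
      (gt_mem_nhds (show (0 : ℝ) < η / 2 by linarith))
    have h3 : ∀ᶠ ε in nhdsWithin (0 : ℝ) (Ioi 0), ε ∈ Ioc (0 : ℝ) 1 :=
      Ioc_mem_nhdsGT one_pos
    obtain ⟨ε, h⟩ := (h2.and h3).exists
    exact ⟨ε, h.2, h.1⟩
  refine ⟨ε, hε, min r 1, lt_min hr one_pos, fun δ hδ => ?_⟩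
  have hδr : δ < r := hδ.2.trans_le (min_le_left _ _)
  have hδ1 : δ < 1 := hδ.2.trans_le (min_le_right _ _)
  have hc0 : 0 ≤ ε ^ (1 - α) * c := by
    have := Real.Gamma_pos_of_pos hα.1
    have := Real.Gamma_pos_of_pos hα'
    have := hε.1
    positivity
  have hq := integrableOn_shiftQuot (a := -δ) (b := T) hα hε.1 hδ.1
  have hconst : IntegrableOn (fun _ : ℝ => B * (ε ^ (1 - α) * c)) (Ioo (-δ) T) :=
    integrableOn_const measure_Ioo_lt_top.ne
  calc ∫ σ in Ioo (-δ) T, shiftQuot α ε δ σ * C σ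
      ≤ ∫ σ in Ioo (-δ) T, (shiftQuot α ε δ σ * (η / 2) + B * (ε ^ (1 - α) * c)) := by
        refine setIntegral_mono_on ?_ ((hq.mul_const _).add hconst) measurableSet_Ioo
          fun σ hσ => ?_
        · exact hq.mul_bdd (c := B) hC.aestronglyMeasurable
            (Filter.Eventually.of_forall fun σ => hB σ)
        · have hκ := shiftQuot_nonneg hα hε.1 hδ.1 σ
          rcases lt_or_ge σ r with h | h
          · have := mul_le_mul_of_nonneg_left
              (hCr σ (abs_lt.2 ⟨by linarith [hσ.1], h⟩)) hκ
            have := mul_nonneg hB0 hc0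
            linarith
          · have h1 : shiftQuot α ε δ σ ≤ ε ^ (1 - α) * c := by
              rw [shiftQuot, div_le_iff₀ hδ.1, mul_comm _ δ]
              exact shiftPrim_add_sub_le hα hε.1 hr h hδ.1.le
            have h2 : shiftQuot α ε δ σ * C σ ≤ (ε ^ (1 - α) * c) * B :=
              (mul_le_mul_of_nonneg_left ((le_abs_self _).trans (hB σ)) hκ).trans
                (mul_le_mul_of_nonneg_right h1 hB0)
            have : 0 ≤ shiftQuot α ε δ σ * (η / 2) := by positivity
            linarith
    _ = (∫ σ in Ioo (-δ) T, shiftQuot α ε δ σ) * (η / 2) +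
          (T + δ) * (B * (ε ^ (1 - α) * c)) := by
        rw [integral_add (hq.mul_const _) hconst, integral_mul_const]
        congr 1
        rw [setIntegral_const, smul_eq_mul, Measure.real, Real.volume_Ioo,
          ENNReal.toReal_ofReal (by linarith [hδ.1])]
        ring
    _ ≤ 1 * (η / 2) + (T + 1) * (B * (ε ^ (1 - α) * c)) := by
        have := integral_shiftQuot_le_one hα hε.1 hδ.1 hT
        have := mul_nonneg hB0 hc0
        gcongr
    _ ≤ η := by linarith

end

section

set_option linter.unusedSectionVars false

section Correlation

variable {X : Type*} [NormedAddCommGroup X] [NormedSpace ℝ X] [FiniteDimensional ℝ X]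
  [MeasureSpace X] [BorelSpace X] [(volume : Measure X).IsAddHaarMeasure]

/-- Translation of the first variable of `ℝ × X`. -/
def shiftMap (X : Type*) [TopologicalSpace X] : C(ℝ, C(ℝ × X, ℝ × X)) :=
  (ContinuousMap.mk (fun a : ℝ × (ℝ × X) => (a.2.1 - a.1, a.2.2)) (by fun_prop)).curry

theorem measurePreserving_shiftMap (σ : ℝ) :
    MeasurePreserving (shiftMap X σ) (volume : Measure (ℝ × X)) volume := by
  have h := (measurePreserving_sub_right (volume : Measure ℝ) σ).prod
    (MeasurePreserving.id (volume : Measure X))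
  exact h

/-- The correlation in time of two functions on `ℝ × X`. -/
def timeCorr (P V : ℝ × X → ℝ) (σ : ℝ) : ℝ := ∫ z, P (z.1 - σ, z.2) * V z

theorem timeCorr_eq_lpPairing {p q : ℝ≥0∞} [p.HolderConjugate q] [Fact (1 ≤ p)] [Fact (1 ≤ q)]
    {P V : ℝ × X → ℝ} (hP : MemLp P p) (hV : MemLp V q) (σ : ℝ) :
    timeCorr P V σ = (ContinuousLinearMap.mul ℝ ℝ).lpPairing volume p q
      (Lp.compMeasurePreserving (shiftMap X σ) (measurePreserving_shiftMap σ) (hP.toLp P))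
      (hV.toLp V) := by
  rw [ContinuousLinearMap.lpPairing_eq_integral, timeCorr]
  refine integral_congr_ae ?_
  have h1 := Lp.coeFn_compMeasurePreserving (hP.toLp P) (measurePreserving_shiftMap (X := X) σ)
  have h2 := (measurePreserving_shiftMap (X := X) σ).quasiMeasurePreserving.ae_eq_comp
    hP.coeFn_toLp
  filter_upwards [h1, h2, hV.coeFn_toLp] with z h1 h2 h3
  rw [h1, h2, h3]
  rfl

theorem continuous_timeCorr (p q : ℝ≥0∞) [p.HolderConjugate q] (hp : p ≠ ⊤)
    {P V : ℝ × X → ℝ} (hP : MemLp P p) (hV : MemLp V q) : Continuous (timeCorr P V) := by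
  have : Fact (1 ≤ p) := ⟨ENNReal.HolderConjugate.one_le p q⟩
  have : Fact (1 ≤ q) := ⟨ENNReal.HolderConjugate.one_le q p⟩
  have h : Continuous fun σ => Lp.compMeasurePreserving (shiftMap X σ)
      (measurePreserving_shiftMap σ) (hP.toLp P) :=
    continuous_const.compMeasurePreservingLp (shiftMap X).continuous _ hp
  have : timeCorr P V = fun σ => (ContinuousLinearMap.mul ℝ ℝ).lpPairing volume p q
      (Lp.compMeasurePreserving (shiftMap X σ) (measurePreserving_shiftMap σ) (hP.toLp P))
      (hV.toLp V) := funext fun σ => timeCorr_eq_lpPairing hP hV σ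
  rw [this]
  fun_prop

theorem exists_abs_timeCorr_le (p q : ℝ≥0∞) [p.HolderConjugate q]
    {P V : ℝ × X → ℝ} (hP : MemLp P p) (hV : MemLp V q) : ∃ B, ∀ σ, |timeCorr P V σ| ≤ B := by
  have : Fact (1 ≤ p) := ⟨ENNReal.HolderConjugate.one_le p q⟩
  have : Fact (1 ≤ q) := ⟨ENNReal.HolderConjugate.one_le q p⟩
  refine ⟨‖(ContinuousLinearMap.mul ℝ ℝ).lpPairing (volume : Measure (ℝ × X)) p q‖ *
    ‖hP.toLp P‖ * ‖hV.toLp V‖, fun σ => ?_⟩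
  rw [timeCorr_eq_lpPairing hP hV, ← Real.norm_eq_abs]
  refine (ContinuousLinearMap.le_opNorm₂ _ _ _).trans_eq ?_
  rw [Lp.norm_compMeasurePreserving]

theorem integrable_mul_shift_mul (p q : ℝ≥0∞) [p.HolderConjugate q]
    {P V : ℝ × X → ℝ} (hPm : Measurable P) (hVm : Measurable V) (hP : MemLp P p)
    (hV : MemLp V q) {κ : ℝ → ℝ} (hκ : Integrable κ) (hκm : Measurable κ) :
    Integrable (fun w : ℝ × (ℝ × X) => κ w.1 * (P (w.2.1 - w.1, w.2.2) * V w.2)) := by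
  have hm : Measurable fun w : ℝ × (ℝ × X) => κ w.1 * (P (w.2.1 - w.1, w.2.2) * V w.2) := by
    fun_prop
  rw [Measure.volume_eq_prod, integrable_prod_iff hm.aestronglyMeasurable]
  have hPσ : ∀ σ, MemLp (fun z : ℝ × X => P (z.1 - σ, z.2)) p := fun σ =>
    hP.comp_measurePreserving (measurePreserving_shiftMap σ)
  constructor
  · refine Filter.Eventually.of_forall fun σ => ?_
    exact Integrable.const_mul (f := fun z : ℝ × X => P (z.1 - σ, z.2) * V z)
      ((hPσ σ).integrable_mul hV) (κ σ)
  · obtain ⟨B, hB⟩ := exists_abs_timeCorr_le p q hP.norm hV.norm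
    refine (hκ.norm.mul_const B).mono' ?_ (Filter.Eventually.of_forall fun σ => ?_)
    · exact hm.norm.stronglyMeasurable.integral_prod_right.aestronglyMeasurable
    · rw [Real.norm_eq_abs, abs_of_nonneg (integral_nonneg fun _ => norm_nonneg _)]
      simp only [norm_mul]
      rw [integral_const_mul]
      exact mul_le_mul_of_nonneg_left ((le_abs_self _).trans (hB σ)) (norm_nonneg _)

theorem integral_conv_pairing (p q : ℝ≥0∞) [p.HolderConjugate q]
    {P V : ℝ × X → ℝ} (hPm : Measurable P) (hVm : Measurable V) (hP : MemLp P p)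
    (hV : MemLp V q) {κ : ℝ → ℝ} (hκ : Integrable κ) (hκm : Measurable κ) :
    Integrable (fun t => ∫ τ, κ (t - τ) * ∫ x, P (τ, x) * V (t, x)) ∧
      ∫ t, ∫ τ, κ (t - τ) * ∫ x, P (τ, x) * V (t, x) = ∫ σ, κ σ * timeCorr P V σ := by
  have hi := integrable_mul_shift_mul p q hPm hVm hP hV hκ hκm
  set F : ℝ × (ℝ × X) → ℝ := fun w => κ w.1 * (P (w.2.1 - w.1, w.2.2) * V w.2) with hF
  let e : ℝ × (ℝ × X) → ℝ × (ℝ × X) := fun w => (w.2.1, (w.1, w.2.2))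
  have he : MeasurePreserving e volume volume := by
    have h1 : MeasurePreserving (MeasurableEquiv.prodAssoc : (ℝ × ℝ) × X ≃ᵐ ℝ × (ℝ × X))
      volume volume := volume_preserving_prodAssoc
    have h2 : MeasurePreserving (Prod.map Prod.swap id : (ℝ × ℝ) × X → (ℝ × ℝ) × X)
      volume volume := (Measure.measurePreserving_swap (μ := (volume : Measure ℝ))
        (ν := (volume : Measure ℝ))).prod (MeasurePreserving.id (volume : Measure X))
    have h3 := h1.comp (h2.comp (h1.symm _))
    exact h3
  have hi2 : Integrable (F ∘ e) := he.integrable_comp_of_integrable hi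
  have hI2 : ∫ w, (F ∘ e) w = ∫ w, F w := by
    have hinv : Function.Involutive e := fun w => rfl
    let E : ℝ × (ℝ × X) ≃ᵐ ℝ × (ℝ × X) :=
      { toEquiv := hinv.toPerm, measurable_toFun := he.measurable,
        measurable_invFun := he.measurable }
    exact he.integral_comp E.measurableEmbedding F
  have hcongr : (fun t => ∫ w : ℝ × X, (F ∘ e) (t, w)) =ᵐ[volume]
      fun t => ∫ τ, κ (t - τ) * ∫ x, P (τ, x) * V (t, x) := by
    rw [Measure.volume_eq_prod] at hi2
    filter_upwards [hi2.prod_right_ae] with t ht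
    rw [Measure.volume_eq_prod] at ht
    rw [Measure.volume_eq_prod, integral_prod _ ht,
      ← integral_sub_left_eq_self (fun τ => κ (t - τ) * ∫ x, P (τ, x) * V (t, x)) volume t]
    refine integral_congr_ae (Filter.Eventually.of_forall fun σ => ?_)
    simp only [sub_sub_cancel, hF, e, Function.comp]
    rw [integral_const_mul]
  constructor
  · rw [Measure.volume_eq_prod] at hi2
    exact hi2.integral_prod_left.congr hcongr
  · rw [← integral_congr_ae hcongr]
    rw [Measure.volume_eq_prod] at hi2 hI2 hi
    rw [← integral_prod _ hi2, hI2, integral_prod _ hi]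
    refine integral_congr_ae (Filter.Eventually.of_forall fun σ => ?_)
    simp only [hF]
    rw [integral_const_mul, timeCorr]

end Correlation

end

section

theorem setIntegral_Ioo_eq_intervalIntegral {f : ℝ → ℝ} {a b : ℝ} (h : a ≤ b) :
    ∫ x in Ioo a b, f x = ∫ x in a..b, f x := by
  rw [intervalIntegral.integral_of_le h, integral_Ioc_eq_integral_Ioo]

/-- Integration by parts of a test function against a primitive. -/
theorem integral_deriv_mul_primitive {T : ℝ} (hT : 0 < T) {F : ℝ → ℝ}
    (hF : IntegrableOn F (Ioo 0 T)) {ψ : ℝ → ℝ} (hψ : ContDiff ℝ ∞ ψ)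
    (hψs : tsupport ψ ⊆ Ioo 0 T) :
    ∫ t in Ioo 0 T, deriv ψ t * ∫ r in 0..t, F r = -∫ t in Ioo 0 T, ψ t * F t := by
  have hFi : IntervalIntegrable F volume 0 T := by
    rwa [intervalIntegrable_iff_integrableOn_Ioo_of_le hT.le]
  have hψc : Continuous (deriv ψ) := hψ.continuous_deriv (by simp)
  have hψi : IntervalIntegrable (deriv ψ) volume 0 T := hψc.intervalIntegrable _ _
  have hψd : Differentiable ℝ ψ := hψ.differentiable (by simp)
  have hψ0 : ψ 0 = 0 := image_eq_zero_of_notMem_tsupport fun h => lt_irrefl _ (hψs h).1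
  have hψT : ψ T = 0 := image_eq_zero_of_notMem_tsupport fun h => lt_irrefl _ (hψs h).2
  have hψac : AbsolutelyContinuousOnInterval ψ 0 T := by
    have := hψi.absolutelyContinuousOnInterval_intervalIntegral (c := 0) (by simp)
    convert this using 1
    ext x
    rw [intervalIntegral.integral_deriv_eq_sub (fun x _ => hψd x) (hψc.intervalIntegrable _ _),
      hψ0, sub_zero]
  have hPac := hFi.absolutelyContinuousOnInterval_intervalIntegral (c := 0) (by simp)
  have h := hψac.integral_mul_deriv_eq_deriv_mul hPac
  rw [hψ0, hψT, zero_mul, zero_mul, sub_zero, zero_sub] at h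
  rw [setIntegral_Ioo_eq_intervalIntegral hT.le, setIntegral_Ioo_eq_intervalIntegral hT.le,
    eq_neg_iff_add_eq_zero, add_comm, ← eq_neg_iff_add_eq_zero, ← h]
  refine intervalIntegral.integral_congr_ae ?_
  filter_upwards [hFi.ae_hasDerivAt_integral] with x hx hxT
  rw [(hx (uIoc_subset_uIcc hxT) 0 (by simp)).deriv]

/-- A smooth function with compact support in an interval and integral zero is the derivative of
a test function. -/
theorem exists_test_primitive {T : ℝ} {φ : ℝ → ℝ} (hφ : ContDiff ℝ ∞ φ)
    (hφc : HasCompactSupport φ) (hφs : tsupport φ ⊆ Ioo 0 T)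
    (hφ0 : ∫ t in Ioo 0 T, φ t = 0) :
    ∃ ψ : ℝ → ℝ, ContDiff ℝ ∞ ψ ∧ HasCompactSupport ψ ∧ tsupport ψ ⊆ Ioo 0 T ∧ deriv ψ = φ := by
  have hcont := hφ.continuous
  rcases (tsupport φ).eq_empty_or_nonempty with he | hne
  · refine ⟨0, contDiff_const, HasCompactSupport.zero, by simp [tsupport], ?_⟩
    have : φ = 0 := by
      ext x; exact image_eq_zero_of_notMem_tsupport (by simp [he])
    rw [this]; ext x; simp
  obtain ⟨a, haS, ha⟩ := hφc.exists_isLeast hne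
  obtain ⟨b, hbS, hb⟩ := hφc.exists_isGreatest hne
  have hz : ∀ x, x ∉ Icc a b → φ x = 0 := fun x hx =>
    image_eq_zero_of_notMem_tsupport fun h => hx ⟨ha h, hb h⟩
  have ha0 := (hφs haS).1
  have hbT := (hφs hbS).2
  have hab : a ≤ b := ha hbS
  set ψ : ℝ → ℝ := fun t => ∫ r in 0..t, φ r with hψ
  have hd : ∀ t, HasDerivAt ψ (φ t) t := fun t =>
    intervalIntegral.integral_hasDerivAt_right (hcont.intervalIntegrable _ _)
      (hcont.stronglyMeasurableAtFilter _ _) hcont.continuousAt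
  have hderiv : deriv ψ = φ := funext fun t => (hd t).deriv
  have hψz : ∀ t, t ∉ Icc a b → ψ t = 0 := by
    intro t ht
    rcases lt_or_ge t a with h | h
    · rw [hψ]
      simp only
      rw [intervalIntegral.integral_congr (g := fun _ => (0 : ℝ))]
      · simp
      · intro r hr
        refine hz r fun h' => ?_
        have := hr.2
        have : max 0 t < a := max_lt ha0 h
        linarith [h'.1]
    · have hbt : b < t := by
        by_contra! h'
        exact ht ⟨h, h'⟩
      have e : ∫ r in 0..t, φ r = ∫ r in Ioo 0 T, φ r := by
        rw [setIntegral_Ioo_eq_intervalIntegral (by linarith),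
          ← intervalIntegral.integral_add_adjacent_intervals (b := b)
            (hcont.intervalIntegrable 0 b) (hcont.intervalIntegrable b t),
          ← intervalIntegral.integral_add_adjacent_intervals (b := b)
            (hcont.intervalIntegrable 0 b) (hcont.intervalIntegrable b T)]
        congr 1
        have h0 : ∀ c, b < c → ∫ r in b..c, φ r = 0 := by
          intro c hc
          rw [intervalIntegral.integral_of_le hc.le]
          refine setIntegral_eq_zero_of_forall_eq_zero fun r hr => hz r fun h' => ?_
          linarith [h'.2, hr.1]
        rw [h0 t hbt, h0 T hbT]
      rw [hψ]
      simp only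
      rw [e, hφ0]
  have hsupp : tsupport ψ ⊆ Icc a b :=
    closure_minimal (fun t ht => by_contra fun h => ht (hψz t h)) isClosed_Icc
  refine ⟨ψ, contDiff_infty_iff_deriv.2 ⟨fun t => (hd t).differentiableAt, hderiv ▸ hφ⟩,
    HasCompactSupport.of_support_subset_isCompact isCompact_Icc
      ((subset_tsupport _).trans hsupp), hsupp.trans fun t ht => ⟨?_, ?_⟩, hderiv⟩
  · linarith [ht.1]
  · linarith [ht.2]

/-- If the distributional derivative of a continuous function on `(0,T)` is integrable then the
function is its primitive. -/
theorem eq_primitive_of_weak_deriv {T : ℝ} (hT : 0 < T) {Y F : ℝ → ℝ}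
    (hY : ContinuousOn Y (Icc 0 T)) (hY0 : Y 0 = 0) (hF : IntegrableOn F (Ioo 0 T))
    (h : ∀ ψ : ℝ → ℝ, ContDiff ℝ ∞ ψ → HasCompactSupport ψ → tsupport ψ ⊆ Ioo 0 T →
      -(∫ t in Ioo 0 T, deriv ψ t * Y t) = ∫ t in Ioo 0 T, ψ t * F t) :
    ∀ t ∈ Icc 0 T, Y t = ∫ r in Ioo 0 t, F r := by
  have hFi : IntervalIntegrable F volume 0 T := by
    rwa [intervalIntegrable_iff_integrableOn_Ioo_of_le hT.le]
  set P : ℝ → ℝ := fun t => ∫ r in 0..t, F r with hP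
  have hPc : ContinuousOn P (Icc 0 T) := by
    have := (hFi.absolutelyContinuousOnInterval_intervalIntegral (c := 0) (by simp)).continuousOn
    rwa [uIcc_of_le hT.le] at this
  set Z : ℝ → ℝ := fun t => Y t - P t with hZ
  have hZc : ContinuousOn Z (Icc 0 T) := hY.sub hPc
  have hint : ∀ {φ G : ℝ → ℝ}, Continuous φ → ContinuousOn G (Icc 0 T) →
      IntegrableOn (fun t => φ t * G t) (Ioo 0 T) := fun hφ hG =>
    ((hφ.continuousOn.mul hG).integrableOn_Icc).mono_set Ioo_subset_Icc_self
  have hZ0 : ∀ φ : ℝ → ℝ, ContDiff ℝ ∞ φ → HasCompactSupport φ → tsupport φ ⊆ Ioo 0 T →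
      ∫ t in Ioo 0 T, φ t = 0 → ∫ t in Ioo 0 T, φ t * Z t = 0 := by
    intro φ h1 h2 h3 h4
    obtain ⟨ψ, g1, g2, g3, rfl⟩ := exists_test_primitive h1 h2 h3 h4
    have e1 := h ψ g1 g2 g3
    have e2 := integral_deriv_mul_primitive hT hF g1 g3
    simp only [hZ, mul_sub]
    rw [integral_sub (hint h1.continuous hY) (hint h1.continuous hPc), e2, ← e1]
    ring
  obtain ⟨φ₀, k1, k2, k3, k4, k5⟩ : ∃ φ₀ : ℝ → ℝ, ContDiff ℝ ∞ φ₀ ∧ HasCompactSupport φ₀ ∧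
      tsupport φ₀ ⊆ Ioo 0 T ∧ (∀ t, 0 ≤ φ₀ t) ∧ ∫ t in Ioo 0 T, φ₀ t = 1 := by
    obtain ⟨f, f1, f2, f3, f4, f5⟩ := exists_contDiff_tsupport_subset (n := ⊤)
      (Ioo_mem_nhds (show 0 < T / 2 by linarith) (show T / 2 < T by linarith))
    have f0 : ∀ t, 0 ≤ f t := fun t => (f4 ⟨t, rfl⟩).1
    have hpos : 0 < ∫ t in Ioo 0 T, f t := by
      rw [setIntegral_eq_integral_of_forall_compl_eq_zero fun t ht =>
        image_eq_zero_of_notMem_tsupport fun h => ht (f1 h)]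
      exact f3.continuous.integral_pos_of_hasCompactSupport_nonneg_nonzero f2 f0
        (x := T / 2) (by rw [f5]; exact one_ne_zero)
    set I := ∫ t in Ioo 0 T, f t
    refine ⟨fun t => I⁻¹ * f t, contDiff_const.mul f3, f2.mul_left, ?_, fun t =>
      mul_nonneg (inv_nonneg.2 hpos.le) (f0 t), ?_⟩
    · exact (tsupport_mul_subset_right).trans f1
    · rw [integral_const_mul]; exact inv_mul_cancel₀ hpos.ne'
  set c := ∫ t in Ioo 0 T, φ₀ t * Z t with hc
  have hZae : ∀ᵐ t, t ∈ Ioo 0 T → Z t - c = 0 := by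
    have hZcc : ContinuousOn (fun t => Z t - c) (Icc 0 T) := hZc.sub continuousOn_const
    refine isOpen_Ioo.ae_eq_zero_of_integral_contDiff_smul_eq_zero
      ((hZcc.mono Ioo_subset_Icc_self).locallyIntegrableOn measurableSet_Ioo)
      fun φ h1 h2 h3 => ?_
    set d := ∫ t in Ioo 0 T, φ t with hd
    have hφi : IntegrableOn φ (Ioo 0 T) :=
      h1.continuous.continuousOn.integrableOn_Icc.mono_set Ioo_subset_Icc_self
    have hφ₀i : IntegrableOn φ₀ (Ioo 0 T) :=
      k1.continuous.continuousOn.integrableOn_Icc.mono_set Ioo_subset_Icc_self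
    have hs : tsupport (fun t => φ t - d * φ₀ t) ⊆ Ioo 0 T := by
      refine (tsupport_sub _ _).trans (union_subset h3 ?_)
      exact tsupport_mul_subset_right.trans k3
    have := hZ0 (fun t => φ t - d * φ₀ t) (h1.sub (contDiff_const.mul k1))
      (h2.sub k2.mul_left) hs (by
        rw [integral_sub hφi (hφ₀i.const_mul d), integral_const_mul, k5]; simp [hd])
    rw [← setIntegral_eq_integral_of_forall_compl_eq_zero (s := Ioo 0 T) fun t ht => by
      rw [image_eq_zero_of_notMem_tsupport fun h => ht (h3 h), zero_smul]]
    simp only [smul_eq_mul, mul_sub]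
    rw [integral_sub (hint h1.continuous hZc) (hφi.mul_const c), integral_mul_const, ← hd]
    simp only [sub_mul, mul_assoc] at this
    rw [integral_sub (hint h1.continuous hZc) ((hint k1.continuous hZc).const_mul d),
      integral_const_mul, ← hc] at this
    exact this
  have hZconst : ∀ t ∈ Icc 0 T, Z t = c := by
    have h1 : EqOn Z (fun _ => c) (Ioo 0 T) := by
      refine Measure.eqOn_Ioo_of_ae_eq volume ?_ (hZc.mono Ioo_subset_Icc_self)
        continuousOn_const
      rw [Filter.EventuallyEq, ae_restrict_iff' measurableSet_Ioo]
      filter_upwards [hZae] with t ht htT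
      linarith [ht htT]
    have h2 : EqOn Z (fun _ => c) (closure (Ioo 0 T)) :=
      h1.of_subset_closure (by rw [closure_Ioo hT.ne]; exact hZc) continuousOn_const
        subset_closure le_rfl
    rwa [closure_Ioo hT.ne] at h2
  have hc0 : c = 0 := by
    rw [← hZconst 0 ⟨le_rfl, hT.le⟩]
    simp [hZ, hP, hY0]
  intro t ht
  have := hZconst t ht
  rw [hc0] at this
  rw [setIntegral_Ioo_eq_intervalIntegral ht.1]
  simpa [hZ, hP, sub_eq_zero] using this

end

section

theorem integrableOn_mul_of_abs_le {S : Set ℝ} (hS : MeasurableSet S) {p y : ℝ → ℝ}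
    (hp : Measurable p) {B : ℝ} (hB : ∀ x ∈ S, |p x| ≤ B) (hy : IntegrableOn y S) :
    IntegrableOn (fun x => p x * y x) S :=
  Integrable.bdd_mul (c := B) hy hp.aestronglyMeasurable (ae_restrict_of_forall_mem hS hB)

/-- Convolution of the integrated equation with `shiftKernel`. -/
theorem shiftPrim_conv_eq {α ε T : ℝ} (hα : α ∈ Ioo (0 : ℝ) 1) (hε : 0 < ε)
    {y G : ℝ → ℝ} (hy : ContinuousOn y (Icc 0 T)) (hG : IntegrableOn G (Ioo 0 T))
    (h : ∀ t ∈ Ioo 0 T, ∫ τ in Ioo 0 t, phi (1 - α) (t - τ) * y τ = ∫ τ in Ioo 0 t, G τ)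
    {t : ℝ} (ht : t ≤ T) :
    ∫ τ in Ioo 0 t, phi (1 - α) (t - τ + ε) * y τ =
      ∫ τ in Ioo 0 t, shiftPrim α ε (t - τ) * G τ := by
  have hα' : 0 < 1 - α := by linarith [hα.2]
  have hsub : Ioo 0 t ⊆ Ioo 0 T := Ioo_subset_Ioo_right ht
  have hyi : IntegrableOn y (Ioo 0 t) :=
    hy.integrableOn_Icc.mono_set (hsub.trans Ioo_subset_Icc_self)
  have hGi : IntegrableOn G (Ioo 0 t) := hG.mono_set hsub
  have h1 := volterra_assoc (p := shiftKernel α ε) (q := phi (1 - α))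
    (R := fun t => phi (1 - α) (t + ε)) (y := y) (t := t) (by fun_prop) (by fun_prop)
    (fun τ _ => shiftKernel_nonneg hα hε τ) (fun τ hτ => phi_nonneg hα' hτ.le)
    (fun t ht => shiftKernel_conv hα hε ht) hyi.aestronglyMeasurable
    (integrableOn_mul_of_abs_le (B := phi (1 - α) ε) measurableSet_Ioo (by fun_prop)
      (fun x hx => by
        rw [abs_of_nonneg (phi_nonneg hα' (by linarith [hx.2]))]
        exact phi_antitone hα' (by linarith [hα.1]) hε (by linarith [hx.2])) hyi)
  have hm := (shiftPrim_mono hα hε).measurable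
  have h2 := volterra_assoc (p := shiftKernel α ε) (q := fun _ => 1)
    (R := shiftPrim α ε) (y := G) (t := t) (by fun_prop) (by fun_prop)
    (fun τ _ => shiftKernel_nonneg hα hε τ) (fun τ hτ => zero_le_one)
    (fun t ht => by simpa [shiftPrim] using integrableOn_shiftKernel hα hε t)
    hGi.aestronglyMeasurable
    (integrableOn_mul_of_abs_le (B := 1) measurableSet_Ioo (by fun_prop)
      (fun x hx => by
        rw [abs_of_nonneg (shiftPrim_nonneg hα hε _)]
        exact shiftPrim_le_one hα hε _) hGi)
  rw [← h1, ← h2]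
  refine setIntegral_congr_fun measurableSet_Ioo fun τ hτ => ?_
  simp only [one_mul]
  rw [h τ (hsub hτ)]

section Lower

variable {k : ℝ → ℝ} (hk : Measurable k) (hk0 : ∀ t, 0 ≤ t → 0 ≤ k t)
  (hka : ∀ t r, 0 ≤ t → t ≤ r → k r ≤ k t)

include hk hk0 hka in
theorem integrableOn_conv {t T : ℝ} (ht : t ≤ T) {y : ℝ → ℝ} (hy : IntegrableOn y (Ioo 0 T)) :
    IntegrableOn (fun τ => k (t - τ) * y τ) (Ioo 0 t) :=
  integrableOn_mul_of_abs_le (B := k 0) measurableSet_Ioo (by fun_prop)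
    (fun x hx => by
      rw [abs_of_nonneg (hk0 _ (by linarith [hx.2]))]
      exact hka _ _ le_rfl (by linarith [hx.2]))
    (hy.mono_set (Ioo_subset_Ioo_right ht))

include hk hk0 hka in
theorem integral_conv_split {t δ T : ℝ} (ht : 0 ≤ t) (hδ : 0 ≤ δ) (hT : t + δ ≤ T) {y : ℝ → ℝ}
    (hy : IntegrableOn y (Ioo 0 T)) :
    ∫ τ in Ioo 0 (t + δ), k (t + δ - τ) * y τ =
      (∫ τ in Ioo 0 t, k (t + δ - τ) * y τ) + ∫ τ in Ioo t (t + δ), k (t + δ - τ) * y τ := by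
  have hi := integrableOn_conv hk hk0 hka hT hy
  have hu : Ioo 0 (t + δ) =ᵐ[volume] (Ioo 0 t ∪ Ioo t (t + δ) : Set ℝ) := by
    refine Ioo_ae_eq_Ioc.trans ?_
    rw [← Ioc_union_Ioc_eq_Ioc ht (by linarith : t ≤ t + δ)]
    exact Ioo_ae_eq_Ioc.symm.union Ioo_ae_eq_Ioc.symm
  rw [setIntegral_congr_set hu, setIntegral_union _ measurableSet_Ioo
    (hi.mono_set (Ioo_subset_Ioo_right (by linarith)))
    (hi.mono_set (Ioo_subset_Ioo_left ht))]
  exact disjoint_left.2 fun x h1 h2 => lt_asymm h1.2 h2.1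

include hk hk0 hka in
theorem conv_diff_le {t δ T : ℝ} (ht : 0 ≤ t) (hδ : 0 ≤ δ) (hT : t + δ ≤ T) {J Q : ℝ → ℝ}
    (hJ : IntegrableOn J (Ioo 0 T)) (hQ : IntegrableOn Q (Ioo 0 T)) {q w : ℝ} (hq : 0 ≤ q)
    (hJle : ∀ τ ∈ Ioo 0 T, J τ ≤ q + Q τ)
    (hJge : ∀ τ ∈ Ioo t (t + δ), q + Q τ - w ≤ J τ) :
    (∫ τ in Ioo 0 (t + δ), k (t + δ - τ) * Q τ) - (∫ τ in Ioo 0 t, k (t - τ) * Q τ) -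
        w * k 0 * δ ≤
      (∫ τ in Ioo 0 (t + δ), k (t + δ - τ) * J τ) - ∫ τ in Ioo 0 t, k (t - τ) * J τ := by
  have htT : t ≤ T := by linarith
  have hc : IntegrableOn (fun _ : ℝ => q) (Ioo 0 T) := integrableOn_const measure_Ioo_lt_top.ne
  set D : ℝ → ℝ := fun τ => q + Q τ - J τ with hD
  have hDi : IntegrableOn D (Ioo 0 T) := (hc.add hQ).sub hJ
  have hex : ∀ r, r ≤ T → ∫ τ in Ioo 0 r, k (r - τ) * J τ =
      (∫ τ in Ioo 0 r, k (r - τ) * q) + (∫ τ in Ioo 0 r, k (r - τ) * Q τ) -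
        ∫ τ in Ioo 0 r, k (r - τ) * D τ := by
    intro r hr
    have i1 := integrableOn_conv hk hk0 hka hr hc
    have i2 := integrableOn_conv hk hk0 hka hr hQ
    have i3 := integrableOn_conv hk hk0 hka hr hDi
    have i12 : IntegrableOn (fun τ => k (r - τ) * q + k (r - τ) * Q τ) (Ioo 0 r) := i1.add i2
    rw [← integral_add i1 i2, ← integral_sub i12 i3]
    refine setIntegral_congr_fun measurableSet_Ioo fun τ _ => ?_
    simp only [hD]
    ring
  rw [hex _ hT, hex _ htT]
  have h1 : ∫ τ in Ioo 0 t, k (t - τ) * q ≤ ∫ τ in Ioo 0 (t + δ), k (t + δ - τ) * q := by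
    have e : ∀ r, 0 ≤ r → ∫ τ in Ioo 0 r, k (r - τ) * q = ∫ τ in Ioo 0 r, k τ * q := by
      intro r hr
      rw [setIntegral_Ioo_eq_intervalIntegral hr, setIntegral_Ioo_eq_intervalIntegral hr]
      simp
    rw [e _ ht, e _ (by linarith)]
    refine setIntegral_mono_set ?_ (ae_restrict_of_forall_mem measurableSet_Ioo fun τ hτ =>
      mul_nonneg (hk0 _ hτ.1.le) hq) (Filter.Eventually.of_forall
        (Ioo_subset_Ioo_right (by linarith)))
    exact integrableOn_mul_of_abs_le (B := k 0) measurableSet_Ioo hk (fun x hx => by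
      rw [abs_of_nonneg (hk0 _ hx.1.le)]
      exact hka _ _ le_rfl hx.1.le) (hc.mono_set (Ioo_subset_Ioo_right hT))
  have h2 : ∫ τ in Ioo 0 t, k (t + δ - τ) * D τ ≤ ∫ τ in Ioo 0 t, k (t - τ) * D τ := by
    refine setIntegral_mono_on ((integrableOn_conv hk hk0 hka hT hDi).mono_set
      (Ioo_subset_Ioo_right (by linarith))) (integrableOn_conv hk hk0 hka htT hDi)
      measurableSet_Ioo fun τ hτ => ?_
    refine mul_le_mul_of_nonneg_right (hka _ _ (by linarith [hτ.2]) (by linarith)) ?_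
    have := hJle τ ⟨hτ.1, by linarith [hτ.2]⟩
    simp only [hD]; linarith
  have h3 : ∫ τ in Ioo t (t + δ), k (t + δ - τ) * D τ ≤ w * k 0 * δ := by
    calc ∫ τ in Ioo t (t + δ), k (t + δ - τ) * D τ ≤ ∫ _ in Ioo t (t + δ), w * k 0 := by
          refine setIntegral_mono_on ((integrableOn_conv hk hk0 hka hT hDi).mono_set
            (Ioo_subset_Ioo_left ht)) (integrableOn_const measure_Ioo_lt_top.ne) measurableSet_Ioo fun τ hτ => ?_
          have g1 := hJge τ hτ
          have g2 := hJle τ ⟨by linarith [hτ.1], by linarith [hτ.2]⟩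
          have g3 := hk0 (t + δ - τ) (by linarith [hτ.2])
          have g4 := hka 0 (t + δ - τ) le_rfl (by linarith [hτ.2])
          have g5 : D τ ≤ w := by simp only [hD]; linarith
          have g6 : 0 ≤ D τ := by simp only [hD]; linarith
          calc k (t + δ - τ) * D τ ≤ k 0 * w := mul_le_mul g4 g5 g6 (g3.trans g4)
            _ = w * k 0 := mul_comm _ _
      _ = w * k 0 * δ := by simp [hδ]; ring
  have h4 := integral_conv_split hk hk0 hka ht hδ hT hDi
  linarith

include hk hk0 hka in
theorem integral_le_of_conv_diff_le {T' T δ : ℝ} (hT' : 0 < T') (hδ : 0 < δ)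
    (hT : T' + δ ≤ T) {Q L : ℝ → ℝ} (hQm : Measurable Q) {B : ℝ}
    (hQ0 : ∀ t ∈ Icc 0 T, 0 ≤ Q t) (hQB : ∀ t ∈ Icc 0 T, Q t ≤ B)
    (hL : IntegrableOn L (Ioo 0 T')) {e R : ℝ}
    (hLge : ∀ᵐ t ∂(volume.restrict (Ioo 0 T')),
      (∫ τ in Ioo 0 (t + δ), k (t + δ - τ) * Q τ) - (∫ τ in Ioo 0 t, k (t - τ) * Q τ) - e * δ ≤ L t)
    (hLle : ∫ t in Ioo 0 T', L t ≤ δ * R) :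
    k T * ∫ t in Ioo 0 T', Q t ≤ R + e * T' + k 0 * B * δ := by
  have hT0 : 0 < T := by linarith
  have hB0 : 0 ≤ B := (hQ0 0 ⟨le_rfl, hT0.le⟩).trans (hQB 0 ⟨le_rfl, hT0.le⟩)
  have hQi : IntegrableOn Q (Ioo 0 T) := by
    refine Measure.integrableOn_of_bounded (M := B) measure_Ioo_lt_top.ne hQm.aestronglyMeasurable
      (ae_restrict_of_forall_mem measurableSet_Ioo fun t ht => ?_)
    have ht' := Ioo_subset_Icc_self ht
    rw [Real.norm_eq_abs, abs_of_nonneg (hQ0 t ht')]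
    exact hQB t ht'
  set A : ℝ → ℝ := fun t => ∫ τ in Ioo 0 t, k (t - τ) * Q τ with hA
  have hAm : Measurable A := by
    have e : A = fun t => ∫ τ, (Ioo 0 t).indicator (fun τ => k (t - τ) * Q τ) τ := by
      ext t; rw [integral_indicator measurableSet_Ioo]
    rw [e]
    refine StronglyMeasurable.measurable (StronglyMeasurable.integral_prod_right (ν := volume)
      (f := fun t τ => (Ioo 0 t).indicator (fun τ => k (t - τ) * Q τ) τ) ?_)
    have : (Function.uncurry fun t τ => (Ioo 0 t).indicator (fun τ => k (t - τ) * Q τ) τ) =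
        {z : ℝ × ℝ | 0 < z.2 ∧ z.2 < z.1}.indicator (fun z => k (z.1 - z.2) * Q z.2) := by
      ext ⟨t, τ⟩; rfl
    rw [this]
    refine (Measurable.indicator (by fun_prop) ?_).stronglyMeasurable
    exact (measurableSet_lt measurable_const measurable_snd).inter
      (measurableSet_lt measurable_snd measurable_fst)
  have hk00 : 0 ≤ k 0 := hk0 0 le_rfl
  have hA0 : ∀ t ∈ Icc 0 T, 0 ≤ A t := fun t ht =>
    setIntegral_nonneg measurableSet_Ioo fun τ hτ => mul_nonneg (hk0 _ (by linarith [hτ.2]))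
      (hQ0 τ ⟨hτ.1.le, by linarith [hτ.2, ht.2]⟩)
  have hAle : ∀ t ∈ Icc 0 T, A t ≤ k 0 * B * t := by
    intro t ht
    calc A t ≤ ∫ _ in Ioo 0 t, k 0 * B := by
          refine setIntegral_mono_on (integrableOn_conv hk hk0 hka ht.2 hQi)
            (integrableOn_const measure_Ioo_lt_top.ne)
            measurableSet_Ioo fun τ hτ => ?_
          have hτ' : τ ∈ Icc 0 T := ⟨hτ.1.le, by linarith [hτ.2, ht.2]⟩
          exact mul_le_mul (hka _ _ le_rfl (by linarith [hτ.2])) (hQB τ hτ') (hQ0 τ hτ') hk00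
      _ = k 0 * B * t := by simp [ht.1]; ring
  have hAi : ∀ a b, 0 ≤ a → b ≤ T → IntegrableOn A (Ioo a b) := by
    intro a b ha hb
    refine Measure.integrableOn_of_bounded (M := k 0 * B * T) measure_Ioo_lt_top.ne
      hAm.aestronglyMeasurable (ae_restrict_of_forall_mem measurableSet_Ioo fun t ht => ?_)
    have ht' : t ∈ Icc 0 T := ⟨by linarith [ht.1], by linarith [ht.2]⟩
    rw [Real.norm_eq_abs, abs_of_nonneg (hA0 t ht')]
    exact (hAle t ht').trans (mul_le_mul_of_nonneg_left ht'.2 (by positivity))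
  have hAii : ∀ a b, 0 ≤ a → a ≤ b → b ≤ T → IntervalIntegrable A volume a b := by
    intro a b ha hab hb
    rw [intervalIntegrable_iff_integrableOn_Ioo_of_le hab]
    exact hAi a b ha hb
  have hAs : IntervalIntegrable (fun t => A (t + δ)) volume 0 T' := by
    have := (hAii δ (T' + δ) hδ.le (by linarith) hT).comp_add_right δ
    simpa using this
  have hdiff : ∫ t in Ioo 0 T', (A (t + δ) - A t) =
      (∫ t in T'..(T' + δ), A t) - ∫ t in 0..δ, A t := by
    rw [setIntegral_Ioo_eq_intervalIntegral hT'.le,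
      intervalIntegral.integral_sub hAs (hAii _ _ le_rfl hT'.le (by linarith)),
      intervalIntegral.integral_comp_add_right A, zero_add]
    have e1 := intervalIntegral.integral_add_adjacent_intervals
      (hAii 0 δ le_rfl hδ.le (by linarith)) (hAii δ (T' + δ) hδ.le (by linarith) hT)
    have e2 := intervalIntegral.integral_add_adjacent_intervals
      (hAii 0 T' le_rfl hT'.le (by linarith)) (hAii T' (T' + δ) hT'.le (by linarith) hT)
    linarith
  have h1 : (∫ t in Ioo 0 T', (A (t + δ) - A t)) - e * δ * T' ≤ ∫ t in Ioo 0 T', L t := by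
    have hi : IntegrableOn (fun t => A (t + δ) - A t) (Ioo 0 T') := by
      rw [← intervalIntegrable_iff_integrableOn_Ioo_of_le hT'.le]
      exact hAs.sub (hAii _ _ le_rfl hT'.le (by linarith))
    have hc : IntegrableOn (fun _ : ℝ => e * δ) (Ioo 0 T') :=
      integrableOn_const measure_Ioo_lt_top.ne
    have := integral_mono_ae (hi.sub hc) hL hLge
    simp only [Pi.sub_apply] at this
    rw [integral_sub hi hc] at this
    have e3 : ∫ _ in Ioo 0 T', e * δ = e * δ * T' := by simp [hT'.le]; ring
    linarith
  have h2 : ∫ t in 0..δ, A t ≤ δ * (k 0 * B * δ) := by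
    have := intervalIntegral.integral_mono_on hδ.le (hAii 0 δ le_rfl hδ.le (by linarith))
      (g := fun _ => k 0 * B * δ) (by simp) fun t ht => by
        have ht' : t ∈ Icc 0 T := ⟨ht.1, by linarith [ht.2]⟩
        exact (hAle t ht').trans (mul_le_mul_of_nonneg_left ht.2 (by positivity))
    rw [intervalIntegral.integral_const, smul_eq_mul, sub_zero] at this
    exact this
  have h3 : δ * (k T * ∫ t in Ioo 0 T', Q t) ≤ ∫ t in T'..(T' + δ), A t := by
    have := intervalIntegral.integral_mono_on (f := fun _ => k T * ∫ t in Ioo 0 T', Q t)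
      (show T' ≤ T' + δ by linarith) (by simp)
      (hAii T' (T' + δ) hT'.le (by linarith) hT) fun t ht => by
        have htT : t ≤ T := by linarith [ht.2]
        have ht0 : 0 ≤ t := by linarith [ht.1]
        have hci := integrableOn_conv hk hk0 hka htT hQi
        calc k T * ∫ t in Ioo 0 T', Q t = ∫ τ in Ioo 0 T', k T * Q τ := by
              rw [integral_const_mul]
          _ ≤ ∫ τ in Ioo 0 T', k (t - τ) * Q τ := by
              refine setIntegral_mono_on ((hQi.mono_set
                (Ioo_subset_Ioo_right (by linarith))).const_mul _)
                (hci.mono_set (Ioo_subset_Ioo_right ht.1)) measurableSet_Ioo fun τ hτ => ?_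
              exact mul_le_mul_of_nonneg_right (hka _ _ (by linarith [hτ.2, ht.1])
                (by linarith [hτ.1])) (hQ0 τ ⟨hτ.1.le, by linarith [hτ.2]⟩)
          _ ≤ A t := by
              refine setIntegral_mono_set hci (ae_restrict_of_forall_mem measurableSet_Ioo
                fun τ hτ => mul_nonneg (hk0 _ (by linarith [hτ.2]))
                  (hQ0 τ ⟨hτ.1.le, by linarith [hτ.2]⟩))
                (Filter.Eventually.of_forall (Ioo_subset_Ioo_right ht.1))
    rw [intervalIntegral.integral_const, smul_eq_mul, add_sub_cancel_left] at this
    exact this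
  have h4 : δ * (k T * ∫ t in Ioo 0 T', Q t) ≤ δ * (R + e * T' + k 0 * B * δ) := by
    rw [hdiff] at h1
    linarith
  exact le_of_mul_le_mul_left h4 hδ

end Lower

end

section

/-! ### Truncations -/

/-- The truncation `min((z - M)₊, 1)`. -/
def trunc (M z : ℝ) : ℝ := min (max (z - M) 0) 1

/-- The primitive of `trunc M` vanishing at `M`. -/
def truncPrim (M z : ℝ) : ℝ := max (z - M) 0 * trunc M z - trunc M z ^ 2 / 2

theorem continuous_trunc (M : ℝ) : Continuous (trunc M) := by unfold trunc; fun_prop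

theorem continuous_truncPrim (M : ℝ) : Continuous (truncPrim M) := by
  have := continuous_trunc M
  unfold truncPrim; fun_prop

theorem trunc_nonneg (M z : ℝ) : 0 ≤ trunc M z := le_min (le_max_right _ _) zero_le_one

theorem trunc_le_one (M z : ℝ) : trunc M z ≤ 1 := min_le_right _ _

theorem abs_trunc_le_one (M z : ℝ) : |trunc M z| ≤ 1 := by
  rw [abs_of_nonneg (trunc_nonneg M z)]; exact trunc_le_one M z

theorem trunc_eq_zero {M z : ℝ} (h : z ≤ M) : trunc M z = 0 := by
  rw [trunc, max_eq_right (by linarith), min_eq_left zero_le_one]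

theorem trunc_mono (M : ℝ) : Monotone (trunc M) := fun a b h => by
  unfold trunc; gcongr

theorem abs_trunc_sub_le (M a b : ℝ) : |trunc M a - trunc M b| ≤ |a - b| := by
  have h1 := abs_min_sub_min_le_max (max (a - M) 0) 1 (max (b - M) 0) 1
  have h2 := abs_max_sub_max_le_max (a - M) 0 (b - M) 0
  rw [sub_self, abs_zero, max_eq_left (abs_nonneg (max (a - M) 0 - max (b - M) 0))] at h1
  rw [sub_self, abs_zero, max_eq_left (abs_nonneg (a - M - (b - M)))] at h2
  refine (h1.trans h2).trans_eq ?_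
  congr 1; ring

theorem abs_trunc_le {M : ℝ} (hM : 0 ≤ M) (z : ℝ) : |trunc M z| ≤ |z| := by
  have := abs_trunc_sub_le M z 0
  rwa [trunc_eq_zero hM, sub_zero, sub_zero] at this

theorem sub_mul_trunc_sub_nonneg (M a b : ℝ) : 0 ≤ (a - b) * (trunc M a - trunc M b) := by
  rcases le_total a b with h | h
  · exact mul_nonneg_of_nonpos_of_nonpos (by linarith) (by linarith [trunc_mono M h])
  · exact mul_nonneg (by linarith) (by linarith [trunc_mono M h])

theorem sub_mul_trunc_le (M a b : ℝ) : (b - a) * trunc M a ≤ truncPrim M b - truncPrim M a := by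
  have h1 : ∀ h ∈ Icc (0 : ℝ) 1, max (b - M) 0 * h - h ^ 2 / 2 ≤ truncPrim M b := by
    intro h hh
    unfold truncPrim trunc
    have hp : 0 ≤ max (b - M) 0 := le_max_right _ _
    set p := max (b - M) 0
    rcases le_total p 1 with hp1 | hp1
    · rw [min_eq_left hp1]; nlinarith [sq_nonneg (p - h)]
    · rw [min_eq_right hp1]; nlinarith [mul_nonneg (sub_nonneg.2 hp1) (sub_nonneg.2 hh.2), hh.1, hh.2]
  have h2 := h1 (trunc M a) ⟨trunc_nonneg M a, trunc_le_one M a⟩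
  have h3 : (b - a) * trunc M a ≤ (max (b - M) 0 - max (a - M) 0) * trunc M a := by
    rcases le_total a M with h | h
    · rw [trunc_eq_zero h]; simp
    · refine mul_le_mul_of_nonneg_right ?_ (trunc_nonneg M a)
      rw [max_eq_left (sub_nonneg.2 h)]
      linarith [le_max_left (b - M) 0]
  have h4 : truncPrim M a = max (a - M) 0 * trunc M a - trunc M a ^ 2 / 2 := rfl
  linarith

theorem truncPrim_eq_zero {M z : ℝ} (h : z ≤ M) : truncPrim M z = 0 := by
  rw [truncPrim, trunc_eq_zero h]; simp

theorem truncPrim_nonneg (M z : ℝ) : 0 ≤ truncPrim M z := by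
  have := sub_mul_trunc_le M (min z M) z
  rw [trunc_eq_zero (min_le_right _ _), truncPrim_eq_zero (min_le_right _ _)] at this
  linarith

theorem truncPrim_sub_le (M a b : ℝ) : truncPrim M a - truncPrim M b ≤ |a - b| := by
  have h := sub_mul_trunc_le M a b
  have h1 : (a - b) * trunc M a ≤ |a - b| * 1 :=
    mul_le_mul (le_abs_self _) (trunc_le_one M a) (trunc_nonneg M a) (abs_nonneg _)
  linarith

theorem abs_truncPrim_sub_le (M a b : ℝ) : |truncPrim M a - truncPrim M b| ≤ |a - b| := by
  rw [abs_le]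
  have h1 := truncPrim_sub_le M a b
  have h2 := truncPrim_sub_le M b a
  rw [abs_sub_comm b a] at h2
  constructor <;> linarith

theorem truncPrim_le_abs {M : ℝ} (hM : 0 ≤ M) (z : ℝ) : truncPrim M z ≤ |z| := by
  have := truncPrim_sub_le M z 0
  rwa [truncPrim_eq_zero hM, sub_zero, sub_zero] at this

theorem truncPrim_le_mul_trunc {M : ℝ} (hM : 0 ≤ M) (z : ℝ) : truncPrim M z ≤ z * trunc M z := by
  have := sub_mul_trunc_le M z 0
  rw [truncPrim_eq_zero hM] at this
  linarith

theorem le_of_truncPrim_eq_zero {M z : ℝ} (h : truncPrim M z = 0) : z ≤ M := by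
  by_contra! hz
  unfold truncPrim trunc at h
  rw [max_eq_left (by linarith)] at h
  rcases le_total (z - M) 1 with h1 | h1
  · rw [min_eq_left h1] at h; nlinarith
  · rw [min_eq_right h1] at h; nlinarith

/-! ### Gagliardo quotients -/

variable {n : ℕ}

/-- The square root of the Gagliardo integrand, with sign. -/
def gagliardoQuot (s : ℝ) (v : Space n → ℝ) (p : Space n × Space n) : ℝ :=
  (v p.1 - v p.2) / ‖p.1 - p.2‖ ^ (((n : ℝ) + 2 * s) / 2)

theorem rpow_half_mul_self {r e : ℝ} (hr : 0 ≤ r) : r ^ (e / 2) * r ^ (e / 2) = r ^ e := by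
  rw [← Real.mul_rpow hr hr, ← pow_two, ← Real.rpow_natCast, ← Real.rpow_mul hr]
  congr 1; push_cast; ring

theorem gagliardoQuot_mul (s : ℝ) (u v : Space n → ℝ) (p : Space n × Space n) :
    gagliardoQuot s u p * gagliardoQuot s v p =
      (u p.1 - u p.2) * (v p.1 - v p.2) / ‖p.1 - p.2‖ ^ ((n : ℝ) + 2 * s) := by
  rw [gagliardoQuot, gagliardoQuot, div_mul_div_comm, rpow_half_mul_self (norm_nonneg _)]

theorem fracLaplacianForm_eq (s : ℝ) (u v : Space n → ℝ) : fracLaplacianForm s u v =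
    fracConst n s / 2 * ∫ p, gagliardoQuot s u p * gagliardoQuot s v p := by
  simp_rw [gagliardoQuot_mul]; rfl

theorem gagliardoSq_eq (s : ℝ) (v : Space n → ℝ) :
    gagliardoSq s v = ∫⁻ p, ‖gagliardoQuot s v p‖ₑ ^ (2 : ℝ) := by
  refine lintegral_congr fun p => ?_
  rw [Real.enorm_eq_ofReal_abs, ENNReal.ofReal_rpow_of_nonneg (abs_nonneg _) zero_le_two]
  congr 1
  rw [Real.rpow_two, sq_abs, pow_two, pow_two, gagliardoQuot_mul]

theorem gagliardoQuot_congr {s : ℝ} {u v : Space n → ℝ} (h : u =ᵐ[volume] v) :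
    gagliardoQuot s u =ᵐ[volume] gagliardoQuot s v := by
  have h1 : ∀ᵐ p : Space n × Space n, u p.1 = v p.1 :=
    Measure.quasiMeasurePreserving_fst.ae_eq_comp h
  have h2 : ∀ᵐ p : Space n × Space n, u p.2 = v p.2 :=
    Measure.quasiMeasurePreserving_snd.ae_eq_comp h
  filter_upwards [h1, h2] with p h1 h2
  rw [gagliardoQuot, gagliardoQuot, h1, h2]

theorem gagliardoSq_congr {s : ℝ} {u v : Space n → ℝ} (h : u =ᵐ[volume] v) :
    gagliardoSq s u = gagliardoSq s v := by
  rw [gagliardoSq_eq, gagliardoSq_eq]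
  refine lintegral_congr_ae ?_
  filter_upwards [gagliardoQuot_congr h] with p hp
  rw [hp]

theorem fracLaplacianForm_congr {s : ℝ} {u u' v v' : Space n → ℝ} (hu : u =ᵐ[volume] u')
    (hv : v =ᵐ[volume] v') : fracLaplacianForm s u v = fracLaplacianForm s u' v' := by
  rw [fracLaplacianForm_eq, fracLaplacianForm_eq]
  congr 1
  refine integral_congr_ae ?_
  filter_upwards [gagliardoQuot_congr hu, gagliardoQuot_congr hv] with p h1 h2
  rw [h1, h2]

theorem gagliardoSq_mono {s : ℝ} {u v : Space n → ℝ} (h : ∀ x y, |u x - u y| ≤ |v x - v y|) :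
    gagliardoSq s u ≤ gagliardoSq s v := by
  refine lintegral_mono fun p => ENNReal.ofReal_le_ofReal ?_
  refine div_le_div_of_nonneg_right (sq_le_sq.2 (h _ _)) (by positivity)

theorem gagliardoSq_add_le {s : ℝ} {u v : Space n → ℝ} (hu : Measurable u) :
    gagliardoSq s (fun x => u x + v x) ≤
      ENNReal.ofReal 2 * gagliardoSq s u + ENNReal.ofReal 2 * gagliardoSq s v := by
  unfold gagliardoSq
  rw [← lintegral_const_mul' _ _ ENNReal.ofReal_ne_top,
    ← lintegral_const_mul' _ _ ENNReal.ofReal_ne_top,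
    ← lintegral_add_left (by fun_prop)]
  refine lintegral_mono fun p => ?_
  rw [← ENNReal.ofReal_mul zero_le_two, ← ENNReal.ofReal_mul zero_le_two,
    ← ENNReal.ofReal_add (by positivity) (by positivity)]
  refine ENNReal.ofReal_le_ofReal ?_
  rw [← mul_div_assoc, ← mul_div_assoc, ← add_div]
  refine div_le_div_of_nonneg_right ?_ (by positivity)
  nlinarith [sq_nonneg ((u p.1 - u p.2) - (v p.1 - v p.2))]

theorem integrable_min_div_norm_rpow (hn : 1 ≤ n) {s : ℝ} (hs : s ∈ Ioo (0 : ℝ) 1) :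
    Integrable fun z : Space n => min 1 (‖z‖ ^ 2) / ‖z‖ ^ ((n : ℝ) + 2 * s) := by
  have : Nontrivial (Space n) := by
    have : Nonempty (Fin n) := ⟨⟨0, hn⟩⟩
    infer_instance
  rw [integrable_fun_norm_addHaar volume
    (f := fun r : ℝ => min 1 (r ^ 2) / r ^ ((n : ℝ) + 2 * s))]
  have hd : Module.finrank ℝ (Space n) = n := finrank_euclideanSpace_fin
  rw [hd, ← Ioc_union_Ioi_eq_Ioi zero_le_one, integrableOn_union]
  have e : ∀ y : ℝ, 0 < y → y ^ (n - 1) / y ^ ((n : ℝ) + 2 * s) = y ^ (-1 - 2 * s) := by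
    intro y hy
    rw [← Real.rpow_natCast, ← Real.rpow_sub hy, Nat.cast_sub hn]
    congr 1; push_cast; ring
  constructor
  · have h1 : IntegrableOn (fun y : ℝ => y ^ (1 - 2 * s)) (Ioc 0 1) := by
      have := intervalIntegral.intervalIntegrable_rpow' (a := 0) (b := 1)
        (show -1 < 1 - 2 * s by linarith [hs.2])
      rwa [intervalIntegrable_iff_integrableOn_Ioc_of_le zero_le_one] at this
    refine h1.congr_fun (fun y hy => ?_) measurableSet_Ioc
    simp only [smul_eq_mul]
    rw [min_eq_right (by nlinarith [hy.1, hy.2]), ← mul_div_assoc, mul_div_right_comm, e y hy.1,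
      ← Real.rpow_natCast, ← Real.rpow_add hy.1]
    congr 1; push_cast; ring
  · have h1 : IntegrableOn (fun y : ℝ => y ^ (-1 - 2 * s)) (Ioi 1) :=
      integrableOn_Ioi_rpow_of_lt (by linarith [hs.1]) one_pos
    refine h1.congr_fun (fun y hy => ?_) measurableSet_Ioi
    simp only [smul_eq_mul]
    have hy1 : 1 < y := hy
    rw [min_eq_left (by nlinarith), ← mul_div_assoc, mul_one, e y (by linarith)]

theorem exists_gagliardoSq_le (hn : 1 ≤ n) {s : ℝ} (hs : s ∈ Ioo (0 : ℝ) 1) (L B : ℝ)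
    {S : Set (Space n)} (hS : MeasurableSet S) (hSf : volume S ≠ ⊤) :
    ∃ C : ℝ≥0∞, C ≠ ⊤ ∧ ∀ v : Space n → ℝ, (∀ x y, |v x - v y| ≤ L * ‖x - y‖) →
      (∀ x, |v x| ≤ B) → (∀ x, x ∉ S → v x = 0) → gagliardoSq s v ≤ C := by
  set k : Space n → ℝ≥0∞ := fun z =>
    ENNReal.ofReal (min 1 (‖z‖ ^ 2) / ‖z‖ ^ ((n : ℝ) + 2 * s)) with hk
  have hkm : Measurable k := by rw [hk]; fun_prop
  have hkI : ∫⁻ z, k z ≠ ⊤ := by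
    have h := (integrable_min_div_norm_rpow hn hs).2
    rw [hasFiniteIntegral_iff_ofReal (Filter.Eventually.of_forall fun z => by positivity)] at h
    exact h.ne
  set A : ℝ≥0∞ := ENNReal.ofReal (L ^ 2 + (2 * B) ^ 2)
  refine ⟨A * (volume S * ∫⁻ z, k z) + A * (volume S * ∫⁻ z, k z), by finiteness,
    fun v hL hB h0 => ?_⟩
  have hbound : ∀ p : Space n × Space n,
      ENNReal.ofReal ((v p.1 - v p.2) ^ 2 / ‖p.1 - p.2‖ ^ ((n : ℝ) + 2 * s)) ≤
        A * (S.indicator (fun _ => 1) p.1 * k (p.1 - p.2)) +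
        A * (S.indicator (fun _ => 1) p.2 * k (p.1 - p.2)) := by
    intro p
    by_cases h : p.1 ∉ S ∧ p.2 ∉ S
    · rw [h0 _ h.1, h0 _ h.2]; simp
    have hle : ENNReal.ofReal ((v p.1 - v p.2) ^ 2 / ‖p.1 - p.2‖ ^ ((n : ℝ) + 2 * s)) ≤
        A * k (p.1 - p.2) := by
      rw [hk, ← ENNReal.ofReal_mul (by positivity), ← mul_div_assoc]
      refine ENNReal.ofReal_le_ofReal (div_le_div_of_nonneg_right ?_ (by positivity))
      have h1 : (v p.1 - v p.2) ^ 2 ≤ L ^ 2 * ‖p.1 - p.2‖ ^ 2 := by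
        rw [← mul_pow, ← sq_abs]
        exact pow_le_pow_left₀ (abs_nonneg _) (hL _ _) 2
      have h2 : (v p.1 - v p.2) ^ 2 ≤ (2 * B) ^ 2 := by
        rw [← sq_abs]
        refine pow_le_pow_left₀ (abs_nonneg _) ?_ 2
        have := abs_sub (v p.1) (v p.2)
        linarith [hB p.1, hB p.2]
      rcases le_total 1 (‖p.1 - p.2‖ ^ 2) with h3 | h3
      · rw [min_eq_left h3]; nlinarith [sq_nonneg L]
      · rw [min_eq_right h3]; nlinarith [sq_nonneg B, sq_nonneg ‖p.1 - p.2‖]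
    refine hle.trans ?_
    by_cases h1 : p.1 ∈ S
    · rw [indicator_of_mem h1, one_mul]; exact le_self_add
    · have h2 : p.2 ∈ S := by by_contra h2; exact h ⟨h1, h2⟩
      rw [indicator_of_mem h2, one_mul]; exact le_add_self
  have hind : Measurable (S.indicator fun _ => (1 : ℝ≥0∞)) := measurable_const.indicator hS
  have hIS : ∫⁻ x, S.indicator (fun _ => (1 : ℝ≥0∞)) x = volume S := by
    rw [lintegral_indicator hS]; simp
  refine (lintegral_mono hbound).trans ?_
  rw [lintegral_add_left (by fun_prop), lintegral_const_mul _ (by fun_prop),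
    lintegral_const_mul _ (by fun_prop)]
  refine add_le_add (le_of_eq ?_) (le_of_eq ?_)
  · congr 1
    rw [Measure.volume_eq_prod, lintegral_prod _ (by fun_prop)]
    simp only
    rw [← hIS, ← lintegral_mul_const _ hind]
    refine lintegral_congr fun x => ?_
    rw [lintegral_const_mul _ (by fun_prop), lintegral_sub_left_eq_self k x]
  · congr 1
    rw [Measure.volume_eq_prod, lintegral_prod_symm _ (by fun_prop)]
    simp only
    rw [← hIS, ← lintegral_mul_const _ hind]
    refine lintegral_congr fun x => ?_
    rw [lintegral_const_mul _ (by fun_prop), lintegral_sub_right_eq_self k x]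

end

section

variable {n : ℕ}

theorem ae_tendsto_of_tsum_eLpNorm_sq {X : Type*} [MeasurableSpace X] {μ : Measure X}
    {F : ℕ → X → ℝ} {f : X → ℝ} (hF : ∀ j, AEStronglyMeasurable (F j) μ)
    (hf : AEStronglyMeasurable f μ)
    (h : ∑' j, eLpNorm (F j - f) 2 μ ^ (2 : ℝ) ≠ ⊤) :
    ∀ᵐ x ∂μ, Filter.Tendsto (fun j => F j x) Filter.atTop (nhds (f x)) := by
  have e : ∀ j, eLpNorm (F j - f) 2 μ ^ (2 : ℝ) = ∫⁻ x, ‖F j x - f x‖ₑ ^ (2 : ℝ) ∂μ := by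
    intro j
    rw [eLpNorm_eq_lintegral_rpow_enorm_toReal (by simp) (by simp), ← ENNReal.rpow_mul]
    simp
  simp_rw [e] at h
  have hm : ∀ j, AEMeasurable (fun x => ‖F j x - f x‖ₑ ^ (2 : ℝ)) μ := fun j =>
    ((hF j).sub hf).enorm.pow_const _
  rw [← lintegral_tsum hm] at h
  have h2 := ae_lt_top' (AEMeasurable.tsum hm) h
  filter_upwards [h2] with x hx
  have h3 := ENNReal.tendsto_atTop_zero_of_tsum_ne_top hx.ne
  have h4 : Filter.Tendsto (fun j => (‖F j x - f x‖ₑ ^ (2 : ℝ)) ^ (1 / 2 : ℝ)) Filter.atTop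
      (nhds 0) := by
    have := (ENNReal.continuous_rpow_const (y := (1 / 2 : ℝ))).tendsto (0 : ℝ≥0∞)
    rw [ENNReal.zero_rpow_of_pos (by norm_num)] at this
    exact this.comp h3
  rw [tendsto_iff_edist_tendsto_0]
  refine h4.congr fun j => ?_
  rw [← ENNReal.rpow_mul, edist_eq_enorm_sub]
  norm_num

/-- A continuous curve in `L²` has a jointly measurable representative. -/
theorem exists_measurable_rep {T : ℝ} {u : ℝ → L2 n} (hu : ContinuousOn u (Icc 0 T)) :
    ∃ U : ℝ × Space n → ℝ, Measurable U ∧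
      ∀ t ∈ Icc 0 T, (fun x => U (t, x)) =ᵐ[volume] u t := by
  have huc := isCompact_Icc.uniformContinuousOn_of_continuous hu
  have h1 : ∀ j : ℕ, ∃ δ > 0, ∀ r ∈ Icc 0 T, ∀ r' ∈ Icc 0 T, dist r r' < δ →
      dist (u r) (u r') < (1 / 2 : ℝ) ^ j := fun j => by
    have := Metric.uniformContinuousOn_iff.1 huc ((1 / 2 : ℝ) ^ j) (by positivity)
    exact this
  choose δ hδ hδu using h1
  set ρ : ℕ → ℝ → ℝ := fun j t => ⌊t / δ j⌋ * δ j with hρ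
  set F : ℕ → ℝ × Space n → ℝ := fun j z => u (ρ j z.1) z.2 with hF
  have hFm : ∀ j, Measurable (F j) := by
    intro j
    have h2 : Measurable fun z : ℤ × Space n => u (z.1 * δ j) z.2 :=
      measurable_from_prod_countable_right fun k => (Lp.stronglyMeasurable (u (k * δ j))).measurable
    have h3 : Measurable fun z : ℝ × Space n => ((⌊z.1 / δ j⌋ : ℤ), z.2) :=
      (Int.measurable_floor.comp (measurable_fst.div_const _)).prodMk measurable_snd
    exact h2.comp h3
  refine ⟨fun z => Filter.limsup (fun j => F j z) Filter.atTop, Measurable.limsup hFm,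
    fun t ht => ?_⟩
  have hρt : ∀ j, ρ j t ∈ Icc 0 T ∧ dist (ρ j t) t < δ j := by
    intro j
    have h2 : ρ j t ≤ t := by
      have := Int.floor_le (t / δ j)
      rwa [le_div_iff₀ (hδ j)] at this
    have h3 : t < ρ j t + δ j := by
      have := Int.lt_floor_add_one (t / δ j)
      rw [div_lt_iff₀ (hδ j)] at this
      simp only [hρ]; linarith
    have h4 : 0 ≤ ρ j t := mul_nonneg
      (by exact_mod_cast Int.floor_nonneg.2 (div_nonneg ht.1 (hδ j).le)) (hδ j).le
    refine ⟨⟨h4, h2.trans ht.2⟩, ?_⟩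
    rw [Real.dist_eq, abs_sub_comm, abs_of_nonneg (by linarith)]
    linarith
  have hsum : ∑' j, eLpNorm (⇑(u (ρ j t)) - ⇑(u t)) 2 volume ^ (2 : ℝ) ≠ ⊤ := by
    have hle : ∀ j : ℕ, eLpNorm (⇑(u (ρ j t)) - ⇑(u t)) 2 volume ^ (2 : ℝ) ≤
        (ENNReal.ofReal (1 / 2)) ^ j := by
      intro j
      have h5 := hδu j _ (hρt j).1 t ht (hρt j).2
      have h6 : eLpNorm (⇑(u (ρ j t)) - ⇑(u t)) 2 volume ≤ ENNReal.ofReal (1 / 2) ^ j := by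
        rw [← Lp.edist_def, edist_dist, ← ENNReal.ofReal_pow (by norm_num)]
        exact ENNReal.ofReal_le_ofReal h5.le
      calc _ ≤ (ENNReal.ofReal (1 / 2) ^ j) ^ (2 : ℝ) := ENNReal.rpow_le_rpow h6 zero_le_two
        _ = ENNReal.ofReal (1 / 2) ^ j * ENNReal.ofReal (1 / 2) ^ j := by
            rw [ENNReal.rpow_two, pow_two]
        _ ≤ ENNReal.ofReal (1 / 2) ^ j * 1 := by
            gcongr
            refine pow_le_one₀ (by simp) ?_
            rw [ENNReal.ofReal_le_one]; norm_num
        _ = _ := mul_one _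
    refine ne_top_of_le_ne_top ?_ (ENNReal.tsum_le_tsum hle)
    rw [ENNReal.tsum_geometric]
    refine ENNReal.inv_ne_top.2 ?_
    rw [ne_eq, tsub_eq_zero_iff_le, not_le, ENNReal.ofReal_lt_one]
    norm_num
  filter_upwards [ae_tendsto_of_tsum_eLpNorm_sq
    (fun j => Lp.aestronglyMeasurable (u (ρ j t))) (Lp.aestronglyMeasurable (u t)) hsum] with x hx
  exact hx.limsup_eq

theorem setIntegral_abs_sub_le {Ω : Set (Space n)} (hΩf : volume Ω ≠ ⊤) (v w : L2 n) :
    ∫ x in Ω, |v x - w x| ≤ (volume Ω).toReal ^ (1 / 2 : ℝ) * ‖v - w‖ := by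
  have h1 : MemLp (v - w : L2 n) 2 (volume.restrict Ω) := (Lp.memLp (v - w)).restrict Ω
  have hfin : IsFiniteMeasure (volume.restrict Ω) := ⟨by simpa using hΩf.lt_top⟩
  have h2 : ∫ x in Ω, |v x - w x| = ∫ x in Ω, ‖(v - w : L2 n) x‖ := by
    refine integral_congr_ae ?_
    filter_upwards [ae_restrict_of_ae (Lp.coeFn_sub v w)] with x hx
    rw [hx, Real.norm_eq_abs]; rfl
  rw [h2, ← ENNReal.ofReal_le_ofReal_iff (by positivity),
    ofReal_integral_norm_eq_lintegral_enorm (h1.integrable one_le_two), ← eLpNorm_one_eq_lintegral_enorm]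
  refine (eLpNorm_le_eLpNorm_mul_rpow_measure_univ one_le_two h1.aestronglyMeasurable).trans ?_
  rw [mul_comm, ENNReal.ofReal_mul (by positivity)]
  refine mul_le_mul' (le_of_eq ?_) ?_
  · rw [Measure.restrict_apply_univ, ← ENNReal.ofReal_rpow_of_nonneg (by positivity) (by norm_num),
      ENNReal.ofReal_toReal hΩf]
    norm_num
  · rw [ofReal_norm, Lp.enorm_def]
    exact eLpNorm_mono_measure _ Measure.restrict_le_self

end

section

variable {n : ℕ}

/-- Integrated weak form of `∂ₜ^α U + (-Δ)^s U = b` in `Ω × (0,T)` with `U(0) = 0`, where `U ≤ M`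
outside `Ω` and `b ≤ K` wherever `U > 0`. -/
structure IsSubsolution (α s T : ℝ) (Ω : Set (Space n)) (K M : ℝ) (u : ℝ → L2 n)
    (U b : ℝ × Space n → ℝ) : Prop where
  continuousOn : ContinuousOn u (Icc 0 T)
  measurable : Measurable U
  rep : ∀ t ∈ Icc 0 T, (fun x => U (t, x)) =ᵐ[volume] u t
  measurable_source : Measurable b
  integrable_source : IntegrableOn b (Ioo 0 T ×ˢ Ω)
  exterior : ∀ᵐ t ∂(volume.restrict (Ioo 0 T)), ∀ᵐ x, x ∉ Ω → U (t, x) ≤ M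
  energy : ∫⁻ t in Ioo 0 T, gagliardoSq s (fun x => U (t, x)) < ⊤
  source_le : ∀ᵐ t ∂(volume.restrict (Ioo 0 T)), ∀ᵐ x ∂(volume.restrict Ω),
    0 < U (t, x) → b (t, x) ≤ K
  equation : ∀ v : Space n → ℝ, Measurable v → (∀ x, |v x| ≤ 1) → MemHsTilde s Ω v →
    ∀ t ∈ Ioo 0 T,
    ∫ τ in Ioo 0 t, phi (1 - α) (t - τ) * ∫ x, U (τ, x) * v x =
      ∫ τ in Ioo 0 t, ((∫ x in Ω, b (τ, x) * v x) - fracLaplacianForm s (fun x => U (τ, x)) v)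

theorem integrable_integral_mul {X : Type*} [MeasureSpace X] [SFinite (volume : Measure X)]
    (p q : ℝ≥0∞) [p.HolderConjugate q] {P V : ℝ × X → ℝ} (hP : MemLp P p) (hV : MemLp V q) :
    Integrable fun t => ∫ x, P (t, x) * V (t, x) := by
  have h : Integrable (fun z : ℝ × X => P z * V z) := hP.integrable_mul hV
  rw [Measure.volume_eq_prod] at h
  exact h.integral_prod_left

namespace IsSubsolution

variable {α s T K M : ℝ} {Ω : Set (Space n)} {u : ℝ → L2 n} {U b : ℝ × Space n → ℝ}

/-- The barrier-subtracted function. -/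
def excess (α K : ℝ) (U : ℝ × Space n → ℝ) (z : ℝ × Space n) : ℝ := U z - K * phi (1 + α) z.1

/-- The source minus `K`, extended by zero. -/
def srcExt (T K : ℝ) (Ω : Set (Space n)) (b : ℝ × Space n → ℝ) : ℝ × Space n → ℝ :=
  (Ioo 0 T ×ˢ Ω).indicator fun z => b z - K

/-- The Gagliardo quotients of the slices, extended by zero. -/
def quotExt (s T : ℝ) (V : ℝ × Space n → ℝ) (w : ℝ × (Space n × Space n)) : ℝ :=
  (Ioo 0 T).indicator (fun t => gagliardoQuot s (fun x => V (t, x)) w.2) w.1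

theorem measurable_quotExt {V : ℝ × Space n → ℝ} (hV : Measurable V) :
    Measurable (quotExt s T V) := by
  have : quotExt s T V = (Prod.fst ⁻¹' Ioo 0 T).indicator
      fun w : ℝ × (Space n × Space n) => gagliardoQuot s (fun x => V (w.1, x)) w.2 := by
    ext w; rfl
  rw [this]
  refine Measurable.indicator ?_ (measurable_fst measurableSet_Ioo)
  unfold gagliardoQuot
  fun_prop

theorem memLp_quotExt {V : ℝ × Space n → ℝ} (hV : Measurable V)
    (h : ∫⁻ t in Ioo 0 T, gagliardoSq s (fun x => V (t, x)) < ⊤) :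
    MemLp (quotExt s T V) 2 volume := by
  have hm := measurable_quotExt (s := s) (T := T) hV
  refine ⟨hm.aestronglyMeasurable, ?_⟩
  rw [eLpNorm_lt_top_iff_lintegral_rpow_enorm_lt_top (by simp) (by simp),
    Measure.volume_eq_prod, lintegral_prod _ (by fun_prop)]
  refine lt_of_eq_of_lt ?_ h
  rw [← lintegral_indicator measurableSet_Ioo]
  refine lintegral_congr fun t => ?_
  by_cases ht : t ∈ Ioo 0 T
  · rw [indicator_of_mem ht, gagliardoSq_eq]
    refine lintegral_congr fun p => ?_
    simp only [quotExt, indicator_of_mem ht]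
    norm_num
  · rw [indicator_of_notMem ht]
    simp only [quotExt, indicator_of_notMem ht]
    simp

theorem memLp_quotExt_const {v : Space n → ℝ} (hv : Measurable v) (h : gagliardoSq s v < ⊤) :
    MemLp (quotExt s T fun z => v z.2) 2 volume := by
  refine memLp_quotExt (hv.comp measurable_snd) ?_
  simp only [lintegral_const, Measure.restrict_apply_univ]
  exact ENNReal.mul_lt_top h measure_Ioo_lt_top

variable (hu : IsSubsolution α s T Ω K M u U b) (hΩ : MeasurableSet Ω) (hΩf : volume Ω ≠ ⊤)

include hu in
theorem measurable_excess : Measurable (excess α K U) := by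
  have := hu.measurable
  unfold excess; fun_prop

include hΩ hu in
theorem measurable_srcExt : Measurable (srcExt T K Ω b) :=
  (hu.measurable_source.sub_const K).indicator (measurableSet_Ioo.prod hΩ)

include hΩ hΩf hu in
theorem memLp_srcExt : MemLp (srcExt T K Ω b) 1 volume := by
  rw [memLp_one_iff_integrable, srcExt,
    integrable_indicator_iff (measurableSet_Ioo.prod hΩ)]
  refine hu.integrable_source.sub (integrableOn_const ?_)
  rw [Measure.volume_eq_prod, Measure.prod_prod]
  exact ENNReal.mul_ne_top measure_Ioo_lt_top.ne hΩf

include hu in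
theorem memLp_quotExt_self : MemLp (quotExt s T U) 2 volume := memLp_quotExt hu.measurable hu.energy

/-- The right-hand side of the equation for the excess, tested with `v`. -/
def testedSource (s K : ℝ) (Ω : Set (Space n)) (U b : ℝ × Space n → ℝ) (v : Space n → ℝ)
    (τ : ℝ) : ℝ :=
  (∫ x in Ω, (b (τ, x) - K) * v x) - fracLaplacianForm s (fun x => U (τ, x)) v

include hΩ in
theorem testedSource_eq {v : Space n → ℝ} {τ : ℝ} (hτ : τ ∈ Ioo 0 T) :
    testedSource s K Ω U b v τ = (∫ x, srcExt T K Ω b (τ, x) * Ω.indicator v x) -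
      fracConst n s / 2 * ∫ p, quotExt s T U (τ, p) * gagliardoQuot s v p := by
  rw [testedSource, fracLaplacianForm_eq, ← integral_indicator hΩ]
  congr 1
  · refine integral_congr_ae (Filter.Eventually.of_forall fun x => ?_)
    by_cases hx : x ∈ Ω
    · have : (τ, x) ∈ Ioo 0 T ×ˢ Ω := ⟨hτ, hx⟩
      simp only [indicator_of_mem hx, srcExt, indicator_of_mem this]
    · simp only [indicator_of_notMem hx, mul_zero]
  · simp only [quotExt, indicator_of_mem hτ]

include hΩ hΩf hu in
theorem integrableOn_testedSource {v : Space n → ℝ} (hv : Measurable v) {B : ℝ}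
    (hB : ∀ x, |v x| ≤ B) (hvs : gagliardoSq s v < ⊤) :
    IntegrableOn (testedSource s K Ω U b v) (Ioo 0 T) := by
  have hV : MemLp (fun z : ℝ × Space n => Ω.indicator v z.2) ⊤ volume :=
    memLp_top_of_bound ((hv.indicator hΩ).comp measurable_snd).aestronglyMeasurable B
      (Filter.Eventually.of_forall fun z => (norm_indicator_le_norm_self v _).trans (hB _))
  have h1 := integrable_integral_mul 1 ⊤ (hu.memLp_srcExt hΩ hΩf) hV
  have h2 := integrable_integral_mul 2 2 hu.memLp_quotExt_self (memLp_quotExt_const (T := T) hv hvs)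
  refine (Integrable.sub (h1.integrableOn (s := Ioo 0 T))
    (Integrable.const_mul (h2.integrableOn (s := Ioo 0 T)) (fracConst n s / 2))).congr
    (ae_restrict_of_forall_mem measurableSet_Ioo fun τ hτ => ?_)
  rw [testedSource_eq hΩ hτ]
  simp only [Pi.sub_apply]
  congr 3
  simp only [quotExt, indicator_of_mem hτ]

/-- The excess tested with `v`. -/
def testedExcess (α K : ℝ) (Ω : Set (Space n)) (U : ℝ × Space n → ℝ) (v : Space n → ℝ)
    (τ : ℝ) : ℝ := ∫ x in Ω, excess α K U (τ, x) * v x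

include hu in
theorem memLp_slice {t : ℝ} (ht : t ∈ Icc 0 T) : MemLp (fun x => U (t, x)) 2 volume :=
  (memLp_congr_ae (hu.rep t ht)).2 (Lp.memLp (u t))

include hu hΩf in
theorem integrableOn_slice {t : ℝ} (ht : t ∈ Icc 0 T) : IntegrableOn (fun x => U (t, x)) Ω := by
  have hfin : IsFiniteMeasure (volume.restrict Ω) := ⟨by simpa using hΩf.lt_top⟩
  exact ((hu.memLp_slice ht).restrict Ω).integrable one_le_two

include hu hΩf in
theorem integrableOn_excess {t : ℝ} (ht : t ∈ Icc 0 T) :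
    IntegrableOn (fun x => excess α K U (t, x)) Ω :=
  (hu.integrableOn_slice hΩf ht).sub (integrableOn_const (C := K * phi (1 + α) t) hΩf)

include hΩf in
theorem integrableOn_of_bounded {v : Space n → ℝ} (hv : Measurable v) {B : ℝ}
    (hB : ∀ x, |v x| ≤ B) : IntegrableOn v Ω :=
  Measure.integrableOn_of_bounded hΩf hv.aestronglyMeasurable
    (Filter.Eventually.of_forall fun x => hB x)

include hu hΩf in
theorem testedExcess_eq {v : Space n → ℝ} (hv : Measurable v) {B : ℝ} (hB : ∀ x, |v x| ≤ B)
    (hvΩ : ∀ᵐ x, x ∉ Ω → v x = 0) {τ : ℝ} (hτ : τ ∈ Icc 0 T) :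
    testedExcess α K Ω U v τ = (∫ x, U (τ, x) * v x) - phi (1 + α) τ * (K * ∫ x in Ω, v x) := by
  have hvi := integrableOn_of_bounded hΩf hv hB
  have hUv : IntegrableOn (fun x => U (τ, x) * v x) Ω :=
    (hu.integrableOn_slice hΩf hτ).mul_bdd hv.aestronglyMeasurable
      (Filter.Eventually.of_forall fun x => hB x)
  rw [← setIntegral_eq_integral_of_ae_compl_eq_zero (s := Ω)
    (hvΩ.mono fun x hx h => by rw [hx h, mul_zero])]
  simp only [testedExcess, excess, sub_mul]
  rw [integral_sub hUv (hvi.const_mul _), integral_const_mul]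
  ring

theorem continuous_phi_one_add (hα : 0 ≤ α) : Continuous (phi (1 + α)) := by
  unfold phi
  refine Continuous.div_const ?_ _
  exact Real.continuous_rpow_const (by linarith)

include hu hΩf in
theorem continuousOn_testedExcess (hα : 0 ≤ α) {v : Space n → ℝ} (hv : Measurable v) {B : ℝ}
    (hB : ∀ x, |v x| ≤ B) (hv2 : MemLp v 2 volume) (hvΩ : ∀ᵐ x, x ∉ Ω → v x = 0) :
    ContinuousOn (testedExcess α K Ω U v) (Icc 0 T) := by
  have h1 : ContinuousOn (fun τ => inner ℝ (hv2.toLp v) (u τ) -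
      phi (1 + α) τ * (K * ∫ x in Ω, v x)) (Icc 0 T) :=
    (continuousOn_const.inner hu.continuousOn).sub
      ((continuous_phi_one_add hα).mul continuous_const).continuousOn
  refine h1.congr fun τ hτ => ?_
  rw [hu.testedExcess_eq hΩf hv hB hvΩ hτ]
  simp only
  rw [L2.inner_def]
  congr 1
  refine integral_congr_ae ?_
  filter_upwards [hu.rep τ hτ, hv2.coeFn_toLp] with x h1 h2
  rw [h2, ← h1]
  simp

include hu hΩ hΩf in
theorem shifted_equation (hα : α ∈ Ioo (0 : ℝ) 1) {ε : ℝ} (hε : 0 < ε) {v : Space n → ℝ}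
    (hv : Measurable v) (hB : ∀ x, |v x| ≤ 1) (hvs : MemHsTilde s Ω v) {t : ℝ}
    (ht : t ≤ T) :
    ∫ τ in Ioo 0 t, phi (1 - α) (t - τ + ε) * testedExcess α K Ω U v τ =
      ∫ τ in Ioo 0 t, shiftPrim α ε (t - τ) * testedSource s K Ω U b v τ := by
  have hα' : 0 < 1 - α := by linarith [hα.2]
  have hc := hu.continuousOn_testedExcess hΩf hα.1.le hv hB hvs.1.1 hvs.2
  have hG := hu.integrableOn_testedSource hΩ hΩf hv hB hvs.1.2
  refine shiftPrim_conv_eq hα hε hc hG (fun t ht => ?_) ht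
  have heq := hu.equation v hv hB hvs t ht
  obtain ⟨hpi, hpI⟩ := phi_conv_phi hα ht.1
  set κ := K * ∫ x in Ω, v x with hκ
  have hsub : Ioo 0 t ⊆ Icc 0 T := fun τ hτ => ⟨hτ.1.le, by linarith [hτ.2, ht.2]⟩
  have hki : IntegrableOn (fun τ => phi (1 - α) (t - τ)) (Ioo 0 t) := by
    have h1 : IntervalIntegrable (fun τ : ℝ => τ ^ (1 - α - 1)) volume 0 t :=
      intervalIntegral.intervalIntegrable_rpow' (by linarith [hα.2])
    have h2 := (h1.div_const (Real.Gamma (1 - α))).comp_sub_left t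
    simp only [sub_zero, sub_self] at h2
    rw [← intervalIntegrable_iff_integrableOn_Ioo_of_le ht.1.le]
    exact h2.symm
  have hkJ : IntegrableOn (fun τ => phi (1 - α) (t - τ) * testedExcess α K Ω U v τ) (Ioo 0 t) := by
    have hcJ : ContinuousOn (testedExcess α K Ω U v) (Icc 0 t) :=
      hc.mono (Icc_subset_Icc_right ht.2.le)
    rw [← intervalIntegrable_iff_integrableOn_Ioo_of_le ht.1.le] at hki ⊢
    refine hki.mul_continuousOn ?_
    rwa [uIcc_of_le ht.1.le]
  have e1 : ∫ τ in Ioo 0 t, phi (1 - α) (t - τ) * ∫ x, U (τ, x) * v x =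
      (∫ τ in Ioo 0 t, phi (1 - α) (t - τ) * testedExcess α K Ω U v τ) + t * κ := by
    have e0 : t * κ = ∫ τ in Ioo 0 t, phi (1 - α) (t - τ) * phi (1 + α) τ * κ := by
      rw [integral_mul_const, hpI]
    rw [e0, ← integral_add hkJ (hpi.mul_const κ)]
    refine setIntegral_congr_fun measurableSet_Ioo fun τ hτ => ?_
    rw [hu.testedExcess_eq hΩf hv hB hvs.2 (hsub hτ)]
    ring
  have hbint : ∀ᵐ τ ∂(volume.restrict (Ioo 0 T)), IntegrableOn (fun x => b (τ, x)) Ω := by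
    have := hu.integrable_source
    rw [IntegrableOn, Measure.volume_eq_prod, ← Measure.prod_restrict] at this
    exact this.prod_right_ae
  have e2 : ∫ τ in Ioo 0 t, ((∫ x in Ω, b (τ, x) * v x) -
      fracLaplacianForm s (fun x => U (τ, x)) v) =
      (∫ τ in Ioo 0 t, testedSource s K Ω U b v τ) + t * κ := by
    have hc' : IntegrableOn (fun _ : ℝ => κ) (Ioo 0 t) := integrableOn_const measure_Ioo_lt_top.ne
    have e3 : t * κ = ∫ _ in Ioo 0 t, κ := by simp [ht.1.le]
    rw [e3, ← integral_add (hG.mono_set (Ioo_subset_Ioo_right ht.2.le)) hc']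
    refine integral_congr_ae ?_
    filter_upwards [ae_restrict_of_ae_restrict_of_subset (Ioo_subset_Ioo_right ht.2.le) hbint]
      with τ hτ
    have hvi := integrableOn_of_bounded hΩf hv hB
    have hbv : IntegrableOn (fun x => b (τ, x) * v x) Ω :=
      hτ.mul_bdd hv.aestronglyMeasurable (Filter.Eventually.of_forall fun x => hB x)
    simp only [testedSource, sub_mul]
    rw [integral_sub hbv (hvi.const_mul K), integral_const_mul, hκ]
    ring
  linarith

end IsSubsolution

end

section

variable {n : ℕ}

instance : (volume : Measure (Space n × Space n)).IsAddHaarMeasure :=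
  inferInstanceAs ((volume : Measure (Space n)).prod volume).IsAddHaarMeasure

theorem trunc_sub (M z w : ℝ) : trunc M (z - w) = trunc (M + w) z := by
  unfold trunc; congr 2; ring

theorem measurable_gagliardoSq_slice {s : ℝ} {V : ℝ × Space n → ℝ} (hV : Measurable V) :
    Measurable fun t => gagliardoSq s (fun x => V (t, x)) := by
  unfold gagliardoSq
  exact Measurable.lintegral_prod_right' (f := fun w : ℝ × (Space n × Space n) =>
    ENNReal.ofReal ((V (w.1, w.2.1) - V (w.1, w.2.2)) ^ 2 /
      ‖w.2.1 - w.2.2‖ ^ ((n : ℝ) + 2 * s))) (by fun_prop)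

theorem fracConst_nonneg {s : ℝ} (hs : s ∈ Ioo (0 : ℝ) 1) : 0 ≤ fracConst n s := by
  have h1 := Real.Gamma_pos_of_pos (show 0 < (n : ℝ) / 2 + s by have := hs.1; positivity)
  have h2 := Real.Gamma_pos_of_pos (show 0 < 1 - s by linarith [hs.2])
  have := hs.1
  unfold fracConst
  positivity

namespace IsSubsolution

variable {α s T K M : ℝ} {Ω : Set (Space n)} {u : ℝ → L2 n} {U b : ℝ × Space n → ℝ}

/-- The truncated excess over `M`, used as a test function. -/
def truncExcess (α K M : ℝ) (U : ℝ × Space n → ℝ) (z : ℝ × Space n) : ℝ :=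
  trunc M (excess α K U z)

theorem abs_truncExcess_le_one (z : ℝ × Space n) : |truncExcess α K M U z| ≤ 1 :=
  abs_trunc_le_one _ _

theorem abs_truncExcess_sub_le (t : ℝ) (x y : Space n) :
    |truncExcess α K M U (t, x) - truncExcess α K M U (t, y)| ≤ |U (t, x) - U (t, y)| := by
  refine (abs_trunc_sub_le _ _ _).trans_eq ?_
  simp [excess]

variable (hu : IsSubsolution α s T Ω K M u U b) (hΩ : MeasurableSet Ω) (hΩf : volume Ω ≠ ⊤)

include hu in
theorem measurable_truncExcess : Measurable (truncExcess α K M U) :=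
  (continuous_trunc M).measurable.comp hu.measurable_excess

theorem barrier_nonneg (hα : α ∈ Ioo (0 : ℝ) 1) (hK : 0 ≤ K) {t : ℝ} (ht : 0 ≤ t) :
    0 ≤ K * phi (1 + α) t := mul_nonneg hK (phi_nonneg (by linarith [hα.1]) ht)

include hu in
theorem memHsTilde_truncExcess (hα : α ∈ Ioo (0 : ℝ) 1) (hK : 0 ≤ K) (hM : 0 ≤ M) :
    ∀ᵐ t ∂(volume.restrict (Ioo 0 T)), MemHsTilde s Ω fun x => truncExcess α K M U (t, x) := by
  have h1 := ae_lt_top (measurable_gagliardoSq_slice (s := s) hu.measurable) hu.energy.ne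
  filter_upwards [h1, hu.exterior, ae_restrict_mem measurableSet_Ioo] with t ht1 ht2 ht
  have hb := barrier_nonneg hα hK ht.1.le
  have hm : Measurable fun x => truncExcess α K M U (t, x) :=
    hu.measurable_truncExcess.comp (measurable_const.prodMk measurable_id)
  refine ⟨⟨(hu.memLp_slice (Ioo_subset_Icc_self ht)).mono hm.aestronglyMeasurable
    (Filter.Eventually.of_forall fun x => ?_), ?_⟩, ?_⟩
  · simp only [truncExcess, excess, trunc_sub]
    exact abs_trunc_le (by linarith) _
  · exact (gagliardoSq_mono fun x y => abs_truncExcess_sub_le t x y).trans_lt ht1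
  · filter_upwards [ht2] with x hx hxΩ
    exact trunc_eq_zero (by simp only [excess]; linarith [hx hxΩ])

/-- The test function in space-time, extended by zero. -/
def testExt (α K M T' : ℝ) (Ω : Set (Space n)) (U : ℝ × Space n → ℝ) : ℝ × Space n → ℝ :=
  (Ioo 0 T' ×ˢ Ω).indicator (truncExcess α K M U)

include hu hΩ in
theorem measurable_testExt (T' : ℝ) : Measurable (testExt α K M T' Ω U) :=
  hu.measurable_truncExcess.indicator (measurableSet_Ioo.prod hΩ)

include hu hΩ in
theorem memLp_testExt (T' : ℝ) : MemLp (testExt α K M T' Ω U) ⊤ volume :=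
  memLp_top_of_bound (hu.measurable_testExt hΩ T').aestronglyMeasurable 1
    (Filter.Eventually.of_forall fun z => (norm_indicator_le_norm_self _ _).trans
      (abs_truncExcess_le_one z))

include hu in
theorem memLp_quotExt_truncExcess {T' : ℝ} (hT' : T' ≤ T) :
    MemLp (quotExt s T' (truncExcess α K M U)) 2 volume := by
  refine memLp_quotExt hu.measurable_truncExcess (lt_of_le_of_lt ?_ hu.energy)
  exact (lintegral_mono fun t => gagliardoSq_mono fun x y => abs_truncExcess_sub_le t x y).trans
    (lintegral_mono_set (Ioo_subset_Ioo_right hT'))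

include hu hΩ hΩf in
theorem timeCorr_src_nonpos (hα : α ∈ Ioo (0 : ℝ) 1) (hK : 0 ≤ K) (hM : 0 ≤ M) (T' : ℝ) :
    timeCorr (srcExt T K Ω b) (testExt α K M T' Ω U) 0 ≤ 0 := by
  have hi : Integrable fun z : ℝ × Space n => srcExt T K Ω b z * testExt α K M T' Ω U z :=
    (hu.memLp_srcExt hΩ hΩf).integrable_mul (hu.memLp_testExt hΩ T')
  rw [Measure.volume_eq_prod] at hi
  simp only [timeCorr, sub_zero, Prod.mk.eta]
  rw [Measure.volume_eq_prod, integral_prod _ hi]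
  have hle := hu.source_le
  rw [ae_restrict_iff' measurableSet_Ioo] at hle
  refine integral_nonpos_of_ae ?_
  filter_upwards [hle] with t ht
  refine integral_nonpos_of_ae ?_
  by_cases htT : t ∈ Ioo 0 T
  · have h2 := ht htT
    rw [ae_restrict_iff' hΩ] at h2
    filter_upwards [h2] with x hx
    by_cases h3 : (t, x) ∈ Ioo 0 T ×ˢ Ω ∧ (t, x) ∈ Ioo 0 T' ×ˢ Ω
    · simp only [srcExt, testExt, indicator_of_mem h3.1, indicator_of_mem h3.2, Pi.zero_apply]
      rcases le_or_gt (U (t, x)) 0 with h4 | h4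
      · have : truncExcess α K M U (t, x) = 0 :=
          trunc_eq_zero (by have := barrier_nonneg hα hK htT.1.le; simp only [excess]; linarith)
        rw [this, mul_zero]
      · exact mul_nonpos_of_nonpos_of_nonneg (by linarith [hx h3.1.2 h4]) (trunc_nonneg _ _)
    · rw [not_and_or] at h3
      rcases h3 with h3 | h3
      · simp only [srcExt, indicator_of_notMem h3, zero_mul, Pi.zero_apply, le_refl]
      · simp only [testExt, indicator_of_notMem h3, mul_zero, Pi.zero_apply, le_refl]
  · refine Filter.Eventually.of_forall fun x => ?_
    have h3 : (t, x) ∉ Ioo 0 T ×ˢ Ω := fun h => htT h.1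
    simp only [srcExt, indicator_of_notMem h3, zero_mul, Pi.zero_apply, le_refl]

theorem timeCorr_quot_nonneg (T' : ℝ) :
    0 ≤ timeCorr (quotExt s T U) (quotExt s T' (truncExcess α K M U)) 0 := by
  refine integral_nonneg fun w => ?_
  simp only [sub_zero, quotExt, Pi.zero_apply]
  by_cases h1 : w.1 ∈ Ioo 0 T
  · by_cases h2 : w.1 ∈ Ioo 0 T'
    · rw [indicator_of_mem h1, indicator_of_mem h2, gagliardoQuot_mul]
      refine div_nonneg ?_ (by positivity)
      have := sub_mul_trunc_sub_nonneg M (excess α K U (w.1, w.2.1)) (excess α K U (w.1, w.2.2))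
      simpa [excess, truncExcess] using this
    · rw [indicator_of_notMem h2, mul_zero]
  · rw [indicator_of_notMem h1, zero_mul]

/-- The difference quotient kernel restricted to the relevant range. -/
def quotKernel (α ε δ T : ℝ) : ℝ → ℝ := (Ioo (-δ) T).indicator (shiftQuot α ε δ)

theorem measurable_quotKernel (hα : α ∈ Ioo (0 : ℝ) 1) {ε : ℝ} (hε : 0 < ε) (δ : ℝ) :
    Measurable (quotKernel α ε δ T) := (measurable_shiftQuot hα hε).indicator measurableSet_Ioo

theorem integrable_quotKernel (hα : α ∈ Ioo (0 : ℝ) 1) {ε δ : ℝ} (hε : 0 < ε) (hδ : 0 < δ) :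
    Integrable (quotKernel α ε δ T) :=
  (integrable_indicator_iff measurableSet_Ioo).2 (integrableOn_shiftQuot hα hε hδ _ _)

theorem quotKernel_eq {ε δ r : ℝ} (hδ : 0 < δ) (hr : r < T) :
    quotKernel α ε δ T r = shiftQuot α ε δ r := by
  rcases lt_or_ge (-δ) r with h | h
  · exact indicator_of_mem (show r ∈ Ioo (-δ) T from ⟨h, hr⟩) _
  · have h1 : r ∉ Ioo (-δ) T := fun h' => by linarith [h'.1]
    rw [quotKernel, indicator_of_notMem h1, shiftQuot, shiftPrim_of_nonpos (by linarith),
      shiftPrim_of_nonpos (by linarith)]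
    simp

/-- The regularized equation tested with the truncated excess at time `t`. -/
def testedQuot (α s K M ε δ T' T : ℝ) (Ω : Set (Space n)) (U b : ℝ × Space n → ℝ) (t : ℝ) : ℝ :=
  (∫ τ, quotKernel α ε δ T (t - τ) *
    ∫ x, srcExt T K Ω b (τ, x) * testExt α K M T' Ω U (t, x)) -
  fracConst n s / 2 * ∫ τ, quotKernel α ε δ T (t - τ) *
    ∫ p, quotExt s T U (τ, p) * quotExt s T' (truncExcess α K M U) (t, p)

include hu hΩ hΩf in
theorem integral_testedQuot (hα : α ∈ Ioo (0 : ℝ) 1) {ε δ T' : ℝ} (hε : 0 < ε) (hδ : 0 < δ)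
    (hT' : T' ≤ T) :
    Integrable (testedQuot α s K M ε δ T' T Ω U b) ∧
      ∫ t, testedQuot α s K M ε δ T' T Ω U b t =
        ∫ σ in Ioo (-δ) T, shiftQuot α ε δ σ *
          (timeCorr (srcExt T K Ω b) (testExt α K M T' Ω U) σ - fracConst n s / 2 *
            timeCorr (quotExt s T U) (quotExt s T' (truncExcess α K M U)) σ) := by
  have hκ := integrable_quotKernel (T := T) hα hε hδ
  have hκm := measurable_quotKernel (T := T) hα hε δ
  have hP1 := hu.memLp_srcExt hΩ hΩf
  have hV1 := hu.memLp_testExt (T' := T') hΩ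
  have hP2 := hu.memLp_quotExt_self
  have hV2 := hu.memLp_quotExt_truncExcess hT'
  obtain ⟨i1, I1⟩ := integral_conv_pairing 1 ⊤ (hu.measurable_srcExt hΩ)
    (hu.measurable_testExt hΩ T') hP1 hV1 hκ hκm
  obtain ⟨i2, I2⟩ := integral_conv_pairing 2 2 (measurable_quotExt hu.measurable)
    (measurable_quotExt hu.measurable_truncExcess) hP2 hV2 hκ hκm
  refine ⟨i1.sub (i2.const_mul _), ?_⟩
  unfold testedQuot
  rw [integral_sub i1 (i2.const_mul _), integral_const_mul, I1, I2]
  have c1 := continuous_timeCorr 1 ⊤ (by simp) hP1 hV1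
  have c2 := continuous_timeCorr 2 2 (by simp) hP2 hV2
  obtain ⟨B1, hB1⟩ := exists_abs_timeCorr_le 1 ⊤ hP1 hV1
  obtain ⟨B2, hB2⟩ := exists_abs_timeCorr_le 2 2 hP2 hV2
  have j1 := hκ.mul_bdd c1.aestronglyMeasurable (Filter.Eventually.of_forall fun σ => hB1 σ)
  have j2 := hκ.mul_bdd c2.aestronglyMeasurable (Filter.Eventually.of_forall fun σ => hB2 σ)
  rw [← integral_const_mul, ← integral_sub j1 (j2.const_mul _),
    ← integral_indicator measurableSet_Ioo]
  refine integral_congr_ae (Filter.Eventually.of_forall fun σ => ?_)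
  simp only [quotKernel]
  by_cases h : σ ∈ Ioo (-δ) T
  · simp only [indicator_of_mem h]; ring
  · simp only [indicator_of_notMem h]; ring

include hu hΩ hΩf in
theorem testedQuot_eq (hα : α ∈ Ioo (0 : ℝ) 1) {ε δ T' t : ℝ} (hε : 0 < ε) (hδ : 0 < δ)
    (hT' : T' + δ ≤ T) (ht : t ∈ Ioo 0 T')
    (hv : MemHsTilde s Ω fun x => truncExcess α K M U (t, x)) :
    δ * testedQuot α s K M ε δ T' T Ω U b t =
      (∫ τ in Ioo 0 (t + δ), phi (1 - α) (t + δ - τ + ε) *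
        testedExcess α K Ω U (fun x => truncExcess α K M U (t, x)) τ) -
      ∫ τ in Ioo 0 t, phi (1 - α) (t - τ + ε) *
        testedExcess α K Ω U (fun x => truncExcess α K M U (t, x)) τ := by
  set v : Space n → ℝ := fun x => truncExcess α K M U (t, x) with hvdef
  have hvm : Measurable v := hu.measurable_truncExcess.comp (measurable_const.prodMk measurable_id)
  have hv1 : ∀ x, |v x| ≤ 1 := fun x => abs_truncExcess_le_one _
  rw [hu.shifted_equation hΩ hΩf hα hε hvm hv1 hv (by linarith [ht.2]),
    hu.shifted_equation hΩ hΩf hα hε hvm hv1 hv (by linarith [ht.2])]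
  set G := testedSource s K Ω U b v with hG
  have hGi : IntegrableOn G (Ioo 0 T) := hu.integrableOn_testedSource hΩ hΩf hvm hv1 hv.1.2
  have hprim : Measurable (shiftPrim α ε) := (shiftPrim_mono hα hε).measurable
  have hext : ∀ r, r ≤ T → ∫ τ in Ioo 0 r, shiftPrim α ε (r - τ) * G τ =
      ∫ τ in Ioo 0 T, shiftPrim α ε (r - τ) * G τ := by
    intro r hr
    refine (setIntegral_eq_of_subset_of_forall_sdiff_eq_zero measurableSet_Ioo
      (Ioo_subset_Ioo_right hr) fun τ hτ => ?_).symm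
    have : r ≤ τ := by
      by_contra! h
      exact hτ.2 ⟨hτ.1.1, h⟩
    rw [shiftPrim_of_nonpos (by linarith), zero_mul]
  have hpi : ∀ r, IntegrableOn (fun τ => shiftPrim α ε (r - τ) * G τ) (Ioo 0 T) := fun r =>
    integrableOn_mul_of_abs_le (B := 1) measurableSet_Ioo (by fun_prop) (fun x _ => by
      rw [abs_of_nonneg (shiftPrim_nonneg hα hε _)]; exact shiftPrim_le_one hα hε _) hGi
  rw [hext _ (by linarith [ht.2]), hext _ (by linarith [ht.2]), ← integral_sub (hpi _) (hpi _)]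
  have htest : ∀ x, testExt α K M T' Ω U (t, x) = Ω.indicator v x := by
    intro x
    by_cases hx : x ∈ Ω
    · rw [indicator_of_mem hx, testExt, indicator_of_mem (show (t, x) ∈ Ioo 0 T' ×ˢ Ω from ⟨ht, hx⟩)]
    · rw [indicator_of_notMem hx, testExt, indicator_of_notMem fun h => hx h.2]
  have hquot : ∀ p, quotExt s T' (truncExcess α K M U) (t, p) = gagliardoQuot s v p := fun p => by
    simp only [quotExt, indicator_of_mem ht, hvdef]
  simp only [testedQuot, htest, hquot]
  have hV : MemLp (fun z : ℝ × Space n => Ω.indicator v z.2) ⊤ volume :=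
    memLp_top_of_bound ((hvm.indicator hΩ).comp measurable_snd).aestronglyMeasurable 1
      (Filter.Eventually.of_forall fun z => (norm_indicator_le_norm_self v _).trans (hv1 _))
  have h1 := integrable_integral_mul 1 ⊤ (hu.memLp_srcExt hΩ hΩf) hV
  have h2 : Integrable fun τ => ∫ p, quotExt s T U (τ, p) * gagliardoQuot s v p := by
    refine (integrable_integral_mul 2 2 hu.memLp_quotExt_self
      (memLp_quotExt_const (T := T) hvm hv.1.2)).congr (Filter.Eventually.of_forall fun τ => ?_)
    simp only
    by_cases hτ : τ ∈ Ioo 0 T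
    · simp only [quotExt, indicator_of_mem hτ]
    · simp only [quotExt, indicator_of_notMem hτ, zero_mul]
  have hκm := measurable_quotKernel (T := T) hα hε δ
  have hκb : ∀ r, |quotKernel α ε δ T r| ≤ 1 / δ := by
    intro r
    by_cases h : r ∈ Ioo (-δ) T
    · rw [quotKernel, indicator_of_mem h, abs_of_nonneg (shiftQuot_nonneg hα hε hδ r)]
      exact shiftQuot_le hα hε hδ r
    · rw [quotKernel, indicator_of_notMem h, abs_zero]; positivity
  have k1 : Integrable fun τ => quotKernel α ε δ T (t - τ) *
      ∫ x, srcExt T K Ω b (τ, x) * Ω.indicator v x :=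
    h1.bdd_mul (c := 1 / δ) (hκm.comp (measurable_const.sub measurable_id)).aestronglyMeasurable (Filter.Eventually.of_forall fun τ => hκb _)
  have k2 : Integrable fun τ => quotKernel α ε δ T (t - τ) *
      ∫ p, quotExt s T U (τ, p) * gagliardoQuot s v p :=
    h2.bdd_mul (c := 1 / δ) (hκm.comp (measurable_const.sub measurable_id)).aestronglyMeasurable (Filter.Eventually.of_forall fun τ => hκb _)
  rw [← integral_const_mul, ← integral_sub k1 (k2.const_mul _), ← integral_const_mul,
    ← integral_indicator measurableSet_Ioo]
  refine integral_congr_ae (Filter.Eventually.of_forall fun τ => ?_)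
  simp only
  by_cases hτ : τ ∈ Ioo 0 T
  · rw [indicator_of_mem hτ, hG, testedSource_eq hΩ hτ, quotKernel_eq hδ
      (by linarith [hτ.1, ht.2]), shiftQuot, show t - τ + δ = t + δ - τ by ring]
    field_simp
  · rw [indicator_of_notMem hτ]
    have e1 : ∀ x, srcExt T K Ω b (τ, x) = 0 := fun x => indicator_of_notMem (fun h => hτ h.1) _
    have e2 : ∀ p, quotExt s T U (τ, p) = 0 := fun p => by
      simp only [quotExt, indicator_of_notMem hτ]
    simp [e1, e2]

end IsSubsolution

end

section

variable {n : ℕ}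

namespace IsSubsolution

variable {α s T K M : ℝ} {Ω : Set (Space n)} {u : ℝ → L2 n} {U b : ℝ × Space n → ℝ}

/-- The energy `∫_Ω Φ(excess)` of the truncated excess. -/
def excessEnergy (α K M : ℝ) (Ω : Set (Space n)) (U : ℝ × Space n → ℝ) (t : ℝ) : ℝ :=
  ∫ x in Ω, truncPrim M (excess α K U (t, x))

/-- The Legendre conjugate of `excessEnergy` at the truncated excess. -/
def conjEnergy (α K M : ℝ) (Ω : Set (Space n)) (U : ℝ × Space n → ℝ) (t : ℝ) : ℝ :=
  ∫ x in Ω, (excess α K U (t, x) * truncExcess α K M U (t, x) -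
    truncPrim M (excess α K U (t, x)))

/-- The distance in `L¹(Ω)` between two slices of the excess. -/
def excessDist (α K : ℝ) (Ω : Set (Space n)) (U : ℝ × Space n → ℝ) (t τ : ℝ) : ℝ :=
  ∫ x in Ω, |excess α K U (t, x) - excess α K U (τ, x)|

variable (hu : IsSubsolution α s T Ω K M u U b) (hΩ : MeasurableSet Ω) (hΩf : volume Ω ≠ ⊤)

include hu in
theorem measurable_excess_slice (t : ℝ) : Measurable fun x => excess α K U (t, x) :=
  hu.measurable_excess.comp (measurable_const.prodMk measurable_id)

include hu hΩf in
theorem integrableOn_truncPrim (hM : 0 ≤ M) {t : ℝ} (ht : t ∈ Icc 0 T) :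
    IntegrableOn (fun x => truncPrim M (excess α K U (t, x))) Ω := by
  refine Integrable.mono (hu.integrableOn_excess hΩf ht)
    ((continuous_truncPrim M).measurable.comp (hu.measurable_excess_slice t)).aestronglyMeasurable
    (Filter.Eventually.of_forall fun x => ?_)
  rw [Real.norm_eq_abs, abs_of_nonneg (truncPrim_nonneg _ _)]
  exact truncPrim_le_abs hM _

include hu hΩf in
theorem integrableOn_excess_mul {t τ : ℝ} (hτ : τ ∈ Icc 0 T) :
    IntegrableOn (fun x => excess α K U (τ, x) * truncExcess α K M U (t, x)) Ω :=
  (hu.integrableOn_excess hΩf hτ).mul_bdd (c := 1)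
    (hu.measurable_truncExcess.comp (measurable_const.prodMk measurable_id)).aestronglyMeasurable
    (Filter.Eventually.of_forall fun _ => abs_truncExcess_le_one _)

theorem conjEnergy_nonneg (hM : 0 ≤ M) (t : ℝ) : 0 ≤ conjEnergy α K M Ω U t :=
  integral_nonneg fun _ => sub_nonneg.2 (truncPrim_le_mul_trunc hM _)

theorem excessEnergy_nonneg (t : ℝ) : 0 ≤ excessEnergy α K M Ω U t :=
  integral_nonneg fun _ => truncPrim_nonneg _ _

include hu hΩf in
theorem testedExcess_le (hM : 0 ≤ M) {t τ : ℝ} (ht : t ∈ Icc 0 T) (hτ : τ ∈ Icc 0 T) :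
    testedExcess α K Ω U (fun x => truncExcess α K M U (t, x)) τ ≤
      conjEnergy α K M Ω U t + excessEnergy α K M Ω U τ := by
  have i1 := hu.integrableOn_excess_mul hΩf (t := t) hτ
  have i2 := hu.integrableOn_excess_mul hΩf (t := t) ht
  have i3 := hu.integrableOn_truncPrim hΩf hM ht
  have i4 := hu.integrableOn_truncPrim hΩf hM hτ
  have i23 : IntegrableOn (fun x => excess α K U (t, x) * truncExcess α K M U (t, x) -
    truncPrim M (excess α K U (t, x))) Ω := i2.sub i3
  unfold testedExcess conjEnergy excessEnergy
  rw [← integral_add i23 i4]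
  refine integral_mono i1 (i23.add i4) fun x => ?_
  have := sub_mul_trunc_le M (excess α K U (t, x)) (excess α K U (τ, x))
  simp only [truncExcess]
  linarith

include hu hΩf in
theorem le_testedExcess (hM : 0 ≤ M) {t τ : ℝ} (ht : t ∈ Icc 0 T) (hτ : τ ∈ Icc 0 T) :
    conjEnergy α K M Ω U t + excessEnergy α K M Ω U τ - 2 * excessDist α K Ω U τ t ≤
      testedExcess α K Ω U (fun x => truncExcess α K M U (t, x)) τ := by
  have i1 := hu.integrableOn_excess_mul hΩf (t := t) hτ
  have i2 := hu.integrableOn_excess_mul hΩf (t := t) ht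
  have i3 := hu.integrableOn_truncPrim hΩf hM ht
  have i4 := hu.integrableOn_truncPrim hΩf hM hτ
  have i5 : IntegrableOn (fun x => |excess α K U (τ, x) - excess α K U (t, x)|) Ω :=
    ((hu.integrableOn_excess hΩf hτ).sub (hu.integrableOn_excess hΩf ht)).abs
  have i23 : IntegrableOn (fun x => excess α K U (t, x) * truncExcess α K M U (t, x) -
    truncPrim M (excess α K U (t, x))) Ω := i2.sub i3
  have i234 : IntegrableOn (fun x => excess α K U (t, x) * truncExcess α K M U (t, x) -
    truncPrim M (excess α K U (t, x)) + truncPrim M (excess α K U (τ, x))) Ω := i23.add i4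
  unfold testedExcess conjEnergy excessEnergy excessDist
  rw [← integral_const_mul, ← integral_add i23 i4, ← integral_sub i234 (i5.const_mul 2)]
  refine integral_mono (i234.sub (i5.const_mul 2)) i1 fun x => ?_
  have h1 := truncPrim_sub_le M (excess α K U (τ, x)) (excess α K U (t, x))
  have h2 : (excess α K U (t, x) - excess α K U (τ, x)) * trunc M (excess α K U (t, x)) ≤
      |excess α K U (τ, x) - excess α K U (t, x)| * 1 := by
    rw [abs_sub_comm]
    exact mul_le_mul (le_abs_self _) (trunc_le_one _ _) (trunc_nonneg _ _) (abs_nonneg _)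
  simp only [truncExcess]
  linarith

include hu hΩf in
theorem exists_excessDist_le (hα : 0 ≤ α) {w : ℝ} (hw : 0 < w) : ∃ δ > 0,
    ∀ t ∈ Icc 0 T, ∀ τ ∈ Icc 0 T, |t - τ| < δ → excessDist α K Ω U t τ ≤ w := by
  set A := (volume Ω).toReal ^ (1 / 2 : ℝ) with hA
  set D := |K| * (volume Ω).toReal with hD
  have hA0 : 0 ≤ A := by positivity
  have hD0 : 0 ≤ D := by positivity
  have hle : ∀ t ∈ Icc 0 T, ∀ τ ∈ Icc 0 T, excessDist α K Ω U t τ ≤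
      A * ‖u t - u τ‖ + D * |phi (1 + α) t - phi (1 + α) τ| := by
    intro t ht τ hτ
    have i1 : IntegrableOn (fun x => |U (t, x) - U (τ, x)|) Ω :=
      ((hu.integrableOn_slice hΩf ht).sub (hu.integrableOn_slice hΩf hτ)).abs
    have i2 : IntegrableOn (fun _ : Space n => |K| * |phi (1 + α) t - phi (1 + α) τ|) Ω :=
      integrableOn_const hΩf
    have h1 : ∫ x in Ω, |U (t, x) - U (τ, x)| = ∫ x in Ω, |u t x - u τ x| := by
      refine integral_congr_ae ?_
      filter_upwards [ae_restrict_of_ae (hu.rep t ht), ae_restrict_of_ae (hu.rep τ hτ)]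
        with x h1 h2
      rw [h1, h2]
    calc excessDist α K Ω U t τ
        ≤ ∫ x in Ω, (|U (t, x) - U (τ, x)| + |K| * |phi (1 + α) t - phi (1 + α) τ|) := by
          refine integral_mono ((hu.integrableOn_excess hΩf ht).sub
            (hu.integrableOn_excess hΩf hτ)).abs (i1.add i2) fun x => ?_
          simp only [excess]
          rw [← abs_mul, show U (t, x) - K * phi (1 + α) t - (U (τ, x) - K * phi (1 + α) τ) =
            (U (t, x) - U (τ, x)) - K * (phi (1 + α) t - phi (1 + α) τ) by ring]
          exact abs_sub _ _
      _ ≤ A * ‖u t - u τ‖ + D * |phi (1 + α) t - phi (1 + α) τ| := by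
          rw [integral_add i1 i2, h1, setIntegral_const, smul_eq_mul]
          refine add_le_add (setIntegral_abs_sub_le hΩf _ _) (le_of_eq ?_)
          rw [hD, Measure.real]; ring
  have huc := Metric.uniformContinuousOn_iff.1
    (isCompact_Icc.uniformContinuousOn_of_continuous hu.continuousOn) (w / (2 * (A + 1)))
    (by positivity)
  have hpc := Metric.uniformContinuousOn_iff.1
    (isCompact_Icc.uniformContinuousOn_of_continuous
      ((continuous_phi_one_add hα).continuousOn (s := Icc 0 T))) (w / (2 * (D + 1)))
    (by positivity)
  obtain ⟨δ1, hδ1, h1⟩ := huc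
  obtain ⟨δ2, hδ2, h2⟩ := hpc
  refine ⟨min δ1 δ2, lt_min hδ1 hδ2, fun t ht τ hτ h => (hle t ht τ hτ).trans ?_⟩
  have g1 := h1 t ht τ hτ (by rw [Real.dist_eq]; exact h.trans_le (min_le_left _ _))
  have g2 := h2 t ht τ hτ (by rw [Real.dist_eq]; exact h.trans_le (min_le_right _ _))
  rw [dist_eq_norm] at g1
  rw [Real.dist_eq] at g2
  rw [lt_div_iff₀ (by positivity)] at g1 g2
  nlinarith [norm_nonneg (u t - u τ), abs_nonneg (phi (1 + α) t - phi (1 + α) τ)]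

include hu hΩf in
theorem abs_excessEnergy_sub_le (hM : 0 ≤ M) {t τ : ℝ} (ht : t ∈ Icc 0 T) (hτ : τ ∈ Icc 0 T) :
    |excessEnergy α K M Ω U t - excessEnergy α K M Ω U τ| ≤ excessDist α K Ω U t τ := by
  have i3 := hu.integrableOn_truncPrim hΩf hM ht
  have i4 := hu.integrableOn_truncPrim hΩf hM hτ
  unfold excessEnergy excessDist
  rw [← integral_sub i3 i4]
  refine (abs_integral_le_integral_abs).trans ?_
  refine integral_mono (i3.sub i4).abs ((hu.integrableOn_excess hΩf ht).sub
    (hu.integrableOn_excess hΩf hτ)).abs fun x => ?_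
  exact abs_truncPrim_sub_le _ _ _

include hu hΩf in
theorem exists_excessEnergy_le (hα : 0 ≤ α) (hM : 0 ≤ M) :
    ∃ B, ∀ t ∈ Icc 0 T, excessEnergy α K M Ω U t ≤ B := by
  have hc : ContinuousOn (excessEnergy α K M Ω U) (Icc 0 T) := by
    rw [Metric.continuousOn_iff]
    intro t ht w hw
    obtain ⟨δ, hδ, h⟩ := hu.exists_excessDist_le hΩf hα (half_pos hw)
    refine ⟨δ, hδ, fun τ hτ hd => ?_⟩
    rw [Real.dist_eq] at hd ⊢
    linarith [hu.abs_excessEnergy_sub_le hΩf hM hτ ht, h τ hτ t ht hd]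
  obtain ⟨B, hB⟩ := isCompact_Icc.exists_bound_of_continuousOn hc
  exact ⟨B, fun t ht => (le_abs_self _).trans (hB t ht)⟩

include hu in
theorem measurable_excessEnergy : Measurable (excessEnergy α K M Ω U) := by
  have h : StronglyMeasurable (Function.uncurry fun t x => truncPrim M (excess α K U (t, x))) :=
    ((continuous_truncPrim M).measurable.comp hu.measurable_excess).stronglyMeasurable
  exact (h.integral_prod_right (ν := volume.restrict Ω)).measurable

include hu hΩ hΩf in
theorem integral_excessEnergy_nonpos (hα : α ∈ Ioo (0 : ℝ) 1) (hs : s ∈ Ioo (0 : ℝ) 1)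
    (hK : 0 ≤ K) (hM : 0 ≤ M) {T' : ℝ} (hT' : T' ∈ Ioo 0 T) :
    ∫ t in Ioo 0 T', excessEnergy α K M Ω U t ≤ 0 := by
  have hα' : 0 < 1 - α := by linarith [hα.2]
  have hT : 0 < T := hT'.1.trans hT'.2
  set C : ℝ → ℝ := fun σ => timeCorr (srcExt T K Ω b) (testExt α K M T' Ω U) σ -
    fracConst n s / 2 * timeCorr (quotExt s T U) (quotExt s T' (truncExcess α K M U)) σ with hC
  have hP1 := hu.memLp_srcExt hΩ hΩf
  have hV1 := hu.memLp_testExt hΩ T'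
  have hP2 := hu.memLp_quotExt_self
  have hV2 := hu.memLp_quotExt_truncExcess hT'.2.le
  have hc0 : 0 ≤ fracConst n s / 2 := by have := fracConst_nonneg (n := n) hs; positivity
  have hCc : Continuous C := (continuous_timeCorr 1 ⊤ (by simp) hP1 hV1).sub
    (continuous_const.mul (continuous_timeCorr 2 2 (by simp) hP2 hV2))
  obtain ⟨B1, hB1⟩ := exists_abs_timeCorr_le 1 ⊤ hP1 hV1
  obtain ⟨B2, hB2⟩ := exists_abs_timeCorr_le 2 2 hP2 hV2
  have hCb : ∀ σ, |C σ| ≤ B1 + fracConst n s / 2 * B2 := by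
    intro σ
    refine (abs_sub _ _).trans ?_
    rw [abs_mul, abs_of_nonneg hc0]
    exact add_le_add (hB1 σ) (mul_le_mul_of_nonneg_left (hB2 σ) hc0)
  have hC0 : C 0 ≤ 0 := by
    have h1 := hu.timeCorr_src_nonpos hΩ hΩf hα hK hM T'
    have h2 := mul_nonneg hc0 (timeCorr_quot_nonneg (s := s) (T := T) (α := α) (K := K) (M := M)
      (U := U) T')
    simp only [hC]; linarith
  obtain ⟨B, hB⟩ := hu.exists_excessEnergy_le hΩf hα.1.le hM
  have hB0 : 0 ≤ B := (excessEnergy_nonneg 0).trans (hB 0 ⟨le_rfl, hT.le⟩)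
  have hm0 : 0 < phi (1 - α) (T + 1) := phi_pos hα' (by linarith)
  set I := ∫ t in Ioo 0 T', excessEnergy α K M Ω U t with hI
  have hI0 : 0 ≤ I := integral_nonneg fun t => excessEnergy_nonneg t
  suffices h : ∀ η > 0, phi (1 - α) (T + 1) * I ≤ 3 * η by
    by_contra! hpos
    have h1 := h (phi (1 - α) (T + 1) * I / 6) (by positivity)
    have : 0 < phi (1 - α) (T + 1) * I := by positivity
    linarith
  intro η hη
  obtain ⟨ε, hε, δ₀, hδ₀, hδ⟩ := exists_integral_shiftQuot_mul_le hα hT hCc hCb hC0 hη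
  set k : ℝ → ℝ := fun r => phi (1 - α) (r + ε) with hk
  have hε0 : 0 < ε := hε.1
  have hkm : Measurable k := by rw [hk]; fun_prop
  have hk0 : ∀ t, 0 ≤ t → 0 ≤ k t := fun t ht => phi_nonneg hα' (by linarith)
  have hka : ∀ t r, 0 ≤ t → t ≤ r → k r ≤ k t := fun t r ht htr =>
    phi_antitone hα' (by linarith [hα.1]) (by linarith) (by linarith)
  have hk00 : 0 < k 0 := phi_pos hα' (by linarith)
  set w := η / (k 0 * T') with hw
  have hw0 : 0 < w := div_pos hη (mul_pos hk00 hT'.1)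
  obtain ⟨δ₁, hδ₁, hmod⟩ := hu.exists_excessDist_le hΩf hα.1.le (half_pos hw0)
  obtain ⟨δ, hδpos, hδlt⟩ : ∃ δ > 0, δ < min (min δ₀ δ₁) (min (T - T') (η / (k 0 * (B + 1)))) := by
    refine exists_between (lt_min (lt_min hδ₀ hδ₁) (lt_min (by linarith [hT'.2]) ?_))
    positivity
  obtain ⟨⟨hδ_0, hδ_1⟩, hδ_2, hδ_3⟩ : (δ < δ₀ ∧ δ < δ₁) ∧ δ < T - T' ∧ δ < η / (k 0 * (B + 1)) := by
    simpa only [lt_min_iff] using hδlt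
  have hTδ : T' + δ ≤ T := by linarith
  obtain ⟨hLi, hLI⟩ := hu.integral_testedQuot (M := M) hΩ hΩf hα hε0 hδpos hT'.2.le
  have hmain := integral_le_of_conv_diff_le (k := k) hkm hk0 hka hT'.1 hδpos hTδ
    (Q := excessEnergy α K M Ω U) (L := fun t => δ * testedQuot α s K M ε δ T' T Ω U b t)
    (e := w * k 0) (R := η) hu.measurable_excessEnergy (fun t _ => excessEnergy_nonneg t) hB
    (hLi.integrableOn.const_mul δ) ?_ ?_
  · have h1 : phi (1 - α) (T + 1) ≤ k T :=
      phi_antitone hα' (by linarith [hα.1]) (by linarith) (by linarith [hε.2])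
    have h2 : w * k 0 * T' = η := by
      have := hT'.1.ne'
      rw [hw]; field_simp
    have h3 : k 0 * B * δ ≤ η := by
      rw [lt_div_iff₀ (by positivity)] at hδ_3
      have := mul_pos hδpos hk00
      nlinarith
    have h4 := mul_le_mul_of_nonneg_right h1 hI0
    linarith
  · filter_upwards [ae_restrict_of_ae_restrict_of_subset (Ioo_subset_Ioo_right hT'.2.le)
      (hu.memHsTilde_truncExcess hα hK hM), ae_restrict_mem measurableSet_Ioo] with t hv ht
    have hvm : Measurable fun x => truncExcess α K M U (t, x) :=
      hu.measurable_truncExcess.comp (measurable_const.prodMk measurable_id)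
    have htI : t ∈ Icc 0 T := ⟨ht.1.le, by linarith [ht.2]⟩
    rw [hu.testedQuot_eq hΩ hΩf hα hε0 hδpos hTδ ht hv]
    have hJ := hu.continuousOn_testedExcess hΩf hα.1.le hvm
      (fun x => abs_truncExcess_le_one _) hv.1.1 hv.2
    have hQi : IntegrableOn (excessEnergy α K M Ω U) (Ioo 0 T) :=
      Measure.integrableOn_of_bounded (M := B) measure_Ioo_lt_top.ne
        hu.measurable_excessEnergy.aestronglyMeasurable
        (ae_restrict_of_forall_mem measurableSet_Ioo fun t ht => by
          rw [Real.norm_eq_abs, abs_of_nonneg (excessEnergy_nonneg t)]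
          exact hB t (Ioo_subset_Icc_self ht))
    exact conv_diff_le (k := k) hkm hk0 hka ht.1.le hδpos.le (by linarith [ht.2] : t + δ ≤ T)
      (hJ.integrableOn_Icc.mono_set Ioo_subset_Icc_self) hQi (conjEnergy_nonneg hM t)
      (fun τ hτ => hu.testedExcess_le hΩf hM htI (Ioo_subset_Icc_self hτ)) fun τ hτ => by
        have hτI : τ ∈ Icc 0 T := ⟨by linarith [ht.1, hτ.1], by linarith [hτ.2, ht.2]⟩
        have h1 := hmod τ hτI t htI (by rw [abs_of_nonneg] <;> linarith [hτ.1, hτ.2])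
        have h2 := hu.le_testedExcess hΩf hM htI hτI
        linarith
  · have h0 : ∀ t, t ∉ Ioo 0 T' → testedQuot α s K M ε δ T' T Ω U b t = 0 := by
      intro t ht
      have e1 : ∀ x, testExt α K M T' Ω U (t, x) = 0 := fun x =>
        indicator_of_notMem (fun h => ht h.1) _
      have e2 : ∀ p, quotExt s T' (truncExcess α K M U) (t, p) = 0 := fun p => by
        simp only [quotExt, indicator_of_notMem ht]
      simp [testedQuot, e1, e2]
    rw [integral_const_mul, setIntegral_eq_integral_of_forall_compl_eq_zero h0, hLI]
    exact mul_le_mul_of_nonneg_left (hδ δ ⟨hδpos, hδ_0⟩) hδpos.le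

include hu hΩ hΩf in
/-- The comparison principle for subsolutions. -/
theorem le_barrier (hα : α ∈ Ioo (0 : ℝ) 1) (hs : s ∈ Ioo (0 : ℝ) 1)
    (hK : 0 ≤ K) (hM : 0 ≤ M) (hT : 0 < T) :
    ∀ᵐ t ∂(volume.restrict (Ioo 0 T)), ∀ᵐ x ∂(volume.restrict Ω),
      U (t, x) ≤ K * phi (1 + α) t + M := by
  have h1 : ∀ j : ℕ, ∀ᵐ t, t ∈ Ioo 0 (T - T / (j + 2)) → excessEnergy α K M Ω U t = 0 := by
    intro j
    have hj : (0 : ℝ) < j + 2 := by positivity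
    have hT' : T - T / (j + 2) ∈ Ioo 0 T := by
      constructor
      · have : T / (j + 2) < T := by
          rw [div_lt_iff₀ hj]
          have : (0 : ℝ) ≤ j := Nat.cast_nonneg j
          nlinarith
        linarith
      · have : 0 < T / (j + 2) := by positivity
        linarith
    have hle := hu.integral_excessEnergy_nonpos hΩ hΩf hα hs hK hM hT'
    have heq := le_antisymm hle (integral_nonneg fun t => excessEnergy_nonneg t)
    obtain ⟨B, hB⟩ := hu.exists_excessEnergy_le hΩf hα.1.le hM
    have hQi : IntegrableOn (excessEnergy α K M Ω U) (Ioo 0 (T - T / (j + 2))) :=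
      Measure.integrableOn_of_bounded (M := B) measure_Ioo_lt_top.ne
        hu.measurable_excessEnergy.aestronglyMeasurable
        (ae_restrict_of_forall_mem measurableSet_Ioo fun t ht => by
          rw [Real.norm_eq_abs, abs_of_nonneg (excessEnergy_nonneg t)]
          exact hB t ⟨ht.1.le, by linarith [ht.2, hT'.2]⟩)
    rw [← ae_restrict_iff' measurableSet_Ioo]
    exact (integral_eq_zero_iff_of_nonneg (fun t => excessEnergy_nonneg t) hQi).1 heq
  rw [ae_restrict_iff' measurableSet_Ioo]
  filter_upwards [ae_all_iff.2 h1] with t ht htT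
  obtain ⟨j, hj⟩ := exists_nat_gt (T / (T - t))
  have htj : t < T - T / (j + 2) := by
    have hTt : 0 < T - t := by linarith [htT.2]
    rw [div_lt_iff₀ hTt] at hj
    have : T / (j + 2) < T - t := by
      rw [div_lt_iff₀ (by positivity)]
      nlinarith
    linarith
  have h2 := ht j ⟨htT.1, htj⟩
  have h3 := (integral_eq_zero_iff_of_nonneg (fun x => truncPrim_nonneg M _)
    (hu.integrableOn_truncPrim hΩf hM (Ioo_subset_Icc_self htT))).1 h2
  filter_upwards [h3] with x hx
  have := le_of_truncPrim_eq_zero hx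
  simp only [excess] at this
  linarith

end IsSubsolution

end

section

variable {n : ℕ}

theorem isClosed_setOf_ae_abs_le (C : ℝ) : IsClosed {w : L2 n | ∀ᵐ x, |w x| ≤ C} := by
  refine IsSeqClosed.isClosed fun w w₀ hw hlim => ?_
  obtain ⟨ns, -, hns⟩ := (tendstoInMeasure_of_tendsto_Lp hlim).exists_seq_tendsto_ae
  have hall : ∀ᵐ x, ∀ j, |w j x| ≤ C := ae_all_iff.2 hw
  filter_upwards [hns, hall] with x hx hxC
  exact le_of_tendsto hx.abs (Filter.Eventually.of_forall fun j => hxC _)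

theorem forall_mem_of_ae_mem {X : Type*} [TopologicalSpace X] {T : ℝ} (hT : 0 < T) {u : ℝ → X}
    (hu : ContinuousOn u (Icc 0 T)) {A : Set X} (hA : IsClosed A)
    (h : ∀ᵐ t ∂(volume.restrict (Ioo 0 T)), u t ∈ A) : ∀ t ∈ Icc 0 T, u t ∈ A := by
  rw [ae_restrict_iff' measurableSet_Ioo] at h
  have hd : Dense {t : ℝ | t ∈ Ioo 0 T → u t ∈ A} := Measure.dense_of_ae h
  have h1 : Icc 0 T ⊆ closure (Ioo 0 T ∩ {t : ℝ | t ∈ Ioo 0 T → u t ∈ A}) := by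
    rw [← closure_Ioo hT.ne]
    exact closure_minimal (hd.open_subset_closure_inter isOpen_Ioo) isClosed_closure
  intro t ht
  have h2 : ContinuousWithinAt u (Ioo 0 T ∩ {t : ℝ | t ∈ Ioo 0 T → u t ∈ A}) t :=
    (hu t ht).mono (inter_subset_left.trans Ioo_subset_Icc_self)
  have h3 := h2.mem_closure (h1 ht) (t := A) fun r hr => hr.2 hr.1
  rwa [hA.closure_eq] at h3

theorem abs_le_toReal_eLpNorm_top {X : Type*} [TopologicalSpace X] [MeasureSpace X]
    [OpensMeasurableSpace X] [(volume : Measure X).IsOpenPosMeasure] {g : X → ℝ}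
    (hg : Continuous g) {S : Set X} (hS : IsOpen S)
    (hfin : eLpNorm g ⊤ (volume.restrict S) ≠ ⊤) (h0 : ∀ x, x ∉ S → g x = 0) (x : X) :
    |g x| ≤ (eLpNorm g ⊤ (volume.restrict S)).toReal := by
  set M := (eLpNorm g ⊤ (volume.restrict S)).toReal
  have hM : 0 ≤ M := ENNReal.toReal_nonneg
  by_cases hx : x ∈ S
  · have hae : ∀ᵐ y ∂(volume.restrict S), |g y| ≤ M := by
      filter_upwards [ae_le_eLpNormEssSup (f := g) (μ := volume.restrict S)] with y hy
      rw [← eLpNorm_exponent_top] at hy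
      have := ENNReal.toReal_mono hfin hy
      rwa [toReal_enorm, Real.norm_eq_abs] at this
    rw [ae_restrict_iff' hS.measurableSet] at hae
    have hopen : IsOpen (S ∩ {y | M < |g y|}) := hS.inter (isOpen_lt continuous_const hg.abs)
    have hz : volume (S ∩ {y | M < |g y|}) = 0 := by
      refine measure_mono_null (fun y hy => ?_) hae
      simp only [mem_compl_iff, mem_ofPred_eq, Classical.not_imp, not_le]
      exact hy
    have he := hopen.measure_eq_zero_iff volume |>.1 hz
    by_contra! h
    have : x ∈ S ∩ {y | M < |g y|} := ⟨hx, h⟩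
    rw [he] at this
    exact this
  · rw [h0 x hx, abs_zero]; exact hM

/-- The energy of a function equal to a smooth compactly supported function up to a function of
finite energy. -/
theorem lintegral_gagliardoSq_lt_top (hn : 1 ≤ n) {s T : ℝ} (hs : s ∈ Ioo (0 : ℝ) 1)
    {g : Space n × ℝ → ℝ} (hg : ContDiff ℝ ∞ g) (hgc : HasCompactSupport g)
    {u : ℝ → Space n → ℝ}
    (h : ∫⁻ t in Ioo 0 T, gagliardoSq s (fun x => u t x - g (x, t)) < ⊤) :
    ∫⁻ t in Ioo 0 T, gagliardoSq s (u t) < ⊤ := by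
  obtain ⟨L, hL⟩ := hg.lipschitzWith_of_hasCompactSupport hgc (by simp)
  obtain ⟨B, hB⟩ := hg.continuous.bounded_above_of_compact_support hgc
  have hK : IsCompact (Prod.fst '' tsupport g) := hgc.isCompact.image continuous_fst
  obtain ⟨C, hC, hCg⟩ := exists_gagliardoSq_le hn hs L B hK.measurableSet hK.measure_lt_top.ne
  have hle : ∀ t, gagliardoSq s (u t) ≤ ENNReal.ofReal 2 * C +
      ENNReal.ofReal 2 * gagliardoSq s (fun x => u t x - g (x, t)) := by
    intro t
    have hgm : Measurable fun x => g (x, t) :=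
      (hg.continuous.comp (continuous_id.prodMk continuous_const)).measurable
    have h1 := gagliardoSq_add_le (s := s) (v := fun x => u t x - g (x, t)) hgm
    simp only [add_sub_cancel] at h1
    refine h1.trans ?_
    gcongr
    refine hCg _ (fun x y => ?_) (fun x => hB _) fun x hx => ?_
    · have := hL.dist_le_mul (x, t) (y, t)
      rwa [Real.dist_eq, dist_prod_same_right, dist_eq_norm] at this
    · exact image_eq_zero_of_notMem_tsupport fun h => hx ⟨_, h, rfl⟩
  refine (lintegral_mono hle).trans_lt ?_
  rw [lintegral_add_left measurable_const, lintegral_const, Measure.restrict_apply_univ,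
    lintegral_const_mul' _ _ ENNReal.ofReal_ne_top]
  refine ENNReal.add_lt_top.2 ⟨ENNReal.mul_lt_top (ENNReal.mul_lt_top ENNReal.ofReal_lt_top hC.lt_top)
    measure_Ioo_lt_top, ENNReal.mul_lt_top ENNReal.ofReal_lt_top h⟩

theorem intervalIntegrable_phi {β : ℝ} (hβ : 0 < β) (a b : ℝ) :
    IntervalIntegrable (phi β) volume a b :=
  (intervalIntegral.intervalIntegrable_rpow' (by linarith)).div_const _

/-- Fractional integrals of continuous functions vanishing at the origin are continuous. -/
theorem continuousOn_phi_conv {β T : ℝ} (hβ : 0 < β) (hT : 0 ≤ T) {y : ℝ → ℝ}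
    (hy : ContinuousOn y (Icc 0 T)) (hy0 : y 0 = 0) :
    ContinuousOn (fun t => ∫ τ in 0..t, phi β (t - τ) * y τ) (Icc 0 T) := by
  set z : ℝ → ℝ := fun r => y (projIcc 0 T hT r) with hz
  have hzc : Continuous z := hy.domRestrict.comp continuous_projIcc
  have hz0 : ∀ r, r ≤ 0 → z r = 0 := fun r hr => by
    simp only [hz, projIcc_of_le_left hT hr, hy0]
  have hzy : ∀ r ∈ Icc 0 T, z r = y r := fun r hr => by
    simp only [hz, projIcc_of_mem hT hr]
  obtain ⟨B, hB⟩ := isCompact_Icc.exists_bound_of_continuousOn hy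
  have hzB : ∀ r, ‖z r‖ ≤ B := fun r => hB _ (projIcc 0 T hT r).2
  have hφ : IntegrableOn (phi β) (Ioc 0 T) := by
    rw [← intervalIntegrable_iff_integrableOn_Ioc_of_le hT]
    exact intervalIntegrable_phi hβ _ _
  have hc : Continuous fun t => ∫ σ in Ioc 0 T, phi β σ * z (t - σ) := by
    refine continuous_of_dominated (bound := fun σ => ‖phi β σ‖ * B) (fun t => ?_) (fun t => ?_)
      (hφ.norm.mul_const B) (Filter.Eventually.of_forall fun σ => by fun_prop)
    · exact (measurable_phi β).aestronglyMeasurable.mul (by fun_prop)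
    · refine Filter.Eventually.of_forall fun σ => ?_
      rw [norm_mul]
      exact mul_le_mul_of_nonneg_left (hzB _) (norm_nonneg _)
  refine hc.continuousOn.congr fun t ht => ?_
  simp only
  have h1 := intervalIntegral.integral_comp_sub_left (a := 0) (b := t)
    (fun τ => phi β (t - τ) * y τ) t
  simp only [sub_sub_cancel, sub_zero, sub_self] at h1
  rw [← h1, intervalIntegral.integral_of_le ht.1]
  symm
  rw [setIntegral_eq_of_subset_of_forall_sdiff_eq_zero measurableSet_Ioc
    (Ioc_subset_Ioc_right ht.2) (fun σ hσ => ?_)]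
  · refine setIntegral_congr_fun measurableSet_Ioc fun σ hσ => ?_
    rw [hzy _ ⟨by linarith [hσ.2], by linarith [hσ.1, ht.2]⟩]
  · have : t < σ := by
      by_contra! h
      exact hσ.2 ⟨hσ.1.1, h⟩
    rw [hz0 _ (by linarith), mul_zero]

theorem integral_rlIntegral_mul {β T : ℝ} (hβ : 0 < β) {w : ℝ → L2 n}
    (hw : ContinuousOn w (Icc 0 T)) {v : Space n → ℝ} (hv : MemLp v 2 volume) {t : ℝ}
    (ht : t ∈ Icc 0 T) : ∫ x, rlIntegral β w t x * v x =
      ∫ τ in 0..t, phi β (t - τ) * ∫ x, w τ x * v x := by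
  have hin : ∀ f : L2 n, ∫ x, f x * v x = inner ℝ (hv.toLp v) f := by
    intro f
    rw [L2.inner_def]
    refine integral_congr_ae ?_
    filter_upwards [hv.coeFn_toLp] with x hx
    rw [hx]; simp
  simp_rw [hin]
  have hφ : IntervalIntegrable (fun τ => phi β (t - τ)) volume 0 t := by
    have := (intervalIntegrable_phi hβ 0 t).comp_sub_left t
    simp only [sub_zero, sub_self] at this
    exact this.symm
  have hi : IntervalIntegrable (fun τ => phi β (t - τ) • w τ) volume 0 t := by
    refine hφ.smul_continuousOn ?_
    rw [uIcc_of_le ht.1]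
    exact hw.mono (Icc_subset_Icc_right ht.2)
  have := ContinuousLinearMap.intervalIntegral_comp_comm (innerSL ℝ (hv.toLp v)) hi
  simp only [innerSL_apply_apply, inner_smul_right] at this
  rw [this]
  rfl

end

section

variable {n : ℕ}

theorem IsSubsolution.neg {α s T K M : ℝ} {Ω : Set (Space n)} {u : ℝ → L2 n}
    {U b : ℝ × Space n → ℝ} (h : IsSubsolution α s T Ω K M u U b)
    (hext : ∀ᵐ t ∂(volume.restrict (Ioo 0 T)), ∀ᵐ x, x ∉ Ω → -M ≤ U (t, x))
    (hsrc : ∀ᵐ t ∂(volume.restrict (Ioo 0 T)), ∀ᵐ x ∂(volume.restrict Ω),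
      U (t, x) < 0 → -K ≤ b (t, x)) :
    IsSubsolution α s T Ω K M (fun t => -u t) (fun z => -U z) (fun z => -b z) where
  continuousOn := h.continuousOn.neg
  measurable := h.measurable.neg
  rep t ht := by
    filter_upwards [h.rep t ht, Lp.coeFn_neg (u t)] with x h1 h2
    rw [h2, Pi.neg_apply, ← h1]
  measurable_source := h.measurable_source.neg
  integrable_source := h.integrable_source.neg
  exterior := by
    filter_upwards [hext] with t ht
    filter_upwards [ht] with x hx hxΩ
    linarith [hx hxΩ]
  energy := by
    refine lt_of_eq_of_lt (lintegral_congr fun t => lintegral_congr fun p => ?_) h.energy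
    congr 2
    ring
  source_le := by
    filter_upwards [hsrc] with t ht
    filter_upwards [ht] with x hx hxU
    linarith [hx (by linarith)]
  equation v hv hvB hvs t ht := by
    have e : ∀ τ, fracLaplacianForm s (fun x => -U (τ, x)) v =
        -fracLaplacianForm s (fun x => U (τ, x)) v := by
      intro τ
      rw [fracLaplacianForm, fracLaplacianForm, ← mul_neg, ← integral_neg]
      congr 1
      refine integral_congr_ae (Filter.Eventually.of_forall fun p => ?_)
      simp only
      ring
    have h1 := h.equation v hv hvB hvs t ht
    simp only [neg_mul, integral_neg, e, mul_neg]
    rw [h1, ← integral_neg]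
    refine integral_congr_ae (Filter.Eventually.of_forall fun p => ?_)
    simp only
    ring

/-- A bounded function of `(x, t)` has a measurable version as a function of `(t, x)`. -/
theorem exists_measurable_version {T : ℝ} {Ω : Set (Space n)} (hΩf : volume Ω ≠ ⊤)
    {f : Space n × ℝ → ℝ} (hf : MemLp f ⊤ (volume.restrict (Ω ×ˢ Ioo 0 T))) :
    ∃ F : ℝ × Space n → ℝ, Measurable F ∧ IntegrableOn F (Ioo 0 T ×ˢ Ω) ∧
      ∀ᵐ t ∂(volume.restrict (Ioo 0 T)), ∀ᵐ x ∂(volume.restrict Ω), F (t, x) = f (x, t) ∧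
        |F (t, x)| ≤ (eLpNorm f ⊤ (volume.restrict (Ω ×ˢ Ioo 0 T))).toReal := by
  have hfin : IsFiniteMeasure (volume.restrict Ω) := ⟨by simpa using hΩf.lt_top⟩
  have hfin' : IsFiniteMeasure (volume.restrict (Ioo 0 T)) := ⟨by simp⟩
  set N := eLpNorm f ⊤ (volume.restrict (Ω ×ˢ Ioo 0 T)) with hN
  have hbd : ∀ᵐ z ∂(volume.restrict (Ω ×ˢ Ioo 0 T)), |f z| ≤ N.toReal := by
    filter_upwards [ae_le_eLpNormEssSup (f := f) (μ := volume.restrict (Ω ×ˢ Ioo 0 T))] with y hy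
    rw [← eLpNorm_exponent_top] at hy
    have := ENNReal.toReal_mono hf.eLpNorm_ne_top hy
    rwa [toReal_enorm, Real.norm_eq_abs] at this
  rw [Measure.volume_eq_prod, ← Measure.prod_restrict] at hf hbd
  have hsw : MeasurePreserving Prod.swap ((volume.restrict (Ioo 0 T)).prod (volume.restrict Ω))
      ((volume.restrict Ω).prod (volume.restrict (Ioo 0 T))) := Measure.measurePreserving_swap
  have hfs := hf.comp_measurePreserving hsw
  have hbs := hsw.quasiMeasurePreserving.ae hbd
  refine ⟨hfs.1.mk _, hfs.1.stronglyMeasurable_mk.measurable, ?_, ?_⟩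
  · rw [IntegrableOn, Measure.volume_eq_prod, ← Measure.prod_restrict]
    exact (hfs.integrable le_top).congr hfs.1.ae_eq_mk
  · have h : ∀ᵐ z ∂((volume.restrict (Ioo 0 T)).prod (volume.restrict Ω)),
        hfs.1.mk _ z = f (z.2, z.1) ∧ |hfs.1.mk _ z| ≤ N.toReal := by
      filter_upwards [hbs, hfs.1.ae_eq_mk] with z h1 h2
      rw [← h2]
      exact ⟨rfl, h1⟩
    exact Measure.ae_ae_of_ae_prod h

theorem powerNonlinearity_nonneg {m : ℕ} {a : Fin (m + 1) → Space n × ℝ → ℝ}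
    {b : Fin (m + 1) → ℝ} {x : Space n} {t z : ℝ} (ha : ∀ k, 0 ≤ a k (x, t)) (hz : 0 ≤ z) :
    0 ≤ powerNonlinearity a b x t z :=
  Finset.sum_nonneg fun k _ =>
    mul_nonneg (ha k) (mul_nonneg (Real.rpow_nonneg (abs_nonneg z) _) hz)

theorem powerNonlinearity_nonpos {m : ℕ} {a : Fin (m + 1) → Space n × ℝ → ℝ}
    {b : Fin (m + 1) → ℝ} {x : Space n} {t z : ℝ} (ha : ∀ k, 0 ≤ a k (x, t)) (hz : z ≤ 0) :
    powerNonlinearity a b x t z ≤ 0 :=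
  Finset.sum_nonpos fun k _ => mul_nonpos_of_nonneg_of_nonpos (ha k)
    (mul_nonpos_of_nonneg_of_nonpos (Real.rpow_nonneg (abs_nonneg z) _) hz)

theorem measurable_powerNonlinearity {m : ℕ} {a : Fin (m + 1) → Space n × ℝ → ℝ}
    {b : Fin (m + 1) → ℝ} {D : Set (Space n × ℝ)} (hD : MeasurableSet D)
    (ha : ∀ k, ContinuousOn (a k) D) {U : ℝ × Space n → ℝ} (hU : Measurable U) :
    Measurable fun z : ℝ × Space n =>
      powerNonlinearity (fun k => D.indicator (a k)) b z.2 z.1 (U z) := by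
  have h1 : ∀ k, Measurable (D.indicator (a k)) := fun k => by
    classical
    have : D.indicator (a k) = D.piecewise (a k) 0 := (piecewise_eq_indicator).symm
    rw [this]
    exact (ha k).measurable_piecewise continuousOn_const hD
  unfold powerNonlinearity
  refine Finset.measurable_sum _ fun k _ => ?_
  exact ((h1 k).comp (measurable_snd.prodMk measurable_fst)).mul (by fun_prop)

/-- Slices of a function on the space-time cylinder, tested with a bounded function. -/
theorem integrableOn_integral_mul {T : ℝ} {Ω : Set (Space n)} (hΩ : MeasurableSet Ω)
    {P : ℝ × Space n → ℝ} (hP : IntegrableOn P (Ioo 0 T ×ˢ Ω)) {v : Space n → ℝ}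
    (hv : Measurable v) {B : ℝ} (hB : ∀ x, |v x| ≤ B) :
    IntegrableOn (fun t => ∫ x in Ω, P (t, x) * v x) (Ioo 0 T) := by
  have hV : MemLp (fun z : ℝ × Space n => v z.2) ⊤ volume :=
    memLp_top_of_bound (hv.comp measurable_snd).aestronglyMeasurable B
      (Filter.Eventually.of_forall fun z => hB _)
  have hPi : MemLp ((Ioo 0 T ×ˢ Ω).indicator P) 1 volume := by
    rwa [memLp_one_iff_integrable, integrable_indicator_iff (measurableSet_Ioo.prod hΩ)]
  refine ((integrable_integral_mul 1 ⊤ hPi hV).integrableOn (s := Ioo 0 T)).congr_fun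
    (fun t ht => ?_) measurableSet_Ioo
  simp only
  rw [← integral_indicator hΩ]
  refine integral_congr_ae (Filter.Eventually.of_forall fun x => ?_)
  by_cases hx : x ∈ Ω
  · have : (t, x) ∈ Ioo 0 T ×ˢ Ω := ⟨ht, hx⟩
    simp only [indicator_of_mem hx, indicator_of_mem this]
  · have : (t, x) ∉ Ioo 0 T ×ˢ Ω := fun h => hx h.2
    simp only [indicator_of_notMem hx, indicator_of_notMem this, zero_mul]

open IsSubsolution in
theorem integrableOn_fracLaplacianForm {s T : ℝ} {U : ℝ × Space n → ℝ} (hU : Measurable U)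
    (hen : ∫⁻ t in Ioo 0 T, gagliardoSq s (fun x => U (t, x)) < ⊤) {v : Space n → ℝ}
    (hv : Measurable v) (hvs : gagliardoSq s v < ⊤) :
    IntegrableOn (fun t => fracLaplacianForm s (fun x => U (t, x)) v) (Ioo 0 T) := by
  have h2 := integrable_integral_mul 2 2 (memLp_quotExt hU hen)
    (memLp_quotExt_const (T := T) hv hvs)
  have h3 : IntegrableOn (fun t => fracConst n s / 2 * ∫ p, quotExt s T U (t, p) *
      quotExt s T (fun z => v z.2) (t, p)) (Ioo 0 T) := h2.integrableOn.const_mul _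
  refine h3.congr_fun
    (fun t ht => ?_) measurableSet_Ioo
  simp only [fracLaplacianForm_eq, quotExt, indicator_of_mem ht]

theorem integrated_equation {α s T : ℝ} {Ω : Set (Space n)} (hα : α ∈ Ioo (0 : ℝ) 1)
    (hT : 0 < T) (hΩ : MeasurableSet Ω) {u : ℝ → L2 n} (hu : ContinuousOn u (Icc 0 T))
    (hu0 : ∀ᵐ x ∂(volume.restrict Ω), u 0 x = 0) {U P Q : ℝ × Space n → ℝ} (hU : Measurable U)
    (hrep : ∀ t ∈ Icc 0 T, (fun x => U (t, x)) =ᵐ[volume] u t)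
    (hen : ∫⁻ t in Ioo 0 T, gagliardoSq s (fun x => U (t, x)) < ⊤)
    (hP : IntegrableOn P (Ioo 0 T ×ˢ Ω)) (hQ : IntegrableOn Q (Ioo 0 T ×ˢ Ω))
    {v : Space n → ℝ} (hv : Measurable v) {B : ℝ} (hB : ∀ x, |v x| ≤ B)
    (hvs : MemHsTilde s Ω v)
    (heq : ∀ ψ : ℝ → ℝ, ContDiff ℝ ∞ ψ → HasCompactSupport ψ → tsupport ψ ⊆ Ioo 0 T →
      -(∫ t in Ioo 0 T, deriv ψ t *
            ∫ x, rlIntegral (1 - α) (fun τ => u τ - u 0) t x * v x)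
        + (∫ t in Ioo 0 T, ψ t * fracLaplacianForm s (fun x => U (t, x)) v)
        + (∫ t in Ioo 0 T, ψ t * ∫ x in Ω, Q (t, x) * v x)
      = ∫ t in Ioo 0 T, ψ t * ∫ x in Ω, P (t, x) * v x) {t : ℝ} (ht : t ∈ Ioo 0 T) :
    ∫ τ in Ioo 0 t, phi (1 - α) (t - τ) * ∫ x, U (τ, x) * v x =
      ∫ τ in Ioo 0 t, ((∫ x in Ω, (P (τ, x) - Q (τ, x)) * v x) -
        fracLaplacianForm s (fun x => U (τ, x)) v) := by
  have hα' : 0 < 1 - α := by linarith [hα.2]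
  set y : ℝ → ℝ := fun τ => ∫ x, (u τ - u 0 : L2 n) x * v x with hy
  have hin : ∀ w : L2 n, ∫ x, w x * v x = inner ℝ (hvs.1.1.toLp v) w := by
    intro w
    rw [L2.inner_def]
    refine integral_congr_ae ?_
    filter_upwards [hvs.1.1.coeFn_toLp] with x hx
    rw [hx]; simp
  have hw : ContinuousOn (fun τ => u τ - u 0) (Icc 0 T) := hu.sub continuousOn_const
  have hyc : ContinuousOn y (Icc 0 T) := by
    simp only [hy, hin]
    exact continuousOn_const.inner hw
  have hy0 : y 0 = 0 := by simp only [hy, hin, sub_self, inner_zero_right]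
  have hyU : ∀ τ ∈ Icc 0 T, y τ = ∫ x, U (τ, x) * v x := by
    intro τ hτ
    refine integral_congr_ae ?_
    rw [ae_restrict_iff' hΩ] at hu0
    filter_upwards [hrep τ hτ, hu0, hvs.2, Lp.coeFn_sub (u τ) (u 0)] with x h1 h2 h3 h4
    rw [h4, Pi.sub_apply, ← h1]
    by_cases hx : x ∈ Ω
    · rw [h2 hx, sub_zero]
    · rw [h3 hx, mul_zero, mul_zero]
  have iP := integrableOn_integral_mul hΩ hP hv hB
  have iQ := integrableOn_integral_mul hΩ hQ hv hB
  have iL := integrableOn_fracLaplacianForm hU hen hv hvs.1.2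
  have iF : IntegrableOn (fun τ => (∫ x in Ω, P (τ, x) * v x) - (∫ x in Ω, Q (τ, x) * v x) -
      fracLaplacianForm s (fun x => U (τ, x)) v) (Ioo 0 T) := (iP.sub iQ).sub iL
  have key := eq_primitive_of_weak_deriv hT (continuousOn_phi_conv hα' hT.le hyc hy0)
    (by simp) iF ?_ t (Ioo_subset_Icc_self ht)
  · rw [← setIntegral_Ioo_eq_intervalIntegral ht.1.le] at key
    have hsub : Ioo 0 t ⊆ Ioo 0 T := Ioo_subset_Ioo_right ht.2.le
    have e1 : ∫ τ in Ioo 0 t, phi (1 - α) (t - τ) * ∫ x, U (τ, x) * v x =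
        ∫ τ in Ioo 0 t, phi (1 - α) (t - τ) * y τ :=
      setIntegral_congr_fun measurableSet_Ioo fun τ hτ => by
        simp only [hyU τ (Ioo_subset_Icc_self (hsub hτ))]
    rw [e1, key]
    refine integral_congr_ae ?_
    have hsl : ∀ {R : ℝ × Space n → ℝ}, IntegrableOn R (Ioo 0 T ×ˢ Ω) →
        ∀ᵐ τ ∂(volume.restrict (Ioo 0 t)), IntegrableOn (fun x => R (τ, x) * v x) Ω := by
      intro R hR
      rw [IntegrableOn, Measure.volume_eq_prod, ← Measure.prod_restrict] at hR
      filter_upwards [ae_restrict_of_ae_restrict_of_subset hsub hR.prod_right_ae] with τ hτ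
      exact hτ.mul_bdd hv.aestronglyMeasurable (Filter.Eventually.of_forall fun x => hB x)
    filter_upwards [hsl hP, hsl hQ] with τ h1 h2
    simp only [sub_mul]
    rw [integral_sub h1 h2]
  · intro ψ hψ hψc hψs
    have h := heq ψ hψ hψc hψs
    obtain ⟨C, hC⟩ := hψ.continuous.bounded_above_of_compact_support hψc
    have hm : ∀ {R : ℝ → ℝ}, IntegrableOn R (Ioo 0 T) →
        IntegrableOn (fun t => ψ t * R t) (Ioo 0 T) := fun hR =>
      hR.bdd_mul hψ.continuous.aestronglyMeasurable (Filter.Eventually.of_forall hC)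
    have e1 : ∫ t in Ioo 0 T, deriv ψ t * ∫ τ in 0..t, phi (1 - α) (t - τ) * y τ =
        ∫ t in Ioo 0 T, deriv ψ t *
          ∫ x, rlIntegral (1 - α) (fun τ => u τ - u 0) t x * v x :=
      setIntegral_congr_fun measurableSet_Ioo fun r hr => by
        simp only [hy, integral_rlIntegral_mul hα' hw hvs.1.1 (Ioo_subset_Icc_self hr)]
    have iPQ : IntegrableOn (fun t => ψ t * (∫ x in Ω, P (t, x) * v x) -
        ψ t * ∫ x in Ω, Q (t, x) * v x) (Ioo 0 T) := (hm iP).sub (hm iQ)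
    rw [e1]
    simp only [mul_sub]
    rw [integral_sub iPQ (hm iL), integral_sub (hm iP) (hm iQ)]
    linarith

end

section

variable {n : ℕ}

/-- A solution satisfies the integrated equation with source `f - a(x,t,u)`. -/
theorem IsSolution.exists_isSubsolution (hn : 1 ≤ n) {α s T : ℝ} (hα : α ∈ Ioo (0 : ℝ) 1)
    (hs : s ∈ Ioo (0 : ℝ) 1) (hT : 0 < T) {Ω : Set (Space n)} (hΩ : MeasurableSet Ω)
    (hΩf : volume Ω ≠ ⊤) {m : ℕ} {a : Fin (m + 1) → Space n × ℝ → ℝ} {b : Fin (m + 1) → ℝ}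
    (ha : ∀ k, ContinuousOn (a k) (closure Ω ×ˢ Icc 0 T))
    (ha0 : ∀ k, ∀ p ∈ closure Ω ×ˢ Icc (0 : ℝ) T, 0 ≤ a k p) {f g : Space n × ℝ → ℝ}
    (hf : MemLp f ⊤ (volume.restrict (Ω ×ˢ Ioo 0 T))) (hg : ContDiff ℝ ∞ g)
    (hgc : HasCompactSupport g) {M : ℝ} (hgM : ∀ p, |g p| ≤ M) {u : ℝ → L2 n}
    (hu : IsSolution α s T Ω (powerNonlinearity a b) f g u) :
    ∃ U B : ℝ × Space n → ℝ,
      IsSubsolution α s T Ω (eLpNorm f ⊤ (volume.restrict (Ω ×ˢ Ioo 0 T))).toReal M u U B ∧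
      IsSubsolution α s T Ω (eLpNorm f ⊤ (volume.restrict (Ω ×ˢ Ioo 0 T))).toReal M
        (fun t => -u t) (fun z => -U z) (fun z => -B z) := by
  obtain ⟨U, hU, hrep⟩ := exists_measurable_rep hu.continuousOn
  obtain ⟨F, hF, hFi, hFf⟩ := exists_measurable_version hΩf hf
  set K := (eLpNorm f ⊤ (volume.restrict (Ω ×ˢ Ioo 0 T))).toReal with hK
  set D := closure Ω ×ˢ Icc (0 : ℝ) T with hD
  have hDm : MeasurableSet D := isClosed_closure.measurableSet.prod measurableSet_Icc
  set Q : ℝ × Space n → ℝ := fun z =>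
    powerNonlinearity (fun k => D.indicator (a k)) b z.2 z.1 (U z) with hQ
  have hQm : Measurable Q := measurable_powerNonlinearity hDm ha hU
  have hsub : Ioo 0 T ⊆ Icc 0 T := Ioo_subset_Icc_self
  have hDa : ∀ {t : ℝ} {x : Space n}, t ∈ Ioo 0 T → x ∈ Ω → ∀ k,
      D.indicator (a k) (x, t) = a k (x, t) := fun ht hx _ =>
    indicator_of_mem (mk_mem_prod (subset_closure hx) (hsub ht)) _
  have hQu : ∀ t ∈ Ioo 0 T, ∀ᵐ x ∂(volume.restrict Ω),
      Q (t, x) = powerNonlinearity a b x t (u t x) := by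
    intro t ht
    filter_upwards [ae_restrict_of_ae (hrep t (hsub ht)), ae_restrict_mem hΩ] with x hx hxΩ
    simp only [hQ, powerNonlinearity, hDa ht hxΩ, hx]
  have hQi : IntegrableOn Q (Ioo 0 T ×ˢ Ω) := by
    refine ⟨hQm.aestronglyMeasurable, ?_⟩
    rw [HasFiniteIntegral, Measure.volume_eq_prod, ← Measure.prod_restrict,
      lintegral_prod _ (by fun_prop)]
    refine lt_of_eq_of_lt ?_ hu.nonlinearity
    refine setLIntegral_congr_fun measurableSet_Ioo fun t ht => lintegral_congr_ae ?_
    filter_upwards [hQu t ht] with x hx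
    rw [hx]
  have hform : ∀ v : Space n → ℝ, ∀ t ∈ Ioo 0 T,
      fracLaplacianForm s (fun x => U (t, x)) v = fracLaplacianForm s (u t) v :=
    fun v t ht => fracLaplacianForm_congr (hrep t (hsub ht)) Filter.EventuallyEq.rfl
  have hen : ∫⁻ t in Ioo 0 T, gagliardoSq s (fun x => U (t, x)) < ⊤ := by
    refine lt_of_eq_of_lt (setLIntegral_congr_fun measurableSet_Ioo fun t ht => ?_)
      (lintegral_gagliardoSq_lt_top hn hs hg hgc hu.energy)
    exact gagliardoSq_congr (hrep t (hsub ht))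
  have hext : ∀ᵐ t ∂(volume.restrict (Ioo 0 T)), ∀ᵐ x, x ∉ Ω → |U (t, x)| ≤ M := by
    filter_upwards [hu.exterior, ae_restrict_mem measurableSet_Ioo] with t h1 ht
    filter_upwards [h1.2, hrep t (hsub ht)] with x h2 h3 hx
    rw [h3, sub_eq_zero.1 (h2 hx)]
    exact hgM _
  have hsign : ∀ᵐ t ∂(volume.restrict (Ioo 0 T)), ∀ᵐ x ∂(volume.restrict Ω),
      |F (t, x)| ≤ K ∧ ∀ k, 0 ≤ D.indicator (a k) (x, t) := by
    filter_upwards [hFf, ae_restrict_mem measurableSet_Ioo] with t h1 ht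
    filter_upwards [h1] with x hx
    exact ⟨hx.2, fun k => indicator_nonneg (ha0 k) _⟩
  have hsol : IsSubsolution α s T Ω K M u U (fun z => F z - Q z) := by
    refine ⟨hu.continuousOn, hU, hrep, hF.sub hQm, hFi.sub hQi, ?_, hen, ?_, ?_⟩
    · filter_upwards [hext] with t ht
      filter_upwards [ht] with x hx hxΩ
      exact (abs_le.1 (hx hxΩ)).2
    · filter_upwards [hsign] with t ht
      filter_upwards [ht] with x hx hxU
      linarith [(abs_le.1 hx.1).2, powerNonlinearity_nonneg (b := b) hx.2 hxU.le]
    · intro v hv hvB hvs t ht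
      refine integrated_equation hα hT hΩ hu.continuousOn hu.initial hU hrep hen hFi hQi hv hvB
        hvs (fun ψ hψ hψc hψs => ?_) ht
      have h := hu.equation v hvs (memLp_top_of_bound hv.aestronglyMeasurable 1
        (Filter.Eventually.of_forall hvB)) ψ hψ hψc hψs
      have e1 : ∫ t in Ioo 0 T, ψ t * fracLaplacianForm s (fun x => U (t, x)) v =
          ∫ t in Ioo 0 T, ψ t * fracLaplacianForm s (u t) v :=
        setIntegral_congr_fun measurableSet_Ioo fun t ht => by simp only [hform v t ht]
      have e2 : ∫ t in Ioo 0 T, ψ t * ∫ x in Ω, Q (t, x) * v x =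
          ∫ t in Ioo 0 T, ψ t * ∫ x in Ω, powerNonlinearity a b x t (u t x) * v x :=
        setIntegral_congr_fun measurableSet_Ioo fun t ht =>
          congrArg (ψ t * ·) (integral_congr_ae ((hQu t ht).mono fun x hx => by simp only [hx]))
      have e3 : ∫ t in Ioo 0 T, ψ t * ∫ x in Ω, F (t, x) * v x =
          ∫ t in Ioo 0 T, ψ t * ∫ x in Ω, f (x, t) * v x :=
        integral_congr_ae (hFf.mono fun t ht =>
          congrArg (ψ t * ·) (integral_congr_ae (ht.mono fun x hx => by simp only [hx.1])))
      rw [e1, e2, e3]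
      exact h
  refine ⟨U, _, hsol, hsol.neg ?_ ?_⟩
  · filter_upwards [hext] with t ht
    filter_upwards [ht] with x hx hxΩ
    exact (abs_le.1 (hx hxΩ)).1
  · filter_upwards [hsign] with t ht
    filter_upwards [ht] with x hx hxU
    linarith [(abs_le.1 hx.1).1, powerNonlinearity_nonpos (b := b) hx.2 hxU.le]

theorem IsSubsolution.ae_abs_le {α s T K M : ℝ} {Ω : Set (Space n)} {u : ℝ → L2 n}
    {U b : ℝ × Space n → ℝ} (h : IsSubsolution α s T Ω K M u U b)
    (h' : IsSubsolution α s T Ω K M (fun t => -u t) (fun z => -U z) (fun z => -b z))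
    (hΩ : MeasurableSet Ω) (hΩf : volume Ω ≠ ⊤) (hα : α ∈ Ioo (0 : ℝ) 1)
    (hs : s ∈ Ioo (0 : ℝ) 1) (hK : 0 ≤ K) (hM : 0 ≤ M) (hT : 0 < T) :
    ∀ t ∈ Icc 0 T, ∀ᵐ x, |u t x| ≤ T ^ α / Real.Gamma (α + 1) * K + M := by
  have hΓ : 0 < Real.Gamma (α + 1) := Real.Gamma_pos_of_pos (by linarith [hα.1])
  have hφ : ∀ t ∈ Ioo 0 T, K * phi (1 + α) t + M ≤ T ^ α / Real.Gamma (α + 1) * K + M := by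
    intro t ht
    have : phi (1 + α) t ≤ T ^ α / Real.Gamma (α + 1) := by
      rw [phi, add_sub_cancel_left, add_comm 1 α]
      exact div_le_div_of_nonneg_right (Real.rpow_le_rpow ht.1.le ht.2.le hα.1.le) hΓ.le
    nlinarith
  have hMC : M ≤ T ^ α / Real.Gamma (α + 1) * K + M :=
    le_add_of_nonneg_left (mul_nonneg (div_nonneg (Real.rpow_nonneg hT.le _) hΓ.le) hK)
  refine forall_mem_of_ae_mem hT h.continuousOn
    (isClosed_setOf_ae_abs_le (n := n) (T ^ α / Real.Gamma (α + 1) * K + M)) ?_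
  filter_upwards [h.le_barrier hΩ hΩf hα hs hK hM hT, h'.le_barrier hΩ hΩf hα hs hK hM hT,
    h.exterior, h'.exterior, ae_restrict_mem measurableSet_Ioo] with t h1 h2 h3 h4 ht
  rw [ae_restrict_iff' hΩ] at h1 h2
  filter_upwards [h1, h2, h3, h4, h.rep t (Ioo_subset_Icc_self ht)] with x h1 h2 h3 h4 h5
  rw [← h5, abs_le]
  have := hφ t ht
  by_cases hx : x ∈ Ω
  · exact ⟨by linarith [h2 hx], by linarith [h1 hx]⟩
  · exact ⟨by linarith [h4 hx], by linarith [h3 hx]⟩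

end

end SpaceTimeFrac

end

theorem proposition4p1 (n : ℕ) (hn : 2 ≤ n) (α s T : ℝ)
    (hα : α ∈ Ioo (0 : ℝ) 1) (hs : s ∈ Ioo (0 : ℝ) 1) (hT : 0 < T)
    (Ω : Set (SpaceTimeFrac.Space n)) (hΩ : SpaceTimeFrac.IsSmoothBoundedDomain Ω)
    (m : ℕ) (a : Fin (m + 1) → SpaceTimeFrac.Space n × ℝ → ℝ) (b : Fin (m + 1) → ℝ)
    (ha_smooth : ∀ k, ContDiffOn ℝ ∞ (a k) (closure Ω ×ˢ Icc 0 T))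
    (ha_nonneg : ∀ k, ∀ p ∈ closure Ω ×ˢ Icc (0 : ℝ) T, 0 ≤ a k p)
    (hb_zero : b 0 = 0) (hb : StrictMono b)
    (f : SpaceTimeFrac.Space n × ℝ → ℝ)
    (hf : MemLp f ⊤ (volume.restrict (Ω ×ˢ Ioo 0 T)))
    (g : SpaceTimeFrac.Space n × ℝ → ℝ) (hg_smooth : ContDiff ℝ ∞ g)
    (hg_compact : HasCompactSupport g) (hg_supp : tsupport g ⊆ (closure Ω)ᶜ ×ˢ Ioo 0 T)
    (u : ℝ → SpaceTimeFrac.L2 n)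
    (hu : SpaceTimeFrac.IsSolution α s T Ω (SpaceTimeFrac.powerNonlinearity a b) f g u) :
    ∀ t ∈ Icc 0 T, eLpNorm (u t) ⊤ volume ≤
      ENNReal.ofReal (T ^ α / Real.Gamma (α + 1)) * eLpNorm f ⊤ (volume.restrict (Ω ×ˢ Ioo 0 T))
        + eLpNorm g ⊤ (volume.restrict ((closure Ω)ᶜ ×ˢ Ioo 0 T)) := by

  intro t ht
  have hΩm := hΩ.isOpen.measurableSet
  have hΩf : volume Ω ≠ ⊤ := hΩ.isBounded.measure_lt_top.ne
  have hS : IsOpen ((closure Ω)ᶜ ×ˢ Ioo (0 : ℝ) T) :=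
    isClosed_closure.isOpen_compl.prod isOpen_Ioo
  have hgfin : eLpNorm g ⊤ (volume.restrict ((closure Ω)ᶜ ×ˢ Ioo 0 T)) ≠ ⊤ := by
    obtain ⟨C, hC⟩ := hg_smooth.continuous.bounded_above_of_compact_support hg_compact
    exact (memLp_top_of_bound hg_smooth.continuous.aestronglyMeasurable C
      (Filter.Eventually.of_forall hC)).eLpNorm_ne_top
  have hgM := SpaceTimeFrac.abs_le_toReal_eLpNorm_top hg_smooth.continuous hS hgfin
    fun p hp => image_eq_zero_of_notMem_tsupport fun h => hp (hg_supp h)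
  obtain ⟨U, B, h1, h2⟩ := hu.exists_isSubsolution (by omega) hα hs hT hΩm hΩf
    (fun k => (ha_smooth k).continuousOn) ha_nonneg hf hg_smooth hg_compact hgM
  have h3 := h1.ae_abs_le h2 hΩm hΩf hα hs ENNReal.toReal_nonneg ENNReal.toReal_nonneg hT t ht
  have hΓ : 0 ≤ T ^ α / Real.Gamma (α + 1) :=
    div_nonneg (Real.rpow_nonneg hT.le _) (Real.Gamma_pos_of_pos (by linarith [hα.1])).le
  rw [eLpNorm_exponent_top]
  refine (eLpNormEssSup_le_of_ae_bound (f := u t) h3).trans_eq ?_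
  rw [ENNReal.ofReal_add (mul_nonneg hΓ ENNReal.toReal_nonneg) ENNReal.toReal_nonneg,
    ENNReal.ofReal_mul hΓ, ENNReal.ofReal_toReal hf.eLpNorm_ne_top,
    ENNReal.ofReal_toReal hgfin]
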